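/- **Theorem (Decomposition).** Let $\mathbb K$ be a commutative noetherian ring and $X$ a separated smooth $\mathbb K$-scheme of relative dimension $n$, such that $n!$ is invertible in $\mathbb K$. *Notation.* For a commutative $\mathbb K$-algebra $A$ and $q\ge 0$ let $\mathcal B_q(A)=A^{\otimes(q+2)}$ (tensor products over $\mathbb K$), let $I_q$ be the kernel of the multiplication $\mathcal B_q(A)\to A$, let $\widehat{\mathcal B}_q(A)$ be the $I_q$-adic completion of $\mathcal B_q(A)$, and let $\widehat{\mathcal C}_q(A)=\widehat{\mathcal B}_q(A)\otimes_{A\otimes A}A$ with the $I_q$-adic topology, where $a\otimes b\in A\otimes A$ acts on $\mathcal B_q(A)$ as $a\otimes1\otimes\cdots\otimes1\otimes b$. The continuous $A$-linear maps $\partial:\widehat{\mathcal C}_{q}(A)\to\widehat{\mathcal C}_{q-1}(A)$ induced by $$\partial(a_0\otimes\cdots\otimes a_{q+1})=\sum_{i=0}^{q}(-1)^i\,a_0\otimes\cdots\otimes a_ia_{i+1}\otimes\cdots\otimes a_{q+1}$$ make $\widehat{\mathcal C}(A)$ a complex, with $\widehat{\mathcal C}_q(A)$ in cohomological degree $-q$.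 The continuous $A$-linear maps $$\pi:\widehat{\mathcal C}_q(A)\to\Omega^q_{A/\mathbb K},\qquad \pi\bigl((1\otimes a_1\otimes\cdots\otimes a_q\otimes 1)\otimes1\bigr)=\mathrm da_1\wedge\cdots\wedge\mathrm da_q$$ (where $\Omega^q_{A/\mathbb K}$ is discrete) form a homomorphism of complexes $\widehat{\mathcal C}(A)\to\bigoplus_q\Omega^q_{A/\mathbb K}[q]$, the target having zero differential. Let $\pi:\widehat{\mathcal C}(X)\to\bigoplus_q\Omega^q_{X/\mathbb K}[q]$ be the homomorphism of complexes of topological $\mathcal O_X$-modules that is given by these maps over every affine open set $\operatorname{Spec}A\subset X$; here $\Gamma(\operatorname{Spec}A,\widehat{\mathcal C}_q(X))=\widehat{\mathcal C}_q(A)$. For an $\mathcal O_X$-module $\mathcal N$ let $\mathcal Hom^{\mathrm{cont}}_{\mathcal O_X}(\widehat{\mathcal C}_q(X),\mathcal N)$ be the sheaf of $\mathcal O_X$-linear homomorphisms that are continuous for the adic topology on $\widehat{\mathcal C}_q(X)$ and the discrete topology on $\mathcal N$. For a complex $\mathcal M$ of $\mathcal O_X$-modules, $\mathcal Hom^{\mathrm{cont}}_{\mathcal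 O_X}(\widehat{\mathcal C}(X),\mathcal M)$ is the usual complex of homomorphisms: its term of degree $k$ is $\prod_{q\ge0}\mathcal Hom^{\mathrm{cont}}_{\mathcal O_X}(\widehat{\mathcal C}_q(X),\mathcal M^{k-q})$ and its differential is $\phi\mapsto d_{\mathcal M}\phi-(-1)^k\phi\,\partial$; similarly for $\mathcal Hom_{\mathcal O_X}(\bigoplus_q\Omega^q_{X/\mathbb K}[q],\mathcal M)$. *Statement.* 1. For every (not necessarily bounded, not necessarily quasi-coherent) complex $\mathcal M$ of $\mathcal O_X$-modules the homomorphism of complexes of $\mathcal O_X$-modules $$\mathcal Hom_{\mathcal O_X}\Bigl(\bigoplus_q\Omega^q_{X/\mathbb K}[q],\mathcal M\Bigr)\longrightarrow\mathcal Hom^{\mathrm{cont}}_{\mathcal O_X}\bigl(\widehat{\mathcal C}(X),\mathcal M\bigr)$$ induced by $\pi$ is a quasi-isomorphism. 2. Let $\mathcal T_X=\mathcal Hom_{\mathcal O_X}(\Omega^1_{X/\mathbb K},\mathcal O_X)$, and let $\mathcal C_{\mathrm{cd}}(X)=\mathcal Hom^{\mathrm{cont}}_{\mathcal O_X}(\widehat{\mathcal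 C}(X),\mathcal O_X)$, with terms $\mathcal C^q_{\mathrm{cd}}(X)=\mathcal Hom^{\mathrm{cont}}_{\mathcal O_X}(\widehat{\mathcal C}_q(X),\mathcal O_X)$. The homomorphism of complexes $$\pi_{\mathrm{cd}}:\bigoplus_q\Bigl(\bigwedge\nolimits^q\mathcal T_X\Bigr)[-q]\longrightarrow\mathcal C_{\mathrm{cd}}(X)$$ (the source having zero differential) that is given on affine open sets by $$\pi_{\mathrm{cd}}(v_1\wedge\cdots\wedge v_q)(1\otimes a_1\otimes\cdots\otimes a_q\otimes1)=\sum_{\sigma\in\Sigma_q}\operatorname{sgn}(\sigma)\,v_{\sigma(1)}(a_1)\cdots v_{\sigma(q)}(a_q)$$ (a section $v$ of $\mathcal T_X$ being regarded as the derivation $a\mapsto v(\mathrm da)$) is a quasi-isomorphism. -/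

import Mathlib

universe u

namespace CompleteHochschild
open TensorProduct

noncomputable section

section Bar
variable (K A : Type u) [CommRing K] [CommRing A] [Algebra K A]

/-- The ring `B_q(A) = A ⊗_K ⋯ ⊗_K A` with `q + 2` tensor factors, numbered `0, …, q + 1`. -/
abbrev Bar (q : ℕ) : Type u := ⨂[K] (_ : Fin (q + 2)), A

/-- The embedding `a ↦ 1 ⊗ ⋯ ⊗ a ⊗ ⋯ ⊗ 1` of `A` as the `i`-th tensor factor of `B_q(A)`. -/
def slot (q : ℕ) (i : Fin (q + 2)) : A →ₐ[K] Bar K A q :=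
  PiTensorProduct.singleAlgHom (R := K) (A := fun _ : Fin (q + 2) => A) i

/-- The multiplication `B_q(A) → A`, `a₀ ⊗ ⋯ ⊗ a_{q+1} ↦ a₀ ⋯ a_{q+1}`. -/
def barMul (q : ℕ) : Bar K A q →ₐ[K] A :=
  PiTensorProduct.liftAlgHom (MultilinearMap.mkPiAlgebra K (Fin (q + 2)) A)
    (by simp) (fun x y => by simp [Finset.prod_mul_distrib])

/-- The ideal `I_q = Ker(B_q(A) → A)`. -/
def barIdeal (q : ℕ) : Ideal (Bar K A q) := RingHom.ker (barMul K A q)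

variable {A}
variable {A' : Type u} [CommRing A'] [Algebra K A']

/-- The ring homomorphism `B_q(A) → B_r(A')` that maps the `i`-th tensor factor `A` to the
`σ(i)`-th tensor factor `A'` by `g`. For `g = id` and `r = q - 1`, with `σ` the monotone surjection
that takes the value `i` twice, it is the face
`a₀ ⊗ ⋯ ⊗ a_{q+1} ↦ a₀ ⊗ ⋯ ⊗ a_i a_{i+1} ⊗ ⋯ ⊗ a_{q+1}`. -/
def barMap {q r : ℕ} (g : A →ₐ[K] A') (σ : Fin (q + 2) → Fin (r + 2)) :
    Bar K A q →ₐ[K] Bar K A' r :=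
  PiTensorProduct.liftAlgHom
    ((MultilinearMap.mkPiAlgebra K (Fin (q + 2)) (Bar K A' r)).compLinearMap
      (fun i => ((slot K A' r (σ i)).comp g).toLinearMap))
    (by simp) (fun x y => by simp [Finset.prod_mul_distrib])

theorem tprod_eq_prod {q : ℕ} (a : Fin (q + 2) → A) :
    PiTensorProduct.tprod K a = ∏ i, slot K A q i (a i) := by
  have h := PiTensorProduct.tprod_prod (R := K) (A := fun _ : Fin (q+2) => A) Finset.univ
    (fun i => Pi.mulSingle i (a i))
  rw [Finset.univ_prod_mulSingle] at h
  exact h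

theorem barMul_slot {q : ℕ} (i : Fin (q + 2)) (a : A) : barMul K A q (slot K A q i a) = a := by
  have : barMul K A q (slot K A q i a) = ∏ j, (Pi.mulSingle i a : Fin (q+2) → A) j := by
    exact (PiTensorProduct.lift.tprod (R := K) (φ := MultilinearMap.mkPiAlgebra K (Fin (q + 2)) A)
      (Pi.mulSingle i a)).trans (MultilinearMap.mkPiAlgebra_apply _)
  rw [this]; simp

theorem barMap_slot {q r : ℕ} (g : A →ₐ[K] A') (σ : Fin (q + 2) → Fin (r + 2)) (i : Fin (q + 2))
    (a : A) : barMap K g σ (slot K A q i a) = slot K A' r (σ i) (g a) := by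
  have : barMap K g σ (slot K A q i a)
      = ∏ j, slot K A' r (σ j) (g ((Pi.mulSingle i a : Fin (q+2) → A) j)) := by
    simp [barMap, slot]
  rw [this, Finset.prod_eq_single i]
  · simp
  · intro j _ hj; simp [Pi.mulSingle_eq_of_ne hj]
  · simp

theorem barMul_barMap {q r : ℕ} (g : A →ₐ[K] A') (σ : Fin (q + 2) → Fin (r + 2))
    (x : Bar K A q) : barMul K A' r (barMap K g σ x) = g (barMul K A q x) := by
  have : (barMul K A' r).comp (barMap K g σ) = g.comp (barMul K A q) := by
    apply PiTensorProduct.algHom_ext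
    intro i; ext a
    change barMul K A' r (barMap K g σ (slot K A q i a)) = g (barMul K A q (slot K A q i a))
    rw [barMap_slot, barMul_slot, barMul_slot]
  exact DFunLike.congr_fun this x

theorem barIdeal_le_comap {q r : ℕ} (g : A →ₐ[K] A') (σ : Fin (q + 2) → Fin (r + 2)) :
    barIdeal K A q ≤ (barIdeal K A' r).comap (barMap K g σ : Bar K A q →+* Bar K A' r) := by
  intro x hx
  rw [barIdeal, RingHom.mem_ker] at hx
  simp only [barIdeal, Ideal.mem_comap, RingHom.mem_ker]
  rw [show barMul K A' r ((barMap K g σ : Bar K A q →+* Bar K A' r) x) = _ from barMul_barMap K g σ x, hx, map_zero]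

theorem barMap_comp {A'' : Type u} [CommRing A''] [Algebra K A''] {q r s : ℕ}
    (g' : A' →ₐ[K] A'') (g : A →ₐ[K] A') (τ : Fin (r + 2) → Fin (s + 2))
    (σ : Fin (q + 2) → Fin (r + 2)) :
    (barMap K g' τ).comp (barMap K g σ) = barMap K (g'.comp g) (τ ∘ σ) := by
  apply PiTensorProduct.algHom_ext
  intro i; ext a
  change barMap K g' τ (barMap K g σ (slot K A q i a)) = barMap K _ _ (slot K A q i a)
  simp [barMap_slot]

theorem barMap_id {q : ℕ} : barMap K (AlgHom.id K A) (id : Fin (q+2) → Fin (q+2)) = AlgHom.id K _ := by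
  apply PiTensorProduct.algHom_ext
  intro i; ext a
  change barMap K _ _ (slot K A q i a) = slot K A q i a
  simp [barMap_slot]

variable (A)
/-- The map `(a₀, …, a_{q+1}) ↦ a₀ a_{q+1} da₁ ∧ ⋯ ∧ da_q`. -/
def wedgeD (q : ℕ) : MultilinearMap K (fun _ : Fin (q + 2) => A) (⋀[A]^q Ω[A⁄K]) where
  toFun a := (a 0 * a (Fin.last (q + 1))) •
    exteriorPower.ιMulti A q (fun i : Fin q => KaehlerDifferential.D K A (a i.castSucc.succ))
  map_update_add' {dec} a j x y := by
    obtain rfl : dec = instDecidableEqFin _ := Subsingleton.elim _ _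
    have h0 : (0 : Fin (q + 2)) ≠ Fin.last (q + 1) := (Fin.last_pos).ne
    induction j using Fin.cases with
    | zero =>
      have h1 : ∀ i : Fin q, i.castSucc.succ ≠ (0 : Fin (q + 2)) := fun i => Fin.succ_ne_zero _
      simp [Function.update_of_ne, h0.symm, h1, add_mul, add_smul]
    | succ j =>
    induction j using Fin.lastCases with
    | last =>
      have h1 : ∀ i : Fin q, i.castSucc ≠ Fin.last q := fun i => (Fin.castSucc_lt_last i).ne
      simp [Function.update_of_ne, h0, h1, mul_add, add_smul]
    | cast j =>
      have key : ∀ z : A, (fun i : Fin q => KaehlerDifferential.D K A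
          (Function.update a j.castSucc.succ z i.castSucc.succ)) =
          Function.update (fun i : Fin q => KaehlerDifferential.D K A (a i.castSucc.succ)) j
            (KaehlerDifferential.D K A z) := by
        intro z; ext i; by_cases h : i = j
        · subst h; simp
        · simp [Function.update_of_ne, h]
      have h1 : (0 : Fin (q + 2)) ≠ j.castSucc.succ := (Fin.succ_ne_zero _).symm
      have h2 : Fin.last (q + 1) ≠ j.castSucc.succ := by
        rw [← Fin.succ_last, Ne, Fin.succ_inj]; exact (Fin.castSucc_lt_last j).ne'
      simp only [key, Function.update_of_ne h1, Function.update_of_ne h2, map_add,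
        AlternatingMap.map_update_add, smul_add]
  map_update_smul' {dec} a j c x := by
    obtain rfl : dec = instDecidableEqFin _ := Subsingleton.elim _ _
    have h0 : (0 : Fin (q + 2)) ≠ Fin.last (q + 1) := (Fin.last_pos).ne
    induction j using Fin.cases with
    | zero =>
      have h1 : ∀ i : Fin q, i.castSucc.succ ≠ (0 : Fin (q + 2)) := fun i => Fin.succ_ne_zero _
      simp [Function.update_of_ne, h0.symm, h1]
    | succ j =>
    induction j using Fin.lastCases with
    | last =>
      have h1 : ∀ i : Fin q, i.castSucc ≠ Fin.last q := fun i => (Fin.castSucc_lt_last i).ne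
      simp [Function.update_of_ne, h0, h1]
    | cast j =>
      have key : ∀ z : A, (fun i : Fin q => KaehlerDifferential.D K A
          (Function.update a j.castSucc.succ z i.castSucc.succ)) =
          Function.update (fun i : Fin q => KaehlerDifferential.D K A (a i.castSucc.succ)) j
            (KaehlerDifferential.D K A z) := by
        intro z; ext i; by_cases h : i = j
        · subst h; simp
        · simp [Function.update_of_ne, h]
      have h1 : (0 : Fin (q + 2)) ≠ j.castSucc.succ := (Fin.succ_ne_zero _).symm
      have h2 : Fin.last (q + 1) ≠ j.castSucc.succ := by
        rw [← Fin.succ_last, Ne, Fin.succ_inj]; exact (Fin.castSucc_lt_last j).ne'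
      simp only [key, Function.update_of_ne h1, Function.update_of_ne h2]
      rw [Derivation.map_smul, ← algebraMap_smul A c (KaehlerDifferential.D K A x),
        AlternatingMap.map_update_smul, smul_comm, algebraMap_smul]

/-- The map `B_q(A) → Ω^q_{A/K}`, `a₀ ⊗ ⋯ ⊗ a_{q+1} ↦ a₀ a_{q+1} da₁ ∧ ⋯ ∧ da_q`. -/
def barPi (q : ℕ) : Bar K A q →ₗ[K] ⋀[A]^q Ω[A⁄K] := PiTensorProduct.lift (wedgeD K A q)

theorem barPi_tprod {q : ℕ} (a : Fin (q + 2) → A) :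
    barPi K A q (PiTensorProduct.tprod K a) = (a 0 * a (Fin.last (q + 1))) •
      exteriorPower.ιMulti A q (fun i : Fin q => KaehlerDifferential.D K A (a i.castSucc.succ)) :=
  PiTensorProduct.lift.tprod _

theorem slot_mul_tprod {q : ℕ} (i : Fin (q + 2)) (c : A) (a : Fin (q + 2) → A) :
    slot K A q i c * PiTensorProduct.tprod K a =
      PiTensorProduct.tprod K (Function.update a i (c * a i)) := by
  have : slot K A q i c = PiTensorProduct.tprod K (Pi.mulSingle i c : Fin (q + 2) → A) := rfl
  rw [this, PiTensorProduct.tprod_mul_tprod]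
  congr 1
  ext j
  by_cases h : j = i
  · subst h; simp
  · simp [h]

variable {A}
theorem bar_induction {q : ℕ} {P : Bar K A q → Prop} (x : Bar K A q)
    (ht : ∀ a : Fin (q + 2) → A, P (PiTensorProduct.tprod K a))
    (hs : ∀ (c : K) x, P x → P (c • x)) (ha : ∀ x y, P x → P y → P (x + y)) : P x := by
  induction x using PiTensorProduct.induction_on with
  | smul_tprod c a => exact hs c _ (ht a)
  | add x y hx hy => exact ha x y hx hy

/-- Left slot acts through `A`. -/
theorem barPi_slot_zero {q : ℕ} (c : A) (x : Bar K A q) :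
    barPi K A q (slot K A q 0 c * x) = c • barPi K A q x := by
  induction x using bar_induction K with
  | ht a =>
    have h0 : (0 : Fin (q + 2)) ≠ Fin.last (q + 1) := (Fin.last_pos).ne
    rw [slot_mul_tprod, barPi_tprod, barPi_tprod, Function.update_self,
      Function.update_of_ne h0.symm, smul_smul, mul_assoc]
    refine congrArg₂ (· • ·) rfl (congrArg _ (funext fun i => ?_))
    rw [Function.update_of_ne (Fin.succ_ne_zero _)]
  | hs k x hx => rw [mul_smul_comm, map_smul, hx, map_smul, smul_comm]
  | ha x y hx hy => rw [mul_add, map_add, hx, hy, map_add, smul_add]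

theorem barPi_slot_last {q : ℕ} (c : A) (x : Bar K A q) :
    barPi K A q (slot K A q (Fin.last (q + 1)) c * x) = c • barPi K A q x := by
  induction x using bar_induction K with
  | ht a =>
    have h0 : (0 : Fin (q + 2)) ≠ Fin.last (q + 1) := (Fin.last_pos).ne
    rw [slot_mul_tprod, barPi_tprod, barPi_tprod, Function.update_self,
      Function.update_of_ne h0, smul_smul]
    refine congrArg₂ (· • ·) (by ring) (congrArg _ (funext fun i => ?_))
    · rw [Function.update_of_ne]
      rw [← Fin.succ_last, Ne, Fin.succ_inj]; exact (Fin.castSucc_lt_last i).ne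
  | hs k x hx => rw [mul_smul_comm, map_smul, hx, map_smul, smul_comm]
  | ha x y hx hy => rw [mul_add, map_add, hx, hy, map_add, smul_add]

/-- The element `1 ⊗ ⋯ ⊗ c ⊗ ⋯ ⊗ 1 - c ⊗ 1 ⊗ ⋯ ⊗ 1`. -/
def slotDiff (q : ℕ) (i : Fin (q + 2)) (c : A) : Bar K A q := slot K A q i c - slot K A q 0 c

theorem barPi_slotDiff_tprod {q : ℕ} (j : Fin q) (c : A) (a : Fin (q + 2) → A) :
    barPi K A q (slotDiff K q j.castSucc.succ c * PiTensorProduct.tprod K a) =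
      (a 0 * a (Fin.last (q + 1))) • exteriorPower.ιMulti A q
        (Function.update (fun i : Fin q => KaehlerDifferential.D K A (a i.castSucc.succ)) j
          (a j.castSucc.succ • KaehlerDifferential.D K A c)) := by
  have h1 : (0 : Fin (q + 2)) ≠ j.castSucc.succ := (Fin.succ_ne_zero _).symm
  have h2 : Fin.last (q + 1) ≠ j.castSucc.succ := by
    rw [← Fin.succ_last, Ne, Fin.succ_inj]; exact (Fin.castSucc_lt_last j).ne'
  have key : (fun i : Fin q => KaehlerDifferential.D K A
      (Function.update a j.castSucc.succ (c * a j.castSucc.succ) i.castSucc.succ)) =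
      Function.update (fun i : Fin q => KaehlerDifferential.D K A (a i.castSucc.succ)) j
        (c • KaehlerDifferential.D K A (a j.castSucc.succ) +
          a j.castSucc.succ • KaehlerDifferential.D K A c) := by
    ext i; by_cases h : i = j
    · subst h; simp
    · simp [Function.update_of_ne, h]
  rw [slotDiff, sub_mul, map_sub, barPi_slot_zero, slot_mul_tprod, barPi_tprod, barPi_tprod, key,
    Function.update_of_ne h1, Function.update_of_ne h2, AlternatingMap.map_update_add,
    AlternatingMap.map_update_smul, smul_add, Function.update_eq_self, smul_comm c]
  abel

theorem barPi_slotDiff_sq {q : ℕ} (j : Fin q) (c d : A) (x : Bar K A q) :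
    barPi K A q (slotDiff K q j.castSucc.succ c * (slotDiff K q j.castSucc.succ d * x)) = 0 := by
  induction x using bar_induction K with
  | ht a =>
    have h1 : (0 : Fin (q + 2)) ≠ j.castSucc.succ := (Fin.succ_ne_zero _).symm
    have h2 : Fin.last (q + 1) ≠ j.castSucc.succ := by
      rw [← Fin.succ_last, Ne, Fin.succ_inj]; exact (Fin.castSucc_lt_last j).ne'
    have key : ∀ z : A, (fun i : Fin q => KaehlerDifferential.D K A
        (Function.update a j.castSucc.succ z i.castSucc.succ)) =
        Function.update (fun i : Fin q => KaehlerDifferential.D K A (a i.castSucc.succ)) j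
          (KaehlerDifferential.D K A z) := by
      intro z; ext i; by_cases h : i = j
      · subst h; simp
      · simp [Function.update_of_ne, h]
    have e : slotDiff K q j.castSucc.succ d * PiTensorProduct.tprod K a =
        PiTensorProduct.tprod K (Function.update a j.castSucc.succ (d * a j.castSucc.succ)) -
        slot K A q 0 d * PiTensorProduct.tprod K a := by
      rw [slotDiff, sub_mul, slot_mul_tprod]
    rw [e, mul_sub, map_sub, mul_left_comm, barPi_slot_zero, barPi_slotDiff_tprod,
      barPi_slotDiff_tprod, key, Function.update_self, Function.update_idem,
      Function.update_of_ne h1, Function.update_of_ne h2, AlternatingMap.map_update_smul,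
      AlternatingMap.map_update_smul, sub_eq_zero]
    simp only [smul_smul]
    refine congrArg₂ (· • ·) (by ring) rfl
  | hs k x hx => rw [mul_smul_comm, mul_smul_comm, map_smul, hx, smul_zero]
  | ha x y hx hy => rw [mul_add, mul_add, map_add, hx, hy, add_zero]


theorem barIdeal_le_span (q : ℕ) : barIdeal K A q ≤
    Ideal.span (Set.range fun p : Fin (q + 2) × A => slotDiff K q p.1 p.2) := by
  intro x hx
  set S := Ideal.span (Set.range fun p : Fin (q + 2) × A => slotDiff K q p.1 p.2)
  have h : Ideal.Quotient.mkₐ K S =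
      (Ideal.Quotient.mkₐ K S).comp ((slot K A q 0).comp (barMul K A q)) := by
    apply PiTensorProduct.algHom_ext
    intro i; ext a
    change Ideal.Quotient.mk S (slot K A q i a) =
      Ideal.Quotient.mk S (slot K A q 0 (barMul K A q (slot K A q i a)))
    rw [barMul_slot, Ideal.Quotient.eq]
    exact Ideal.subset_span ⟨(i, a), rfl⟩
  have h2 : Ideal.Quotient.mk S x = Ideal.Quotient.mk S (slot K A q 0 (barMul K A q x)) :=
    DFunLike.congr_fun h x
  rw [barIdeal, RingHom.mem_ker] at hx
  rw [show barMul K A q x = 0 from hx, map_zero, map_zero] at h2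
  exact Ideal.Quotient.eq_zero_iff_mem.mp h2

theorem barPi_prod_slotDiff {q : ℕ} (f : Fin (q + 1) → Fin (q + 2) × A) (x : Bar K A q) :
    barPi K A q ((∏ k, slotDiff K q (f k).1 (f k).2) * x) = 0 := by
  by_cases h0 : ∃ k, (f k).1 = 0
  · obtain ⟨k, hk⟩ := h0
    rw [Finset.prod_eq_zero (Finset.mem_univ k) (by rw [hk, slotDiff, sub_self]), zero_mul, map_zero]
  by_cases hl : ∃ k, (f k).1 = Fin.last (q + 1)
  · obtain ⟨k, hk⟩ := hl
    rw [← Finset.mul_prod_erase _ _ (Finset.mem_univ k), hk, slotDiff, mul_assoc, sub_mul, map_sub,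
      barPi_slot_last, barPi_slot_zero, sub_self]
  push Not at h0 hl
  have hj : ∀ k, ∃ j : Fin q, (f k).1 = j.castSucc.succ := by
    intro k
    obtain ⟨m, hm⟩ := Fin.exists_succ_eq.mpr (h0 k)
    have : m ≠ Fin.last q := by
      rintro rfl; exact hl k (by rw [← hm, Fin.succ_last])
    obtain ⟨j, hj⟩ := Fin.exists_castSucc_eq.mpr this
    exact ⟨j, by rw [← hm, ← hj]⟩
  choose j hj using hj
  obtain ⟨k, l, hkl, e⟩ : ∃ k l, k ≠ l ∧ j k = j l := by
    have : ¬ Function.Injective j := fun hi => by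
      have := Fintype.card_le_of_injective j hi
      simp at this
    simp only [Function.Injective] at this
    push Not at this
    obtain ⟨k, l, h1, h2⟩ := this
    exact ⟨k, l, h2, h1⟩
  rw [← Finset.mul_prod_erase _ _ (Finset.mem_univ k),
    ← Finset.mul_prod_erase _ _ (Finset.mem_erase.mpr ⟨hkl.symm, Finset.mem_univ l⟩),
    hj k, hj l, ← e, mul_assoc, mul_assoc]
  exact barPi_slotDiff_sq K _ _ _ _

theorem barPi_eq_zero_of_mem_pow {q : ℕ} {x : Bar K A q} (hx : x ∈ barIdeal K A q ^ (q + 1)) :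
    barPi K A q x = 0 := by
  have h1 := Ideal.pow_right_mono (barIdeal_le_span K (A := A) q) (q + 1) hx
  rw [Ideal.span, Submodule.span_pow] at h1
  clear hx
  have : ∀ r, barPi K A q (r * x) = 0 := by
    induction h1 using Submodule.span_induction with
    | mem y hy =>
      intro r
      obtain ⟨f, rfl⟩ := Set.mem_pow.mp hy
      choose g hg using fun k => (f k).2
      rw [List.prod_ofFn]
      simp only [← hg]
      rw [mul_comm]
      exact barPi_prod_slotDiff K g r
    | zero => intro r; rw [mul_zero, map_zero]
    | add y z _ _ hy hz => intro r; rw [mul_add, map_add, hy, hz, add_zero]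
    | smul s y _ hy => intro r; rw [smul_eq_mul, ← mul_assoc]; exact hy _
  simpa using this 1

theorem barMap_predAbove_tprod {q : ℕ} (i : Fin (q + 2)) (a : Fin (q + 3) → A) :
    barMap K (AlgHom.id K A) i.predAbove (PiTensorProduct.tprod K a) =
      slot K A q i (a i.castSucc) *
        PiTensorProduct.tprod K (fun j => a (i.castSucc.succAbove j)) := by
  rw [tprod_eq_prod, tprod_eq_prod, map_prod, Fin.prod_univ_succAbove _ i.castSucc]
  simp [barMap_slot]

theorem barPi_face {q : ℕ} (i : Fin (q + 2)) (a : Fin (q + 3) → A) :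
    let U : Fin (q + 1) → ⋀[A]^q Ω[A⁄K] := fun p =>
      (a 0 * a (Fin.last (q + 2)) * a p.castSucc.succ) • exteriorPower.ιMulti A q
        (fun k => KaehlerDifferential.D K A (a (p.succAbove k).castSucc.succ))
    barPi K A q (barMap K (AlgHom.id K A) i.predAbove (PiTensorProduct.tprod K a)) =
      Fin.cases 0 U i + Fin.lastCases 0 U i := by
  intro U
  rw [barMap_predAbove_tprod]
  induction i using Fin.cases with
  | zero =>
    rw [barPi_slot_zero, barPi_tprod]
    have : (0 : Fin (q + 2)) = (0 : Fin (q + 1)).castSucc := rfl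
    rw [Fin.cases_zero, zero_add, this, Fin.lastCases_castSucc, smul_smul]
    refine congrArg₂ (· • ·) ?_ (congrArg _ (funext fun k => ?_))
    · simp; ring
    · simp
  | succ i =>
  rw [Fin.cases_succ]
  induction i using Fin.lastCases with
  | last =>
    rw [Fin.succ_last, Fin.lastCases_last, add_zero, barPi_slot_last, barPi_tprod, smul_smul]
    refine congrArg₂ (· • ·) ?_ (congrArg _ (funext fun k => ?_))
    · have h1 : (Fin.last (q + 1)).castSucc.succAbove 0 = (0 : Fin (q + 3)) := by
        ext; simp [Fin.succAbove, Fin.lt_def]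
      have h2 : (Fin.last (q + 1)).castSucc.succAbove (Fin.last (q + 1)) = Fin.last (q + 2) := by
        ext; simp [Fin.succAbove]
      rw [h1, h2, ← Fin.succ_last, Fin.succ_castSucc]; ring
    · have h1 : (Fin.last (q + 1)).castSucc.succAbove k.castSucc.succ =
          ((Fin.last q).succAbove k).castSucc.succ := by
        ext; simp [Fin.succAbove, Fin.lt_def]
      rw [h1]
  | cast j =>
    have e0 : j.castSucc.succ.castSucc = j.castSucc.castSucc.succ := rfl
    have e1 : (j.castSucc.succ : Fin (q + 2)) = j.succ.castSucc := rfl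
    have hs : ∀ c y, slot K A q j.castSucc.succ c * y =
        slotDiff K q j.castSucc.succ c * y + slot K A q 0 c * y := by
      intro c y; rw [slotDiff]; ring
    rw [hs, map_add, barPi_slotDiff_tprod, barPi_slot_zero, barPi_tprod,
      AlternatingMap.map_update_smul, smul_smul, smul_smul, add_comm]
    conv_rhs => rw [e1, Fin.lastCases_castSucc]
    have a0 : j.castSucc.succ.castSucc.succAbove 0 = (0 : Fin (q + 3)) := by
      ext; simp [Fin.succAbove, Fin.lt_def]
    have al : j.castSucc.succ.castSucc.succAbove (Fin.last (q + 1)) = Fin.last (q + 2) := by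
      rw [Fin.succAbove_of_le_castSucc _ _ (by rw [Fin.le_def]; simp),
        Fin.succ_last]
    have aj : j.castSucc.succ.castSucc.succAbove j.castSucc.succ = (j.succ.castSucc.succ : Fin (q + 3)) := by
      ext; simp [Fin.succAbove]
    simp only [a0, al, aj]
    refine congrArg₂ (· + ·) (congrArg₂ (· • ·) ?_ (congrArg _ (funext fun k => ?_)))
      (congrArg₂ (· • ·) ?_ (congrArg _ (funext fun k => ?_)))
    · rw [e0]; ring
    · congr 2
      ext; simp only [Fin.succAbove, Fin.lt_def]; simp; split_ifs <;> simp
    · ring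
    · by_cases h : k = j
      · subst h
        rw [Function.update_self]
        congr 2
        ext; simp [Fin.succAbove, Fin.lt_def]
      · rw [Function.update_of_ne h]
        congr 2
        have h' : (k : ℕ) ≠ j := fun e => h (Fin.ext e)
        ext; simp only [Fin.succAbove, Fin.lt_def]; simp; split_ifs <;> simp <;> omega

theorem barPi_boundary {q : ℕ} (x : Bar K A (q + 1)) :
    ∑ i : Fin (q + 2), (-1 : ℤ) ^ (i : ℕ) •
      barPi K A q (barMap K (AlgHom.id K A) i.predAbove x) = 0 := by
  induction x using bar_induction K with
  | ht a =>
    simp only [barPi_face, smul_add, Finset.sum_add_distrib]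
    rw [Fin.sum_univ_succ, Fin.sum_univ_castSucc (n := q + 1)]
    simp [pow_succ]
  | hs k x hx =>
    have : ∀ i : Fin (q + 2), (-1 : ℤ) ^ (i : ℕ) •
      barPi K A q (barMap K (AlgHom.id K A) i.predAbove (k • x)) = k • ((-1 : ℤ) ^ (i : ℕ) •
      barPi K A q (barMap K (AlgHom.id K A) i.predAbove x)) := by
      intro i; rw [map_smul, map_smul, smul_comm]
    simp only [this, ← Finset.smul_sum, hx, smul_zero]
  | ha x y hx hy => simp only [map_add, smul_add, Finset.sum_add_distrib, hx, hy, add_zero]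

end Bar

section Adic
variable {R S T : Type u} [CommRing R] [CommRing S] [CommRing T]

/-- The map `R ⧸ I ^ n → S ⧸ J ^ n` precomposed with the projection of the completion. -/
def adicMapLevel {I : Ideal R} {J : Ideal S} (h : R →+* S) (hIJ : I ≤ J.comap h) (n : ℕ) :
    AdicCompletion I R →+* S ⧸ J ^ n :=
  (Ideal.quotientMap (J ^ n) h
    ((Ideal.pow_right_mono hIJ n).trans (Ideal.le_comap_pow h n))).comp
    (AdicCompletion.evalₐ I n : AdicCompletion I R →+* R ⧸ I ^ n)

theorem adicMapLevel_compat {I : Ideal R} {J : Ideal S} (h : R →+* S) (hIJ : I ≤ J.comap h)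
    {m n : ℕ} (hle : m ≤ n) :
    (Ideal.Quotient.factorPow J hle).comp (adicMapLevel h hIJ n) = adicMapLevel h hIJ m := by
  refine RingHom.ext fun x => ?_
  obtain ⟨c, rfl⟩ := AdicCompletion.mk_surjective I R x
  have h1 : c.val n - c.val m ∈ I ^ m :=
    Ideal.Quotient.eq.mp (AdicCompletion.Ideal.mk_eq_mk I hle c)
  simp only [adicMapLevel, RingHom.comp_apply, RingHom.coe_coe, AdicCompletion.evalₐ_mk,
    Ideal.quotientMap_mk]
  change Ideal.Quotient.mk (J ^ m) (h (c.val n)) = Ideal.Quotient.mk (J ^ m) (h (c.val m))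
  rw [Ideal.Quotient.eq, ← map_sub]
  exact (Ideal.pow_right_mono hIJ m).trans (Ideal.le_comap_pow h m) h1

/-- The ring homomorphism of adic completions induced by a ring homomorphism that maps the one
ideal into the other. -/
def adicMap {I : Ideal R} {J : Ideal S} (h : R →+* S) (hIJ : I ≤ J.comap h) :
    AdicCompletion I R →+* AdicCompletion J S :=
  AdicCompletion.liftRingHom J (adicMapLevel h hIJ) (adicMapLevel_compat h hIJ)

theorem evalₐ_adicMap {I : Ideal R} {J : Ideal S} (h : R →+* S) (hIJ : I ≤ J.comap h) (n : ℕ)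
    (x : AdicCompletion I R) (y : R) (hy : AdicCompletion.evalₐ I n x = Ideal.Quotient.mk _ y) :
    AdicCompletion.evalₐ J n (adicMap h hIJ x) = Ideal.Quotient.mk _ (h y) := by
  refine (AdicCompletion.evalₐ_liftRingHom J (adicMapLevel h hIJ) (adicMapLevel_compat h hIJ)
    n x).trans ?_
  simp [adicMapLevel, hy]

theorem adicMap_algebraMap {I : Ideal R} {J : Ideal S} (h : R →+* S) (hIJ : I ≤ J.comap h) (r : R) :
    adicMap h hIJ (algebraMap R _ r) = algebraMap S _ (h r) := by
  apply AdicCompletion.ext_evalₐ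
  intro n
  rw [evalₐ_adicMap (y := r)]
  · simp
  · simp

theorem adicMap_adicMap {I : Ideal R} {J : Ideal S} {L : Ideal T} (h : R →+* S)
    (hIJ : I ≤ J.comap h) (k : S →+* T) (hJL : J ≤ L.comap k) (m : R →+* T)
    (hIL : I ≤ L.comap m) (e : k.comp h = m) (x : AdicCompletion I R) :
    adicMap k hJL (adicMap h hIJ x) = adicMap m hIL x := by
  apply AdicCompletion.ext_evalₐ
  intro n
  obtain ⟨y, hy⟩ := Ideal.Quotient.mk_surjective (AdicCompletion.evalₐ I n x)
  rw [evalₐ_adicMap _ _ _ _ _ (evalₐ_adicMap _ _ _ _ _ hy.symm), evalₐ_adicMap _ _ _ _ _ hy.symm,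
    ← e]
  rfl

theorem continuous_adic {I : Ideal R} {J : Ideal S} (h : R →+* S) (hIJ : I ≤ J.comap h) :
    @Continuous _ _ I.adicTopology J.adicTopology h := by
  let := I.adicTopology
  let := J.adicTopology
  have := I.nonarchimedean
  have := J.nonarchimedean
  refine continuous_of_continuousAt_zero h.toAddMonoidHom ?_
  rw [ContinuousAt, map_zero]
  refine (I.hasBasis_nhds_zero_adic.tendsto_iff J.hasBasis_nhds_zero_adic).mpr fun n _ =>
    ⟨n, trivial, fun x hx => ?_⟩
  exact (Ideal.pow_right_mono hIJ n).trans (Ideal.le_comap_pow h n) hx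

theorem continuous_adic_discrete {I : Ideal R} {N : Type u} [AddCommGroup N] (f : R →+ N) (n : ℕ)
    (hf : ∀ x ∈ I ^ n, f x = 0) : @Continuous _ _ I.adicTopology ⊥ f := by
  let := I.adicTopology
  let : TopologicalSpace N := ⊥
  have : DiscreteTopology N := ⟨rfl⟩
  have := I.nonarchimedean
  refine continuous_of_continuousAt_zero f ?_
  rw [ContinuousAt, map_zero, nhds_discrete N, Filter.tendsto_pure]
  exact I.hasBasis_nhds_zero_adic.mem_iff.mpr ⟨n, trivial, fun x hx => hf x hx⟩

end Adic

section Env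
variable (K A : Type u) [CommRing K] [CommRing A] [Algebra K A]

/-- The `I_q`-adic completion `B̂_q(A)` of `B_q(A)`. -/
abbrev CBar (q : ℕ) : Type u := AdicCompletion (barIdeal K A q) (Bar K A q)

/-- `B_q(A)` as an algebra over `A^e = A ⊗_K A`, by `a ⊗ b ↦ a ⊗ 1 ⊗ ⋯ ⊗ 1 ⊗ b`. -/
abbrev envAlgebraBar (q : ℕ) : Algebra (A ⊗[K] A) (Bar K A q) :=
  (Algebra.TensorProduct.lift (slot K A q 0) (slot K A q (Fin.last (q + 1)))
    (fun _ _ => Commute.all _ _)).toRingHom.toAlgebra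

/-- `A` as an algebra over `A^e = A ⊗_K A`, by multiplication. -/
abbrev envAlgebra : Algebra (A ⊗[K] A) A := (Algebra.TensorProduct.lmul' K).toRingHom.toAlgebra

attribute [local instance] envAlgebraBar envAlgebra

/-- The module `Ĉ_q(A) = A ⊗_{A^e} B̂_q(A)` of complete Hochschild chains. -/
def CChain (q : ℕ) : Type u := A ⊗[A ⊗[K] A] CBar K A q

instance (q : ℕ) : CommRing (CChain K A q) :=
  inferInstanceAs (CommRing (A ⊗[A ⊗[K] A] CBar K A q))
instance (q : ℕ) : Algebra A (CChain K A q) :=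
  inferInstanceAs (Algebra A (A ⊗[A ⊗[K] A] CBar K A q))

/-- The ring homomorphism `B_q(A) → Ĉ_q(A)`. -/
def toCChain (q : ℕ) : Bar K A q →+* CChain K A q :=
  (Algebra.TensorProduct.includeRight (R := A ⊗[K] A) (A := A) (B := CBar K A q)).toRingHom.comp
    (algebraMap (Bar K A q) (CBar K A q))

/-- The ideal of `Ĉ_q(A)` generated by the image of `I_q`; the topology of `Ĉ_q(A)` is the adic
topology of this ideal. -/
def chainIdeal (q : ℕ) : Ideal (CChain K A q) := (barIdeal K A q).map (toCChain K A q)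

variable {A}
variable {A' : Type u} [CommRing A'] [Algebra K A']

/-- The homomorphism `B̂_q(A) → B̂_r(A')` induced by `barMap`. -/
def cbarMap {q r : ℕ} (g : A →ₐ[K] A') (σ : Fin (q + 2) → Fin (r + 2)) :
    CBar K A q →+* CBar K A' r :=
  adicMap (barMap K g σ : Bar K A q →+* Bar K A' r) (barIdeal_le_comap K g σ)

/-- The homomorphism `Ĉ_q(A) → Ĉ_r(A')` induced by `barMap`, for a map `σ` that preserves the first
and the last tensor factor. -/
def chainMap {q r : ℕ} (g : A →ₐ[K] A') (σ : Fin (q + 2) → Fin (r + 2)) (h0 : σ 0 = 0)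
    (hl : σ (Fin.last (q + 1)) = Fin.last (r + 1)) : CChain K A q →+* CChain K A' r :=
  Algebra.TensorProduct.mapRingHom
    (Algebra.TensorProduct.map g g : A ⊗[K] A →ₐ[K] A' ⊗[K] A').toRingHom
    (g : A →+* A') (cbarMap K g σ)
    (by
      have : g.comp (Algebra.TensorProduct.lmul' K) =
        (Algebra.TensorProduct.lmul' K).comp (Algebra.TensorProduct.map g g) := by
        ext <;> simp
      exact congrArg AlgHom.toRingHom this)
    (by
      have : (barMap K g σ).comp (Algebra.TensorProduct.lift (slot K A q 0)
            (slot K A q (Fin.last (q + 1))) (fun _ _ => Commute.all _ _)) =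
          (Algebra.TensorProduct.lift (slot K A' r 0) (slot K A' r (Fin.last (r + 1)))
            (fun _ _ => Commute.all _ _)).comp (Algebra.TensorProduct.map g g) := by
        ext x
        · simp [barMap_slot, h0]
        · simp [barMap_slot, hl]
      refine RingHom.ext fun x => ?_
      exact (adicMap_algebraMap _ (barIdeal_le_comap K g σ) _).trans (congrArg _ (DFunLike.congr_fun this x)))

theorem chainMap_tmul {q r : ℕ} (g : A →ₐ[K] A') (σ : Fin (q + 2) → Fin (r + 2)) (h0 : σ 0 = 0)
    (hl : σ (Fin.last (q + 1)) = Fin.last (r + 1)) (a : A) (x : CBar K A q) :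
    chainMap K g σ h0 hl (a ⊗ₜ[A ⊗[K] A] x) = (g a ⊗ₜ[A' ⊗[K] A'] cbarMap K g σ x : A' ⊗[A' ⊗[K] A'] CBar K A' r) :=
  Algebra.TensorProduct.mapRingHom_tmul _ _ _ _ _ _ _

variable {K} in
theorem chain_induction {q : ℕ} {P : CChain K A q → Prop} (x : CChain K A q)
    (ht : ∀ (a : A) (y : CBar K A q), P (show CChain K A q from (a ⊗ₜ[A ⊗[K] A] y)))
    (ha : ∀ x y, P x → P y → P (x + y)) : P x := by
  induction x using TensorProduct.induction_on with
  | zero => simpa using ht 0 0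
  | tmul a y => exact ht a y
  | add x y hx hy => exact ha x y hx hy

theorem chainMap_smul {q r : ℕ} (g : A →ₐ[K] A') (σ : Fin (q + 2) → Fin (r + 2)) (h0 : σ 0 = 0)
    (hl : σ (Fin.last (q + 1)) = Fin.last (r + 1)) (a : A) (x : CChain K A q) :
    chainMap K g σ h0 hl (a • x) = g a • chainMap K g σ h0 hl x := by
  induction x using chain_induction with
  | ht b y =>
    exact (chainMap_tmul K g σ h0 hl (a * b) y).trans ((by rw [map_mul]; rfl : _ = g a • (g b ⊗ₜ[A' ⊗[K] A'] cbarMap K g σ y : A' ⊗[A' ⊗[K] A'] CBar K A' r)).trans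
      (congrArg (g a • ·) (chainMap_tmul K g σ h0 hl b y).symm))
  | ha x y hx hy => rw [smul_add, map_add, map_add, hx, hy, smul_add]

theorem chainMap_chainMap {A'' : Type u} [CommRing A''] [Algebra K A''] {q r s : ℕ}
    (g' : A' →ₐ[K] A'') (g : A →ₐ[K] A') (m : A →ₐ[K] A'') (τ : Fin (r + 2) → Fin (s + 2))
    (σ : Fin (q + 2) → Fin (r + 2)) (ρ : Fin (q + 2) → Fin (s + 2)) (h0 hl h0' hl' h0'' hl'')
    (e : g'.comp g = m) (e' : τ ∘ σ = ρ) (x : CChain K A q) :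
    chainMap K g' τ h0' hl' (chainMap K g σ h0 hl x) = chainMap K m ρ h0'' hl'' x := by
  subst e e'
  induction x using chain_induction with
  | ht b y =>
    refine (congrArg _ (chainMap_tmul K g σ h0 hl b y)).trans
      ((chainMap_tmul K g' τ h0' hl' _ _).trans
        (Eq.trans ?_ (chainMap_tmul K _ _ h0'' hl'' b y).symm))
    have : cbarMap K g' τ (cbarMap K g σ y) = cbarMap K (g'.comp g) (τ ∘ σ) y :=
      adicMap_adicMap _ _ _ _ _ _ (congrArg AlgHom.toRingHom (barMap_comp K g' g τ σ)) _
    rw [this]; rfl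
  | ha x y hx hy => rw [map_add, map_add, map_add, hx, hy]

theorem chainMap_id {q : ℕ} (h0 hl) (x : CChain K A q) :
    chainMap K (AlgHom.id K A) id h0 hl x = x := by
  induction x using chain_induction with
  | ht b y =>
    refine (chainMap_tmul K _ _ h0 hl b y).trans ?_
    have : cbarMap K (AlgHom.id K A) id y = y := by
      apply AdicCompletion.ext_evalₐ
      intro n
      obtain ⟨z, hz⟩ := Ideal.Quotient.mk_surjective (AdicCompletion.evalₐ _ n y)
      rw [cbarMap, evalₐ_adicMap _ _ _ _ _ hz.symm, ← hz]
      exact congrArg _ (DFunLike.congr_fun (barMap_id K) z)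
    rw [this]; rfl
  | ha x y hx hy => rw [map_add, hx, hy]

theorem chainIdeal_le_comap {q r : ℕ} (g : A →ₐ[K] A') (σ : Fin (q + 2) → Fin (r + 2)) (h0 hl) :
    chainIdeal K A q ≤ (chainIdeal K A' r).comap (chainMap K g σ h0 hl) := by
  rw [chainIdeal, Ideal.map_le_iff_le_comap]
  intro x hx
  have : chainMap K g σ h0 hl (toCChain K A q x) = toCChain K A' r (barMap K g σ x) := by
    refine (chainMap_tmul K g σ h0 hl 1 _).trans ?_
    have : cbarMap K g σ (algebraMap _ _ x) = algebraMap _ _ (barMap K g σ x) :=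
      adicMap_algebraMap _ _ _
    rw [this, map_one]; rfl
  rw [Ideal.mem_comap, Ideal.mem_comap, this]
  exact Ideal.mem_map_of_mem _ (barIdeal_le_comap K g σ hx)

end Env

section Wedge

variable {R S T : Type u} [CommRing R] [CommRing S] [CommRing T] {M N P : Type u}
  [AddCommGroup M] [Module R M] [AddCommGroup N] [Module S N] [AddCommGroup P] [Module T P]

/-- The alternating map `m ↦ f m₁ ∧ ⋯ ∧ f m_q` for a semilinear map `f`. -/
def wedgeAlternating (σ : R →+* S) (f : M →ₛₗ[σ] N) (q : ℕ) :
    letI : Module R (⋀[S]^q N) := Module.compHom _ σ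
    AlternatingMap R M (⋀[S]^q N) (Fin q) :=
  letI : Module R (⋀[S]^q N) := Module.compHom _ σ
  { toFun := fun m => exteriorPower.ιMulti S q (fun i => f (m i))
    map_update_add' := fun {dec} m i x y => by
      obtain rfl : dec = instDecidableEqFin _ := Subsingleton.elim _ _
      have key : ∀ z, (fun j => f (Function.update m i z j)) =
          Function.update (fun j => f (m j)) i (f z) := fun z =>
        funext fun j => Function.apply_update (fun _ => f) m i z j
      simp only [key, map_add, AlternatingMap.map_update_add]
    map_update_smul' := fun {dec} m i c x => by
      obtain rfl : dec = instDecidableEqFin _ := Subsingleton.elim _ _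
      have key : ∀ z, (fun j => f (Function.update m i z j)) =
          Function.update (fun j => f (m j)) i (f z) := fun z =>
        funext fun j => Function.apply_update (fun _ => f) m i z j
      simp only [key, map_smulₛₗ, AlternatingMap.map_update_smul]
      rfl
    map_eq_zero_of_eq' := fun v i j h hij =>
      AlternatingMap.map_eq_zero_of_eq _ _ (congrArg f h) hij }

/-- The semilinear map of exterior powers induced by a semilinear map. -/
def wedgeMap (σ : R →+* S) (f : M →ₛₗ[σ] N) (q : ℕ) : ⋀[R]^q M →ₛₗ[σ] ⋀[S]^q N :=
  letI : Module R (⋀[S]^q N) := Module.compHom _ σ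
  { toFun := exteriorPower.alternatingMapLinearEquiv (wedgeAlternating σ f q)
    map_add' := map_add _
    map_smul' := fun c x =>
      (exteriorPower.alternatingMapLinearEquiv (wedgeAlternating σ f q)).map_smul c x }

theorem wedgeMap_ιMulti (σ : R →+* S) (f : M →ₛₗ[σ] N) (q : ℕ) (m : Fin q → M) :
    wedgeMap σ f q (exteriorPower.ιMulti R q m) = exteriorPower.ιMulti S q (fun i => f (m i)) :=
  letI : Module R (⋀[S]^q N) := Module.compHom _ σ
  exteriorPower.alternatingMapLinearEquiv_apply_ιMulti (wedgeAlternating σ f q) m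

theorem wedge_induction {q : ℕ} {p : ⋀[R]^q M → Prop} (x : ⋀[R]^q M)
    (hm : ∀ m : Fin q → M, p (exteriorPower.ιMulti R q m))
    (hs : ∀ (c : R) x, p x → p (c • x)) (ha : ∀ x y, p x → p y → p (x + y)) : p x := by
  have hx : x ∈ Submodule.span R (Set.range (exteriorPower.ιMulti R q (M := M))) := by
    rw [exteriorPower.ιMulti_span]; trivial
  induction hx using Submodule.span_induction with
  | mem y hy => obtain ⟨m, rfl⟩ := hy; exact hm m
  | zero => simpa using hs 0 _ (hm 0)
  | add x y _ _ hx hy => exact ha x y hx hy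
  | smul c x _ hx => exact hs c x hx

theorem wedgeMap_comp (σ : R →+* S) (τ : S →+* T) (ρ : R →+* T) (f : M →ₛₗ[σ] N) (g : N →ₛₗ[τ] P)
    (h : M →ₛₗ[ρ] P) (e : τ.comp σ = ρ) (e' : ∀ m, g (f m) = h m) (q : ℕ) (x : ⋀[R]^q M) :
    wedgeMap τ g q (wedgeMap σ f q x) = wedgeMap ρ h q x := by
  subst e
  induction x using wedge_induction with
  | hm m => simp only [wedgeMap_ιMulti, e']
  | hs c x hx => rw [map_smulₛₗ, map_smulₛₗ, map_smulₛₗ, hx]; rfl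
  | ha x y hx hy => rw [map_add, map_add, map_add, hx, hy]

theorem wedgeMap_id (σ : R →+* R) (f : M →ₛₗ[σ] M) (e : σ = RingHom.id R) (e' : ∀ m, f m = m)
    (q : ℕ) (x : ⋀[R]^q M) : wedgeMap σ f q x = x := by
  subst e
  induction x using wedge_induction with
  | hm m => simp only [wedgeMap_ιMulti, e']
  | hs c x hx => rw [map_smulₛₗ, hx]; rfl
  | ha x y hx hy => rw [map_add, hx, hy]

end Wedge

section Forms

variable (K : Type u) {A A' A'' : Type u} [CommRing K] [CommRing A] [Algebra K A] [CommRing A']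
  [Algebra K A'] [CommRing A''] [Algebra K A'']

/-- The semilinear map `Ω_{A/K} → Ω_{A'/K}`, `a db ↦ g(a) dg(b)`. -/
def kaehlerMap (g : A →ₐ[K] A') : Ω[A⁄K] →ₛₗ[(g : A →+* A')] Ω[A'⁄K] :=
  letI : Algebra A A' := (g : A →+* A').toAlgebra
  haveI : IsScalarTower K A A' := IsScalarTower.of_algebraMap_eq fun r => (g.commutes r).symm
  { toFun := KaehlerDifferential.map K K A A'
    map_add' := map_add _
    map_smul' := fun a x => (KaehlerDifferential.map K K A A').map_smul a x }

theorem kaehlerMap_D (g : A →ₐ[K] A') (a : A) :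
    kaehlerMap K g (KaehlerDifferential.D K A a) = KaehlerDifferential.D K A' (g a) :=
  letI : Algebra A A' := (g : A →+* A').toAlgebra
  haveI : IsScalarTower K A A' := IsScalarTower.of_algebraMap_eq fun r => (g.commutes r).symm
  KaehlerDifferential.map_D K K A A' a

theorem kaehler_induction {p : Ω[A⁄K] → Prop} (x : Ω[A⁄K])
    (hD : ∀ a : A, p (KaehlerDifferential.D K A a))
    (hs : ∀ (c : A) x, p x → p (c • x)) (ha : ∀ x y, p x → p y → p (x + y)) : p x := by
  have hx : x ∈ Submodule.span A (Set.range (KaehlerDifferential.D K A)) := by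
    rw [KaehlerDifferential.span_range_derivation]; trivial
  induction hx using Submodule.span_induction with
  | mem y hy => obtain ⟨m, rfl⟩ := hy; exact hD m
  | zero => simpa using hs 0 _ (hD 0)
  | add x y _ _ hx hy => exact ha x y hx hy
  | smul c x _ hx => exact hs c x hx

theorem kaehlerMap_comp (g' : A' →ₐ[K] A'') (g : A →ₐ[K] A') (m : A →ₐ[K] A'') (e : g'.comp g = m)
    (x : Ω[A⁄K]) : kaehlerMap K g' (kaehlerMap K g x) = kaehlerMap K m x := by
  subst e
  induction x using kaehler_induction with
  | hD a => simp only [kaehlerMap_D]; rfl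
  | hs c x hx => rw [map_smulₛₗ, map_smulₛₗ, map_smulₛₗ, hx]; rfl
  | ha x y hx hy => rw [map_add, map_add, map_add, hx, hy]

theorem kaehlerMap_id (g : A →ₐ[K] A) (e : g = AlgHom.id K A) (x : Ω[A⁄K]) :
    kaehlerMap K g x = x := by
  subst e
  induction x using kaehler_induction with
  | hD a => simp only [kaehlerMap_D]; rfl
  | hs c x hx => rw [map_smulₛₗ, hx]; rfl
  | ha x y hx hy => rw [map_add, hx, hy]

/-- The map `Ω^q_{A/K} → Ω^q_{A'/K}`. -/
def formMap (g : A →ₐ[K] A') (q : ℕ) : ⋀[A]^q Ω[A⁄K] →ₛₗ[(g : A →+* A')] ⋀[A']^q Ω[A'⁄K] :=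
  wedgeMap (g : A →+* A') (kaehlerMap K g) q

theorem formMap_barPi (g : A →ₐ[K] A') {q : ℕ} (x : Bar K A q) :
    formMap K g q (barPi K A q x) = barPi K A' q (barMap K g id x) := by
  induction x using bar_induction K with
  | ht a =>
    have : barMap K g id (PiTensorProduct.tprod K a) =
        PiTensorProduct.tprod K (fun i => g (a i)) := by
      rw [tprod_eq_prod, tprod_eq_prod, map_prod]; simp [barMap_slot]
    rw [this, barPi_tprod, barPi_tprod, formMap, map_smulₛₗ, wedgeMap_ιMulti]
    simp only [kaehlerMap_D, RingHom.coe_coe, map_mul]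
  | hs k x hx =>
    have h2 : ∀ y : ⋀[A]^q Ω[A⁄K], formMap K g q (k • y) = k • formMap K g q y := by
      intro y
      rw [← algebraMap_smul A k, map_smulₛₗ, ← algebraMap_smul A' k]
      exact congrArg (· • _) (g.commutes k)
    rw [(barPi K A q).map_smul, h2, _root_.map_smul (barMap K g id) k x, (barPi K A' q).map_smul, hx]
  | ha x y hx hy => rw [map_add, map_add, map_add, map_add, hx, hy]

end Forms

section Chains

variable (K A : Type u) [CommRing K] [CommRing A] [Algebra K A]

/-- The completed form of `barPi`. -/
def cbarPi (q : ℕ) : CBar K A q →+ ⋀[A]^q Ω[A⁄K] :=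
  (QuotientAddGroup.lift (barIdeal K A q ^ (q + 1)).toAddSubgroup
    (barPi K A q).toAddMonoidHom (fun _ hx => barPi_eq_zero_of_mem_pow K hx)).comp
    (AdicCompletion.evalₐ (barIdeal K A q) (q + 1)).toAddMonoidHom

variable {A}

theorem cbarPi_eq {q : ℕ} (x : CBar K A q) (y : Bar K A q)
    (h : AdicCompletion.evalₐ (barIdeal K A q) (q + 1) x = Ideal.Quotient.mk _ y) :
    cbarPi K A q x = barPi K A q y := by
  change QuotientAddGroup.lift (barIdeal K A q ^ (q + 1)).toAddSubgroup
    (barPi K A q).toAddMonoidHom (fun _ hx => barPi_eq_zero_of_mem_pow K hx)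
      (AdicCompletion.evalₐ (barIdeal K A q) (q + 1) x) = _
  rw [h]
  rfl

theorem exists_bar_rep {q : ℕ} (n : ℕ) (x : CBar K A q) : ∃ y : Bar K A q,
    AdicCompletion.evalₐ (barIdeal K A q) n x = Ideal.Quotient.mk _ y :=
  (Ideal.Quotient.mk_surjective _).imp fun _ h => h.symm

theorem evalₐ_cbarMap {A' : Type u} [CommRing A'] [Algebra K A'] {q r : ℕ} (g : A →ₐ[K] A')
    (σ : Fin (q + 2) → Fin (r + 2)) (n : ℕ) (x : CBar K A q) (y : Bar K A q)
    (hy : AdicCompletion.evalₐ (barIdeal K A q) n x = Ideal.Quotient.mk _ y) :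
    AdicCompletion.evalₐ (barIdeal K A' r) n (cbarMap K g σ x) =
      Ideal.Quotient.mk _ (barMap K g σ y) :=
  evalₐ_adicMap _ _ _ _ _ hy

attribute [local instance] envAlgebraBar envAlgebra

theorem cbarPi_smul {q : ℕ} (r : A ⊗[K] A) (x : CBar K A q) :
    cbarPi K A q (r • x) = Algebra.TensorProduct.lmul' K r • cbarPi K A q x := by
  induction r using TensorProduct.induction_on with
  | zero => simp
  | add r s hr hs => rw [add_smul, map_add, hr, hs, map_add, add_smul]
  | tmul a b =>
    obtain ⟨y, hy⟩ := exists_bar_rep K (q + 1) x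
    have e : (a ⊗ₜ[K] b : A ⊗[K] A) • x = algebraMap (Bar K A q) (CBar K A q)
        (slot K A q 0 a * slot K A q (Fin.last (q + 1)) b) * x := by
      rw [Algebra.smul_def]
      rfl
    rw [e, cbarPi_eq K _ ((slot K A q 0 a * slot K A q (Fin.last (q + 1)) b) * y),
      cbarPi_eq K x y hy, mul_assoc, barPi_slot_zero, barPi_slot_last, smul_smul]
    · simp
    · rw [_root_.map_mul (AdicCompletion.evalₐ _ _), hy,
        _root_.map_mul (Ideal.Quotient.mk _) (_ * _) y]
      exact congrArg (· * _) (AlgHom.commutes _ _)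

/-- The biadditive map `(a, x) ↦ a π(x)`. -/
def chainPiAux (q : ℕ) : A →+ CBar K A q →+ ⋀[A]^q Ω[A⁄K] :=
  AddMonoidHom.mk' (fun a => (DistribSMul.toAddMonoidHom (⋀[A]^q Ω[A⁄K]) a).comp (cbarPi K A q))
    (fun a b => AddMonoidHom.ext fun x => add_smul a b (cbarPi K A q x))

theorem chainPiAux_balanced (q : ℕ) (r : A ⊗[K] A) (a : A) (x : CBar K A q) :
    chainPiAux K q (r • a) x = chainPiAux K q a (r • x) := by
  change (r • a) • cbarPi K A q x = a • cbarPi K A q (r • x)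
  rw [cbarPi_smul, smul_smul, mul_comm a]
  rfl

variable (A) in
/-- The additive map underlying `π : Ĉ_q(A) → Ω^q_{A/K}`, `a ⊗ x ↦ a π(x)`. -/
def chainPiAdd (q : ℕ) : CChain K A q →+ ⋀[A]^q Ω[A⁄K] :=
  TensorProduct.liftAddHom (R := A ⊗[K] A) (M := A) (N := CBar K A q)
    (chainPiAux K q) (chainPiAux_balanced K q)

variable (A) in
/-- The homomorphism `π : Ĉ_q(A) → Ω^q_{A/K}`. -/
def chainPi (q : ℕ) : CChain K A q →ₗ[A] ⋀[A]^q Ω[A⁄K] :=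
  { toFun := chainPiAdd K A q
    map_add' := map_add _
    map_smul' := fun a x => by
      induction x using chain_induction with
      | ht b y =>
        change (a * b) • cbarPi K A q y = a • b • cbarPi K A q y
        rw [mul_smul]
      | ha x y hx hy =>
        rw [smul_add, map_add, hx, hy, map_add, smul_add] }

theorem chainPi_tmul {q : ℕ} (a : A) (x : CBar K A q) :
    chainPi K A q (show CChain K A q from (a ⊗ₜ[A ⊗[K] A] x)) = a • cbarPi K A q x := rfl

theorem toCChain_mul_tmul {q : ℕ} (z : Bar K A q) (a : A) (y : CBar K A q) :
    toCChain K A q z * (show CChain K A q from (a ⊗ₜ[A ⊗[K] A] y)) =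
      (show CChain K A q from (a ⊗ₜ[A ⊗[K] A] (algebraMap _ (CBar K A q) z * y))) := by
  refine (Algebra.TensorProduct.tmul_mul_tmul (R := A ⊗[K] A) (1 : A) a
    (algebraMap _ (CBar K A q) z) y).trans ?_
  rw [one_mul]

theorem chainPi_eq_zero_of_mem_pow {q : ℕ} (x : CChain K A q)
    (hx : x ∈ chainIdeal K A q ^ (q + 1)) : chainPi K A q x = 0 := by
  rw [chainIdeal, ← Ideal.map_pow, Ideal.map] at hx
  have : ∀ r, chainPi K A q (r * x) = 0 := by
    induction hx using Submodule.span_induction with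
    | mem y hy =>
      obtain ⟨z, hz, rfl⟩ := hy
      intro r
      induction r using chain_induction with
      | ht b y =>
        rw [mul_comm, toCChain_mul_tmul, chainPi_tmul]
        obtain ⟨w, hw⟩ := exists_bar_rep K (q + 1) y
        have h0 : (0 : CBar K A q) = 0 := rfl
        rw [cbarPi_eq K _ 0, map_zero, smul_zero]
        rw [_root_.map_mul (AdicCompletion.evalₐ _ _)]
        have : AdicCompletion.evalₐ (barIdeal K A q) (q + 1) (algebraMap _ (CBar K A q) z) = 0 :=
          (AlgHom.commutes _ _).trans (Ideal.Quotient.eq_zero_iff_mem.mpr hz)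
        rw [this, zero_mul]
        exact (map_zero _).symm
      | ha x y hx hy => rw [add_mul, map_add, hx, hy, add_zero]
    | zero => intro r; rw [mul_zero, map_zero]
    | add y z _ _ hy hz => intro r; rw [mul_add, map_add, hy, hz, add_zero]
    | smul s y _ hy => intro r; rw [smul_eq_mul, ← mul_assoc]; exact hy _
  simpa using this 1

theorem formMap_chainPi {A' : Type u} [CommRing A'] [Algebra K A'] (g : A →ₐ[K] A') {q : ℕ}
    (h0 hl) (x : CChain K A q) :
    formMap K g q (chainPi K A q x) = chainPi K A' q (chainMap K g id h0 hl x) := by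
  induction x using chain_induction with
  | ht a y =>
    refine Eq.trans ?_ (congrArg _ (chainMap_tmul K g id h0 hl a y)).symm
    obtain ⟨w, hw⟩ := exists_bar_rep K (q + 1) y
    rw [chainPi_tmul, map_smulₛₗ, cbarPi_eq K y w hw, formMap_barPi]
    refine Eq.trans ?_ (chainPi_tmul K (g a) (cbarMap K g id y)).symm
    rw [cbarPi_eq K _ _ (evalₐ_cbarMap K _ _ _ _ _ hw)]
    rfl
  | ha x y hx hy => rw [map_add, map_add, map_add, map_add, hx, hy]

/-- The `i`-th face `Ĉ_{q+1}(A) → Ĉ_q(A)`, induced by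
`a₀ ⊗ ⋯ ⊗ a_{q+2} ↦ a₀ ⊗ ⋯ ⊗ a_i a_{i+1} ⊗ ⋯ ⊗ a_{q+2}`. -/
def chainFace (q : ℕ) (i : Fin (q + 2)) : CChain K A (q + 1) →+* CChain K A q :=
  chainMap K (AlgHom.id K A) i.predAbove Fin.predAbove_right_zero Fin.predAbove_right_last

variable (A) in
/-- The boundary `∂ : Ĉ_{q+1}(A) → Ĉ_q(A)`. -/
def chainBoundary (q : ℕ) : CChain K A (q + 1) →ₗ[A] CChain K A q where
  toFun x := ∑ i : Fin (q + 2), (-1 : ℤ) ^ (i : ℕ) • chainFace K q i x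
  map_add' x y := by simp only [map_add, smul_add, Finset.sum_add_distrib]
  map_smul' a x := by
    simp only [chainFace, chainMap_smul, Finset.smul_sum, AlgHom.id_apply, RingHom.id_apply]
    exact Finset.sum_congr rfl fun i _ => smul_comm _ _ _

theorem chainBoundary_apply {q : ℕ} (x : CChain K A (q + 1)) :
    chainBoundary K A q x = ∑ i : Fin (q + 2), (-1 : ℤ) ^ (i : ℕ) • chainFace K q i x := rfl

theorem chainPi_chainBoundary {q : ℕ} (x : CChain K A (q + 1)) :
    chainPi K A q (chainBoundary K A q x) = 0 := by
  induction x using chain_induction with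
  | ht a y =>
    obtain ⟨w, hw⟩ := exists_bar_rep K (q + 1) y
    have : ∀ i : Fin (q + 2), chainPi K A q (chainFace K q i
        (show CChain K A (q + 1) from (a ⊗ₜ[A ⊗[K] A] y))) =
        a • barPi K A q (barMap K (AlgHom.id K A) i.predAbove w) := by
      intro i
      refine (congrArg _ (chainMap_tmul K _ _ _ _ a y)).trans ?_
      refine (chainPi_tmul K _ _).trans ?_
      rw [cbarPi_eq K _ _ (evalₐ_cbarMap K _ _ _ _ _ hw)]
      rfl
    rw [chainBoundary_apply, map_sum]
    simp only [map_zsmul, this]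
    have h := congrArg (a • ·) (barPi_boundary K w)
    simp only [Finset.smul_sum, smul_zero] at h
    rw [← h]
    exact Finset.sum_congr rfl fun i _ => smul_comm _ _ _
  | ha x y hx hy => rw [map_add, map_add, hx, hy, add_zero]

theorem alternating_sum_sq {X Y Z : Type u} [AddCommGroup X] [AddCommGroup Y] [AddCommGroup Z]
    {n : ℕ} (f : Fin (n + 3) → X →+ Y) (g : Fin (n + 2) → Y →+ Z)
    (h : ∀ i j : Fin (n + 2), i ≤ j → ∀ x, g j (f i.castSucc x) = g i (f j.succ x)) (x : X) :
    ∑ j : Fin (n + 2), (-1 : ℤ) ^ (j : ℕ) •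
      g j (∑ i : Fin (n + 3), (-1 : ℤ) ^ (i : ℕ) • f i x) = 0 := by
  simp only [map_sum, map_zsmul, Finset.smul_sum, ← Finset.sum_product']
  let P := Fin (n + 2) × Fin (n + 3)
  let S : Finset P := {ij : P | (ij.2 : ℕ) ≤ (ij.1 : ℕ)}
  rw [Finset.univ_product_univ, ← Finset.sum_add_sum_compl S, ← eq_neg_iff_add_eq_zero,
    ← Finset.sum_neg_distrib]
  let φ : ∀ ij : P, ij ∈ S → P := fun ij hij =>
    (Fin.castLT ij.2 (lt_of_le_of_lt (Finset.mem_filter.mp hij).right (Fin.is_lt ij.1)), ij.1.succ)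
  apply Finset.sum_bij φ
  · intro ij hij
    simp_rw [S, φ, Finset.compl_filter, Finset.mem_filter_univ, Fin.val_succ,
      Fin.val_castLT] at hij ⊢
    lia
  · rintro ⟨i, j⟩ hij ⟨i', j'⟩ hij' h
    rw [Prod.mk_inj]
    exact ⟨by simpa [φ] using! congr_arg Prod.snd h,
      by simpa [φ, Fin.castSucc_castLT] using! congr_arg Fin.castSucc (congr_arg Prod.fst h)⟩
  · rintro ⟨i', j'⟩ hij'
    simp_rw [S, Finset.compl_filter, Finset.mem_filter_univ, not_le] at hij'
    refine ⟨(j'.pred <| ?_, Fin.castSucc i'), ?_, ?_⟩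
    · rintro rfl
      simp only [Fin.val_zero, not_lt_zero] at hij'
    · simpa [S] using! Nat.le_sub_one_of_lt hij'
    · simp only [φ, Fin.castLT_castSucc, Fin.succ_pred]
  · rintro ⟨i, j⟩ hij
    have hij' : (j : ℕ) ≤ i := (Finset.mem_filter.mp hij).right
    have hj := h (Fin.castLT j (lt_of_le_of_lt hij' (Fin.is_lt i))) i hij' x
    rw [Fin.castSucc_castLT] at hj
    simp only [φ, smul_smul, ← neg_smul, hj, Fin.val_succ, Fin.val_castLT, pow_succ]
    congr 1
    ring

theorem predAbove_comp_predAbove {q : ℕ} (i j : Fin (q + 2)) (hij : i ≤ j) :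
    j.predAbove ∘ i.castSucc.predAbove = i.predAbove ∘ j.succ.predAbove := by
  funext k
  exact congrArg (fun f => f.toOrderHom k) (SimplexCategory.σ_comp_σ hij)

theorem chainFace_chainFace {q : ℕ} (i j : Fin (q + 2)) (hij : i ≤ j) (x : CChain K A (q + 2)) :
    chainFace K q j (chainFace K (q + 1) i.castSucc x) =
      chainFace K q i (chainFace K (q + 1) j.succ x) := by
  have e0 : (i.predAbove ∘ j.succ.predAbove) 0 = 0 := by simp
  have el : (i.predAbove ∘ j.succ.predAbove) (Fin.last (q + 3)) = Fin.last (q + 1) := by simp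
  unfold chainFace
  rw [chainMap_chainMap K (AlgHom.id K A) (AlgHom.id K A) (AlgHom.id K A) j.predAbove
      i.castSucc.predAbove (i.predAbove ∘ j.succ.predAbove) _ _ _ _ e0 el (AlgHom.comp_id _)
      (predAbove_comp_predAbove i j hij),
    chainMap_chainMap K (AlgHom.id K A) (AlgHom.id K A) (AlgHom.id K A) i.predAbove
      j.succ.predAbove (i.predAbove ∘ j.succ.predAbove) _ _ _ _ e0 el (AlgHom.comp_id _) rfl]

theorem chainBoundary_chainBoundary {q : ℕ} (x : CChain K A (q + 2)) :
    chainBoundary K A q (chainBoundary K A (q + 1) x) = 0 :=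
  alternating_sum_sq (fun i => (chainFace K (A := A) (q + 1) i).toAddMonoidHom)
    (fun i => (chainFace K (A := A) q i).toAddMonoidHom)
    (fun i j hij x => chainFace_chainFace K i j hij x) x

theorem chainMap_chainBoundary {A' : Type u} [CommRing A'] [Algebra K A'] (g : A →ₐ[K] A') {q : ℕ}
    (h0 hl h0' hl') (x : CChain K A (q + 1)) :
    chainMap K g id h0 hl (chainBoundary K A q x) =
      chainBoundary K A' q (chainMap K g id h0' hl' x) := by
  simp only [chainBoundary_apply, map_sum, map_zsmul]
  refine Finset.sum_congr rfl fun i _ => congrArg _ ?_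
  have e0 : i.predAbove 0 = 0 := by simp
  have el : i.predAbove (Fin.last (q + 2)) = Fin.last (q + 1) := by simp
  unfold chainFace
  rw [chainMap_chainMap K g (AlgHom.id K A) g id i.predAbove i.predAbove _ _ _ _ e0 el
      (AlgHom.comp_id _) rfl,
    chainMap_chainMap K (AlgHom.id K A') g g i.predAbove id i.predAbove _ _ _ _ e0 el
      (AlgHom.id_comp _) rfl]

theorem continuous_chainBoundary (q : ℕ) :
    @Continuous _ _ (chainIdeal K A (q + 1)).adicTopology (chainIdeal K A q).adicTopology
      (chainBoundary K A q) := by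
  let := (chainIdeal K A (q + 1)).adicTopology
  let := (chainIdeal K A q).adicTopology
  have := (chainIdeal K A q).nonarchimedean
  have h : Continuous fun x : CChain K A (q + 1) =>
      ∑ i : Fin (q + 2), (-1 : ℤ) ^ (i : ℕ) • chainFace K (A := A) q i x := by
    refine continuous_finsetSum _ fun i _ => Continuous.zsmul ?_ _
    exact continuous_adic (chainFace K (A := A) q i) (chainIdeal_le_comap K _ _ _ _)
  exact h

theorem continuous_chainPi (q : ℕ) :
    @Continuous _ _ (chainIdeal K A q).adicTopology ⊥ (chainPi K A q) :=
  continuous_adic_discrete (chainPi K A q).toAddMonoidHom (q + 1)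
    (chainPi_eq_zero_of_mem_pow K)

end Chains

section Sheaves
open AlgebraicGeometry CategoryTheory Opposite TopologicalSpace
open scoped Topology

variable {X : Scheme.{u}}

/-- Restriction of functions. -/
def resO {V W : X.Opens} (h : W ≤ V) : Γ(X, V) →+* Γ(X, W) := (X.presheaf.map (homOfLE h).op).hom

/-- Restriction of sections of an `𝒪_X`-module. -/
def resM (M : X.Modules) {V W : X.Opens} (h : W ≤ V) : Γ(M, V) →+ Γ(M, W) :=
  (M.presheaf.map (homOfLE h).op).hom

theorem resO_resO {U V W : X.Opens} (h : W ≤ V) (h' : V ≤ U) (a : Γ(X, U)) :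
    resO h (resO h' a) = resO (h.trans h') a := by
  simp only [resO, ← CommRingCat.comp_apply, ← X.presheaf.map_comp]
  rfl

theorem resO_self {U : X.Opens} (h : U ≤ U) (a : Γ(X, U)) : resO h a = a := by
  have : (homOfLE h).op = 𝟙 (op U) := rfl
  rw [resO, this, X.presheaf.map_id]; rfl

theorem resM_smul (M : X.Modules) {V W : X.Opens} (h : W ≤ V) (a : Γ(X, V)) (m : Γ(M, V)) :
    resM M h (a • m) = resO h a • resM M h m := M.map_smul (homOfLE h) a m

theorem resM_resM (M : X.Modules) {U V W : X.Opens} (h : W ≤ V) (h' : V ≤ U) (m : Γ(M, U)) :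
    resM M h (resM M h' m) = resM M (h.trans h') m := by
  have : (homOfLE (h.trans h')).op = (homOfLE h').op ≫ (homOfLE h).op := rfl
  rw [resM, resM, resM, this, M.presheaf.map_comp]; rfl

theorem resM_self (M : X.Modules) {U : X.Opens} (h : U ≤ U) (m : Γ(M, U)) : resM M h m = m := by
  have : (homOfLE h).op = 𝟙 (op U) := rfl
  rw [resM, this, M.presheaf.map_id]; rfl

theorem app_resM {M N : X.Modules} (φ : M ⟶ N) {V W : X.Opens} (h : W ≤ V) (m : Γ(M, V)) :
    φ.app W (resM M h m) = resM N h (φ.app V m) :=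
  (ConcreteCategory.congr_hom (φ.mapPresheaf.naturality (homOfLE h).op) m)

theorem resM_ext (M : X.Modules) {ι : Type u} {V : X.Opens} (W : ι → X.Opens) (hW : ∀ i, W i ≤ V)
    (hV : V ≤ ⨆ i, W i) (m m' : Γ(M, V)) (h : ∀ i, resM M (hW i) m = resM M (hW i) m') : m = m' :=
  TopCat.Sheaf.eq_of_locally_eq' ⟨M.presheaf, M.isSheaf⟩ W V (fun i => homOfLE (hW i)) hV m m' h

theorem resM_glue (M : X.Modules) {ι : Type u} {V : X.Opens} (W : ι → X.Opens) (hW : ∀ i, W i ≤ V)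
    (hV : V ≤ ⨆ i, W i) (m : ∀ i, Γ(M, W i))
    (h : ∀ i j, resM M (inf_le_left : W i ⊓ W j ≤ W i) (m i) =
      resM M (inf_le_right : W i ⊓ W j ≤ W j) (m j)) : ∃ s : Γ(M, V), ∀ i, resM M (hW i) s = m i :=
  (TopCat.Sheaf.existsUnique_gluing' ⟨M.presheaf, M.isSheaf⟩ W V (fun i => homOfLE (hW i)) hV m
    h).exists

variable (X) in
/-- A topological `𝒪_X`-module, given by its sections over the affine open subsets, which form a
basis of the topology of `X`. The sheaves `Ĉ_q(X)` (the structure sheaf of the formal completion of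
`X^{q+2}` along the diagonal, tensored with `𝒪_X` over that of `X²`) and `Ω^q_{X/K}` are handled by
means of their sections over the affine open subsets `Spec A`, which are `Ĉ_q(A)` and `Ω^q_{A/K}`;
homomorphisms from a sheaf to a sheaf are determined by their restriction to a basis. -/
structure AffineModule where
  obj : X.affineOpens → Type u
  [addCommGroup : ∀ V, AddCommGroup (obj V)]
  [module : ∀ V : X.affineOpens, Module Γ(X, V.1) (obj V)]
  top : ∀ V, TopologicalSpace (obj V)
  res : ∀ {V W : X.affineOpens}, W.1 ≤ V.1 → obj V →+ obj W
  res_smul : ∀ {V W : X.affineOpens} (h : W.1 ≤ V.1) (a : Γ(X, V.1)) (x : obj V),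
    res h (a • x) = resO h a • res h x
  res_self : ∀ {V : X.affineOpens} (x : obj V), res (le_refl V.1) x = x
  res_res : ∀ {U V W : X.affineOpens} (h : W.1 ≤ V.1) (h' : V.1 ≤ U.1) (x : obj U),
    res h (res h' x) = res (h.trans h') x
  continuous_res : ∀ {V W : X.affineOpens} (h : W.1 ≤ V.1), Continuous[top V, top W] (res h)

attribute [instance] AffineModule.addCommGroup AffineModule.module

variable (F G H : AffineModule X) (M N : X.Modules)

/-- Sections over `U` of the sheaf `ℋom^cont(F, M)`: families of `Γ(X, V)`-linear maps
`F(V) → M(V)`, for `V ⊆ U` affine, that commute with restriction and are continuous for the given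
topology on `F(V)` and the discrete topology on `M(V)`. -/
def homSections (U : X.Opens) : AddSubgroup
    (∀ V : {V : X.affineOpens // V.1 ≤ U}, F.obj V.1 →ₗ[Γ(X, V.1.1)] Γ(M, V.1.1)) where
  carrier := {f | (∀ (V W : {V : X.affineOpens // V.1 ≤ U}) (h : W.1.1 ≤ V.1.1) (x : F.obj V.1),
      f W (F.res h x) = resM M h (f V x)) ∧
    ∀ V : {V : X.affineOpens // V.1 ≤ U}, Continuous[F.top V.1, ⊥] (f V)}
  zero_mem' := by
    refine ⟨fun V W h x => (map_zero _).symm, fun V => ?_⟩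
    let := F.top V.1
    let : TopologicalSpace Γ(M, V.1.1) := ⊥
    exact continuous_const
  add_mem' := by
    rintro f g ⟨hf, hf'⟩ ⟨hg, hg'⟩
    refine ⟨fun V W h x => ?_, fun V => ?_⟩
    · rw [Pi.add_apply, LinearMap.add_apply, hf V W h, hg V W h, Pi.add_apply, LinearMap.add_apply,
        map_add]
    · let := F.top V.1
      let : TopologicalSpace Γ(M, V.1.1) := ⊥
      have : DiscreteTopology Γ(M, V.1.1) := ⟨rfl⟩
      exact (hf' V).add (hg' V)
  neg_mem' := by
    rintro f ⟨hf, hf'⟩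
    refine ⟨fun V W h x => ?_, fun V => ?_⟩
    · rw [Pi.neg_apply, LinearMap.neg_apply, hf V W h, Pi.neg_apply, LinearMap.neg_apply, map_neg]
    · let := F.top V.1
      let : TopologicalSpace Γ(M, V.1.1) := ⊥
      have : DiscreteTopology Γ(M, V.1.1) := ⟨rfl⟩
      exact (hf' V).neg

theorem homSections_ext {U : X.Opens} {f g : homSections F M U}
    (h : ∀ (V : {V : X.affineOpens // V.1 ≤ U}) (x : F.obj V.1), f.1 V x = g.1 V x) : f = g :=
  Subtype.ext (funext fun V => LinearMap.ext fun x => h V x)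

instance homSectionsModule (U : X.Opens) : Module Γ(X, U) (homSections F M U) where
  smul a f := ⟨fun V => resO V.2 a • f.1 V, by
    refine ⟨fun V W h x => ?_, fun V => ?_⟩
    · rw [LinearMap.smul_apply, LinearMap.smul_apply, f.2.1 V W h, resM_smul, resO_resO]
    · let := F.top V.1
      let : TopologicalSpace Γ(M, V.1.1) := ⊥
      have : DiscreteTopology Γ(M, V.1.1) := ⟨rfl⟩
      exact (continuous_of_discreteTopology (f := fun m : Γ(M, V.1.1) => resO V.2 a • m)).comp
        (f.2.2 V)⟩
  one_smul f := Subtype.ext (funext fun V => by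
    change resO V.2 1 • f.1 V = f.1 V
    rw [map_one, one_smul])
  mul_smul a b f := Subtype.ext (funext fun V => by
    change resO V.2 (a * b) • f.1 V = resO V.2 a • resO V.2 b • f.1 V
    rw [map_mul, mul_smul])
  smul_zero a := Subtype.ext (funext fun V => smul_zero (resO V.2 a))
  smul_add a f g := Subtype.ext (funext fun V => smul_add (resO V.2 a) (f.1 V) (g.1 V))
  add_smul a b f := Subtype.ext (funext fun V => by
    change resO V.2 (a + b) • f.1 V = resO V.2 a • f.1 V + resO V.2 b • f.1 V
    rw [map_add, add_smul])
  zero_smul f := Subtype.ext (funext fun V => by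
    change resO V.2 0 • f.1 V = 0
    rw [map_zero, zero_smul])

/-- Restriction of sections of the sheaf of continuous homomorphisms. -/
def homRes {U U' : X.Opens} (h : U' ≤ U) : homSections F M U →+ homSections F M U' where
  toFun f := ⟨fun V => f.1 ⟨V.1, V.2.trans h⟩,
    fun V W hVW x => f.2.1 ⟨V.1, V.2.trans h⟩ ⟨W.1, W.2.trans h⟩ hVW x,
    fun V => f.2.2 ⟨V.1, V.2.trans h⟩⟩
  map_zero' := rfl
  map_add' _ _ := rfl

/-- The abelian presheaf underlying the sheaf of continuous homomorphisms. -/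
def homPresheaf : TopCat.Presheaf Ab.{u} X where
  obj U := AddCommGrpCat.of (homSections F M U.unop)
  map i := AddCommGrpCat.ofHom (homRes F M i.unop.le)
  map_id _ := rfl
  map_comp _ _ := rfl

theorem exists_affine (U V : X.Opens) (x : X) (hU : x ∈ U) (hV : x ∈ V) :
    ∃ W : X.affineOpens, x ∈ W.1 ∧ W.1 ≤ U ∧ W.1 ≤ V := by
  obtain ⟨W, hW, hx, h⟩ := X.isBasis_affineOpens.exists_subset_of_mem_open
    (show x ∈ ((U ⊓ V : X.Opens) : Set X) from ⟨hU, hV⟩) (U ⊓ V).2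
  obtain ⟨W, hW, rfl⟩ := hW
  exact ⟨⟨W, hW⟩, hx, fun y hy => (h hy).1, fun y hy => (h hy).2⟩

set_option maxHeartbeats 1000000 in
theorem homPresheaf_isSheaf : (homPresheaf F M).IsSheaf := by
  rw [TopCat.Presheaf.isSheaf_iff_isSheafUniqueGluing]
  intro ι U s hs
  -- the local values agree on every affine open subset of an overlap
  have hs' : ∀ (i j : ι) (V : X.affineOpens) (hi : V.1 ≤ U i) (hj : V.1 ≤ U j) (x : F.obj V),
      (show homSections F M (U i) from s i).1 ⟨V, hi⟩ x =
      (show homSections F M (U j) from s j).1 ⟨V, hj⟩ x := by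
    intro i j V hi hj x
    have h := hs i j
    have h2 := congrArg (fun f : homSections F M (U i ⊓ U j) => f.1 ⟨V, le_inf hi hj⟩ x) h
    exact h2
  let S : ∀ i, homSections F M (U i) := s
  -- the affine open subsets of `V` that are subordinate to the covering
  let I : X.affineOpens → Type u := fun V =>
    {p : ι × X.affineOpens // p.2.1 ≤ U p.1 ∧ p.2.1 ≤ V.1}
  have hcov : ∀ V : X.affineOpens, V.1 ≤ iSup U → V.1 ≤ ⨆ p : I V, p.1.2.1 := by
    intro V hV x hx
    obtain ⟨i, hi⟩ := Opens.mem_iSup.mp (hV hx)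
    obtain ⟨W, hxW, hWi, hWV⟩ := exists_affine _ _ x hi hx
    exact Opens.mem_iSup.mpr ⟨⟨(i, W), hWi, hWV⟩, hxW⟩
  have hglue : ∀ V : {V : X.affineOpens // V.1 ≤ iSup U}, ∃ f : F.obj V.1 →ₗ[Γ(X, V.1.1)] Γ(M, V.1.1),
      ∀ (x : F.obj V.1) (p : I V.1),
        resM M p.2.2 (f x) = (S p.1.1).1 ⟨p.1.2, p.2.1⟩ (F.res p.2.2 x) := by
    intro V
    have hex : ∀ x : F.obj V.1, ∃ m : Γ(M, V.1.1), ∀ p : I V.1,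
        resM M p.2.2 m = (S p.1.1).1 ⟨p.1.2, p.2.1⟩ (F.res p.2.2 x) := by
      intro x
      refine resM_glue M (fun p : I V.1 => p.1.2.1) (fun p => p.2.2) (hcov V.1 V.2) _ ?_
      intro p p'
      let J := {W : X.affineOpens // W.1 ≤ p.1.2.1 ⊓ p'.1.2.1}
      refine resM_ext M (fun W : J => W.1.1) (fun W => W.2) ?_ _ _ ?_
      · intro y hy
        obtain ⟨W, hyW, hW, -⟩ := exists_affine _ _ y hy hy
        exact Opens.mem_iSup.mpr ⟨⟨W, hW⟩, hyW⟩
      · intro W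
        have h1 : W.1.1 ≤ p.1.2.1 := W.2.trans inf_le_left
        have h2 : W.1.1 ≤ p'.1.2.1 := W.2.trans inf_le_right
        rw [resM_resM, resM_resM, ← (S p.1.1).2.1 ⟨p.1.2, p.2.1⟩ ⟨W.1, h1.trans p.2.1⟩ h1,
          ← (S p'.1.1).2.1 ⟨p'.1.2, p'.2.1⟩ ⟨W.1, h2.trans p'.2.1⟩ h2, F.res_res, F.res_res]
        exact hs' _ _ _ _ _ _
    choose m hm using hex
    refine ⟨⟨⟨m, fun x y => ?_⟩, fun a x => ?_⟩, hm⟩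
    · refine resM_ext M (fun p : I V.1 => p.1.2.1) (fun p => p.2.2) (hcov V.1 V.2) _ _ fun p => ?_
      rw [map_add, hm, hm, hm, map_add, map_add]
    · refine resM_ext M (fun p : I V.1 => p.1.2.1) (fun p => p.2.2) (hcov V.1 V.2) _ _ fun p => ?_
      rw [hm, F.res_smul, map_smul, RingHom.id_apply, resM_smul, hm]
  choose f hf using hglue
  have hfS : ∀ (i : ι) (V : X.affineOpens) (hV : V.1 ≤ U i) (x : F.obj V),
      f ⟨V, hV.trans (le_iSup U i)⟩ x = (S i).1 ⟨V, hV⟩ x := by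
    intro i V hV x
    have := hf ⟨V, hV.trans (le_iSup U i)⟩ x ⟨(i, V), hV, le_refl _⟩
    rwa [resM_self, F.res_self] at this
  have hnat : ∀ (V W : {V : X.affineOpens // V.1 ≤ iSup U}) (h : W.1.1 ≤ V.1.1) (x : F.obj V.1),
      f W (F.res h x) = resM M h (f V x) := by
    intro V W h x
    refine resM_ext M (fun p : I W.1 => p.1.2.1) (fun p => p.2.2) (hcov W.1 W.2) _ _ fun p => ?_
    rw [hf W, resM_resM, hf V x ⟨p.1, p.2.1, p.2.2.trans h⟩, F.res_res]
  have hcont : ∀ V : {V : X.affineOpens // V.1 ≤ iSup U}, Continuous[F.top V.1, ⊥] (f V) := by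
    intro V
    let := F.top V.1
    let : TopologicalSpace Γ(M, V.1.1) := ⊥
    have : DiscreteTopology Γ(M, V.1.1) := ⟨rfl⟩
    obtain ⟨t, ht⟩ := V.1.2.isCompact.elim_finite_subcover (fun p : I V.1 => (p.1.2.1 : Set X))
      (fun p => p.1.2.1.2) (fun x hx => by
        obtain ⟨p, hp⟩ := Opens.mem_iSup.mp (hcov V.1 V.2 hx)
        exact Set.mem_iUnion.mpr ⟨p, hp⟩)
    refine continuous_discrete_rng.mpr fun m => ?_
    have : (f V) ⁻¹' {m} = ⋂ p ∈ t, {x | (S p.1.1).1 ⟨p.1.2, p.2.1⟩ (F.res p.2.2 x) =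
        resM M p.2.2 m} := by
      ext x
      simp only [Set.mem_preimage, Set.mem_singleton_iff, Set.mem_iInter, Set.mem_ofPred_eq]
      refine ⟨fun h p _ => by rw [← hf V x p, h], fun h => ?_⟩
      refine resM_ext M (fun p : t => p.1.1.2.1) (fun p => p.1.2.2) ?_ _ _ fun p => ?_
      · intro y hy
        obtain ⟨p, hp, hyp⟩ := Set.mem_iUnion₂.mp (ht hy)
        exact Opens.mem_iSup.mpr ⟨⟨p, hp⟩, hyp⟩
      · rw [hf V x p.1, h p.1 p.2]
    rw [this]
    refine t.finite_toSet.isOpen_biInter fun p _ => ?_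
    let := F.top p.1.2
    let : TopologicalSpace Γ(M, p.1.2.1) := ⊥
    have : DiscreteTopology Γ(M, p.1.2.1) := ⟨rfl⟩
    have hc : Continuous fun x => (S p.1.1).1 ⟨p.1.2, p.2.1⟩ (F.res p.2.2 x) :=
      Continuous.comp ((S p.1.1).2.2 ⟨p.1.2, p.2.1⟩) (F.continuous_res p.2.2)
    exact (isOpen_discrete {resM M p.2.2 m}).preimage hc
  let T : homSections F M (iSup U) := ⟨f, hnat, hcont⟩
  refine ⟨T, fun i => ?_, fun T' hT' => ?_⟩
  · exact homSections_ext F M fun V x => hfS i V.1 V.2 x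
  · let T'' : homSections F M (iSup U) := T'
    change T'' = T
    refine homSections_ext F M fun V x => ?_
    refine resM_ext M (fun p : I V.1 => p.1.2.1) (fun p => p.2.2) (hcov V.1 V.2) _ _ fun p => ?_
    rw [show T.1 = f from rfl, hf V x p,
      ← T''.2.1 V ⟨p.1.2, p.2.1.trans (le_iSup U _)⟩ p.2.2]
    have h := hT' p.1.1
    exact congrArg (fun g : homSections F M (U p.1.1) => g.1 ⟨p.1.2, p.2.1⟩ (F.res p.2.2 x)) h

end Sheaves

section Sheaves2
open AlgebraicGeometry CategoryTheory Opposite TopologicalSpace Limits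
open scoped Topology

variable {X : Scheme.{u}}
variable (F G : AffineModule X) (M N P : X.Modules)

instance homPresheafModule (U : (Opens X)ᵒᵖ) :
    Module (X.ringCatSheaf.obj.obj U) ((homPresheaf F M).obj U) :=
  homSectionsModule F M U.unop

/-- The sheaf `ℋom^cont(F, M)` of continuous `𝒪_X`-linear homomorphisms from a topological module
`F` to an `𝒪_X`-module `M`, which carries the discrete topology. -/
def homCont : X.Modules where
  val := PresheafOfModules.ofPresheaf (R := X.ringCatSheaf.obj) (homPresheaf F M)
    (fun U V i r f => homSections_ext F M fun W x => by
      have h : resO W.2 (resO i.unop.le (show Γ(X, U.unop) from r)) =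
        resO (W.2.trans i.unop.le) (show Γ(X, U.unop) from r) := resO_resO _ _ _
      exact congrArg (fun c => c • (show homSections F M U.unop from f).1
        ⟨W.1, W.2.trans i.unop.le⟩ x) h.symm)
  isSheaf := homPresheaf_isSheaf F M

/-- A morphism of `𝒪_X`-modules from linear maps on sections that commute with restriction. -/
def modulesHomMk (φ : ∀ U : X.Opens, Γ(M, U) →ₗ[Γ(X, U)] Γ(N, U))
    (hφ : ∀ (U V : X.Opens) (h : V ≤ U) (m : Γ(M, U)), φ V (resM M h m) = resM N h (φ U m)) :
    M ⟶ N :=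
  ⟨PresheafOfModules.homMk (M₁ := M.val) (M₂ := N.val)
    { app := fun U => AddCommGrpCat.ofHom (φ U.unop).toAddMonoidHom
      naturality := fun U V i => by
        ext m
        exact hφ U.unop V.unop i.unop.le m }
    (fun U r m => (φ U.unop).map_smul r m)⟩

theorem modules_hom_ext {M N : X.Modules} {φ ψ : M ⟶ N}
    (h : ∀ (U : X.Opens) (m : Γ(M, U)), φ.app U m = ψ.app U m) : φ = ψ :=
  Scheme.Modules.hom_ext _ _ fun U => by ext m; exact h U m

variable {F G M N P}

/-- A continuous `𝒪_X`-linear homomorphism of topological `𝒪_X`-modules. -/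
@[ext]
structure AffineModule.Hom (F G : AffineModule X) where
  app : ∀ V : X.affineOpens, F.obj V →ₗ[Γ(X, V.1)] G.obj V
  naturality : ∀ {V W : X.affineOpens} (h : W.1 ≤ V.1) (x : F.obj V),
    app W (F.res h x) = G.res h (app V x)
  continuous_app : ∀ V : X.affineOpens, Continuous[F.top V, G.top V] (app V)

/-- Precomposition `ℋom^cont(G, M) → ℋom^cont(F, M)`. -/
def homContPre (φ : F.Hom G) (M : X.Modules) : homCont G M ⟶ homCont F M :=
  modulesHomMk _ _
    (fun U =>
      { toFun := fun (f : homSections G M U) => (⟨fun V => (f.1 V).comp (φ.app V.1),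
          fun V W h x => by
            rw [LinearMap.comp_apply, φ.naturality, f.2.1 V W h, LinearMap.comp_apply],
          fun V => by
            let := F.top V.1
            let := G.top V.1
            let : TopologicalSpace Γ(M, V.1.1) := ⊥
            exact (f.2.2 V).comp (φ.continuous_app V.1)⟩ : homSections F M U)
        map_add' := fun _ _ => rfl
        map_smul' := fun _ _ => rfl })
    (fun _ _ _ _ => rfl)

/-- Postcomposition `ℋom^cont(F, M) → ℋom^cont(F, N)`. -/
def homContPost (F : AffineModule X) (φ : M ⟶ N) : homCont F M ⟶ homCont F N :=
  modulesHomMk _ _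
    (fun U =>
      { toFun := fun (f : homSections F M U) => (⟨fun V =>
          { toFun := fun x => φ.app V.1.1 (f.1 V x)
            map_add' := fun x y => by rw [map_add, map_add]
            map_smul' := fun a x => by
              rw [map_smul, RingHom.id_apply, Scheme.Modules.Hom.app_smul] },
          fun V W h x => by
            change φ.app W.1.1 (f.1 W _) = resM N h (φ.app V.1.1 (f.1 V x))
            rw [f.2.1 V W h, app_resM],
          fun V => by
            let := F.top V.1
            let : TopologicalSpace Γ(M, V.1.1) := ⊥
            let : TopologicalSpace Γ(N, V.1.1) := ⊥
            have : DiscreteTopology Γ(M, V.1.1) := ⟨rfl⟩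
            exact (continuous_of_discreteTopology (f := fun m : Γ(M, V.1.1) =>
              φ.app V.1.1 m)).comp (f.2.2 V)⟩ : homSections F N U)
        map_add' := fun f g => homSections_ext F N fun V x =>
          map_add (φ.app V.1.1).hom (f.1 V x) (g.1 V x)
        map_smul' := fun a f => homSections_ext F N fun V x =>
          Scheme.Modules.Hom.app_smul φ (resO V.2 a) (f.1 V x) })
    (fun _ _ _ _ => rfl)

theorem homContPost_comp (F : AffineModule X) (φ : M ⟶ N) (ψ : N ⟶ P) :
    homContPost F φ ≫ homContPost F ψ = homContPost F (φ ≫ ψ) := rfl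

theorem homContPost_zero (F : AffineModule X) : homContPost F (0 : M ⟶ N) = 0 := rfl

theorem homContPre_homContPost (φ : F.Hom G) (ψ : M ⟶ N) :
    homContPre φ M ≫ homContPost F ψ = homContPost G ψ ≫ homContPre φ N := rfl

/-- The zero homomorphism. -/
instance : Zero (AffineModule.Hom F G) where
  zero :=
    { app := fun _ => 0
      naturality := fun h _ => (map_zero (G.res h)).symm
      continuous_app := fun V => by
        let := F.top V
        let := G.top V
        exact continuous_const }

theorem homContPre_zero (M : X.Modules) : homContPre (0 : F.Hom G) M = 0 :=
  modules_hom_ext fun U f => homSections_ext F M fun V _ =>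
    map_zero ((show homSections G M U from f).1 V)

/-- Composition of homomorphisms. -/
def AffineModule.Hom.comp {H : AffineModule X} (ψ : G.Hom H) (φ : F.Hom G) : F.Hom H where
  app V := (ψ.app V).comp (φ.app V)
  naturality h x := by
    rw [LinearMap.comp_apply, φ.naturality, ψ.naturality, LinearMap.comp_apply]
  continuous_app V := by
    let := F.top V
    let := G.top V
    let := H.top V
    exact (ψ.continuous_app V).comp (φ.continuous_app V)

theorem homContPre_comp {H : AffineModule X} (ψ : G.Hom H) (φ : F.Hom G) (M : X.Modules) :
    homContPre ψ M ≫ homContPre φ M = homContPre (ψ.comp φ) M := rfl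

end Sheaves2

section Total
open AlgebraicGeometry CategoryTheory Opposite TopologicalSpace Limits

variable {X : Scheme.{u}}

instance : HasProducts.{0} X.Modules :=
  fun _ => have : HasLimitsOfSize.{0, 0} X.Modules := hasLimitsOfSizeShrink.{0, 0, u, u} _
    inferInstance

variable (X) in
/-- A complex `⋯ → C_2 → C_1 → C_0` of topological `𝒪_X`-modules; `C_q` sits in cohomological
degree `-q`. -/
structure AffineComplex where
  obj : ℕ → AffineModule X
  d : ∀ q : ℕ, (obj (q + 1)).Hom (obj q)
  d_comp_d : ∀ q : ℕ, (d q).comp (d (q + 1)) = 0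

/-- A continuous homomorphism of complexes of topological `𝒪_X`-modules. -/
structure AffineComplex.Hom (C D : AffineComplex X) where
  app : ∀ q : ℕ, (C.obj q).Hom (D.obj q)
  comm : ∀ q : ℕ, (D.d q).comp (app (q + 1)) = (app q).comp (C.d q)

variable (C D : AffineComplex X) (M : CochainComplex X.Modules ℤ)

/-- The `𝒪_X`-module `∏_{q + p = k} ℋom^cont(C_q, M^p)`. -/
def totalHomX (k : ℤ) : X.Modules :=
  ∏ᶜ fun t : {t : ℕ × ℤ // t.1 + t.2 = k} => homCont (C.obj t.1.1) (M.X t.1.2)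

/-- The projection `(f_q)_q ↦ f_q` to `ℋom^cont(C_q, M^p)`, where `q + p = k`. -/
def totalHomπ {k : ℤ} (q : ℕ) (p : ℤ) (h : q + p = k) :
    totalHomX C M k ⟶ homCont (C.obj q) (M.X p) :=
  Pi.π (fun t : {t : ℕ × ℤ // t.1 + t.2 = k} => homCont (C.obj t.1.1) (M.X t.1.2)) ⟨(q, p), h⟩

theorem totalHom_ext {k : ℤ} {N : X.Modules} {f g : N ⟶ totalHomX C M k}
    (h : ∀ (q : ℕ) (p : ℤ) (e : q + p = k), f ≫ totalHomπ C M q p e = g ≫ totalHomπ C M q p e) :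
    f = g :=
  Pi.hom_ext _ _ fun t => h t.1.1 t.1.2 t.2

/-- The component of the differential of `ℋom^cont(C, M)` at `(q, p)`, where `q + p = k + 1`: it
maps `f` of degree `k` to `d_M ∘ f_q - (-1)^k f_{q-1} ∘ ∂`. -/
def totalHomComponent (k : ℤ) : ∀ (q : ℕ) (p : ℤ), q + p = k + 1 →
    (totalHomX C M k ⟶ homCont (C.obj q) (M.X p))
  | 0, p, h => totalHomπ C M 0 (p - 1) (by lia) ≫ homContPost _ (M.d (p - 1) p)
  | q + 1, p, h =>
    totalHomπ C M (q + 1) (p - 1) (by lia) ≫ homContPost _ (M.d (p - 1) p) -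
      k.negOnePow • (totalHomπ C M q p (by push_cast at h; lia) ≫ homContPre (C.d q) (M.X p))

/-- The differential `f ↦ d_M ∘ f - (-1)^k f ∘ ∂` of `ℋom^cont(C, M)`. -/
def totalHomD (k : ℤ) : totalHomX C M k ⟶ totalHomX C M (k + 1) :=
  Pi.lift fun t => totalHomComponent C M k t.1.1 t.1.2 t.2

theorem totalHomD_π_zero (k p : ℤ) (h : ((0 : ℕ) : ℤ) + p = k + 1) :
    totalHomD C M k ≫ totalHomπ C M 0 p h =
      totalHomπ C M 0 (p - 1) (by lia) ≫ homContPost _ (M.d (p - 1) p) :=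
  Pi.lift_π _ _

theorem totalHomD_π_succ (k : ℤ) (q : ℕ) (p : ℤ) (h : ((q + 1 : ℕ) : ℤ) + p = k + 1)
    (h' : (q : ℤ) + p = k) :
    totalHomD C M k ≫ totalHomπ C M (q + 1) p h =
      totalHomπ C M (q + 1) (p - 1) (by lia) ≫ homContPost _ (M.d (p - 1) p) -
      k.negOnePow • (totalHomπ C M q p h' ≫ homContPre (C.d q) (M.X p)) :=
  Pi.lift_π _ _

theorem homContPost_d_d (F : AffineModule X) (i j k : ℤ) :
    homContPost F (M.d i j) ≫ homContPost F (M.d j k) = 0 := by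
  rw [homContPost_comp, M.d_comp_d, homContPost_zero]

theorem homContPre_d_d (q : ℕ) (N : X.Modules) :
    homContPre (C.d q) N ≫ homContPre (C.d (q + 1)) N = 0 := by
  rw [homContPre_comp, C.d_comp_d, homContPre_zero]

theorem totalHomD_totalHomD (k : ℤ) : totalHomD C M k ≫ totalHomD C M (k + 1) = 0 := by
  refine totalHom_ext C M fun q p h => ?_
  rw [Category.assoc, zero_comp]
  rcases q with - | q
  · rw [totalHomD_π_zero, ← Category.assoc, totalHomD_π_zero, Category.assoc, homContPost_d_d,
      comp_zero]
  · have e : (q : ℤ) + p = k + 1 := by push_cast at h; lia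
    rw [totalHomD_π_succ C M (k + 1) q p h e, Preadditive.comp_sub, ← Category.assoc,
      totalHomD_π_succ C M k q (p - 1) _ (by lia), Preadditive.sub_comp, Category.assoc,
      homContPost_d_d, comp_zero, zero_sub, Linear.comp_units_smul, Linear.units_smul_comp,
      ← Category.assoc (totalHomD C M k), Category.assoc (totalHomπ C M q (p - 1) _),
      homContPre_homContPost]
    rcases q with - | q
    · rw [totalHomD_π_zero, Int.negOnePow_succ, Units.neg_smul, Category.assoc]
      abel
    · rw [totalHomD_π_succ C M k q p e (by push_cast at e; lia), Preadditive.sub_comp,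
        Linear.units_smul_comp, Category.assoc, Category.assoc (totalHomπ C M q p _),
        homContPre_d_d, comp_zero, smul_zero, sub_zero, Int.negOnePow_succ, Units.neg_smul]
      abel

/-- The complex `ℋom^cont(C, M)` of `𝒪_X`-modules. -/
def totalHom : CochainComplex X.Modules ℤ :=
  CochainComplex.of (totalHomX C M) (totalHomD C M) (totalHomD_totalHomD C M)

theorem totalHom_d (k : ℤ) : (totalHom C M).d k (k + 1) = totalHomD C M k :=
  CochainComplex.of_d _ _ _

variable {C D}

/-- The maps `ℋom^cont(D_q, M^p) → ℋom^cont(C_q, M^p)` induced by a homomorphism `C → D`. -/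
def totalHomMapX (φ : C.Hom D) (k : ℤ) : totalHomX D M k ⟶ totalHomX C M k :=
  Limits.Pi.map fun t : {t : ℕ × ℤ // t.1 + t.2 = k} => homContPre (φ.app t.1.1) (M.X t.1.2)

theorem totalHomMapX_π (φ : C.Hom D) {k : ℤ} (q : ℕ) (p : ℤ) (e : q + p = k) :
    totalHomMapX M φ k ≫ totalHomπ C M q p e =
      totalHomπ D M q p e ≫ homContPre (φ.app q) (M.X p) :=
  Limits.Pi.map_π _ _

theorem totalHomMapX_comm (φ : C.Hom D) (k : ℤ) :
    totalHomMapX M φ k ≫ totalHomD C M k = totalHomD D M k ≫ totalHomMapX M φ (k + 1) := by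
  refine totalHom_ext C M fun q p h => ?_
  rw [Category.assoc, Category.assoc, totalHomMapX_π, ← Category.assoc (totalHomD D M k)]
  rcases q with - | q
  · rw [totalHomD_π_zero, totalHomD_π_zero, ← Category.assoc, totalHomMapX_π, Category.assoc,
      Category.assoc, homContPre_homContPost]
  · have e : (q : ℤ) + p = k := by push_cast at h; lia
    rw [totalHomD_π_succ C M k q p h e, totalHomD_π_succ D M k q p h e, Preadditive.comp_sub,
      Preadditive.sub_comp, ← Category.assoc, totalHomMapX_π, Category.assoc, Category.assoc,
      homContPre_homContPost, Linear.comp_units_smul, ← Category.assoc (totalHomMapX M φ k),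
      totalHomMapX_π, Linear.units_smul_comp, Category.assoc, Category.assoc, homContPre_comp,
      homContPre_comp, φ.comm]

/-- The map of complexes `ℋom^cont(D, M) → ℋom^cont(C, M)` induced by a homomorphism `C → D`. -/
def totalHomMap (φ : C.Hom D) : totalHom D M ⟶ totalHom C M :=
  CochainComplex.ofHom (totalHomMapX M φ) (fun k => by
    rw [totalHom_d, totalHom_d]
    exact totalHomMapX_comm M φ k)

variable (C)

/-- The complex `ℋom^cont(C, N)` with `N` in degree `0`, with terms `ℋom^cont(C_q, N)` in degree
`q ≥ 0` and differential `f ↦ -(-1)^q f ∘ ∂`. -/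
def homContComplex (N : X.Modules) : CochainComplex X.Modules ℕ :=
  CochainComplex.of (fun q => homCont (C.obj q) N)
    (fun q => (-1 : ℤˣ) ^ (q + 1) • homContPre (C.d q) N)
    (fun q => by
      rw [Linear.comp_units_smul, Linear.units_smul_comp, homContPre_d_d, smul_zero, smul_zero])

theorem homContComplex_d (N : X.Modules) (q : ℕ) : (homContComplex C N).d q (q + 1) =
    (-1 : ℤˣ) ^ (q + 1) • homContPre (C.d q) N :=
  CochainComplex.of_d (fun q => homCont (C.obj q) N)
    (fun q => (-1 : ℤˣ) ^ (q + 1) • homContPre (C.d q) N) q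

end Total

section Polyvector
open AlgebraicGeometry CategoryTheory Opposite TopologicalSpace Limits

variable {X : Scheme.{u}} (T : X.Modules) (q : ℕ)

/-- Restriction of sections as a semilinear map. -/
def resML {U V : X.Opens} (h : V ≤ U) : Γ(T, U) →ₛₗ[resO h] Γ(T, V) where
  toFun := resM T h
  map_add' := map_add _
  map_smul' a m := resM_smul T h a m

/-- The map `⋀^q Γ(T, U) → ⋀^q Γ(T, V)` given by restriction. -/
def wedgeRes {U V : X.Opens} (h : V ≤ U) :
    ⋀[Γ(X, U)]^q Γ(T, U) →ₛₗ[resO h] ⋀[Γ(X, V)]^q Γ(T, V) :=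
  wedgeMap (resO h) (resML T h) q

/-- The abelian presheaf `U ↦ ⋀^q Γ(T, U)`. -/
def wedgePresheafAb : TopCat.Presheaf Ab.{u} X where
  obj U := AddCommGrpCat.of (⋀[Γ(X, U.unop)]^q Γ(T, U.unop))
  map i := AddCommGrpCat.ofHom (wedgeRes T q i.unop.le).toAddMonoidHom
  map_id U := by
    ext x
    refine congrArg Subtype.val ?_
    exact wedgeMap_id _ (resML T (le_refl U.unop)) (RingHom.ext fun a => resO_self _ a)
      (fun m => resM_self T _ m) q x
  map_comp i j := by
    ext x
    refine congrArg Subtype.val ?_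
    exact (wedgeMap_comp _ _ _ (resML T i.unop.le) (resML T j.unop.le)
      (resML T (j.unop.le.trans i.unop.le)) (RingHom.ext fun a => resO_resO _ _ a)
      (fun m => resM_resM T _ _ m) q x).symm

instance wedgePresheafModule (U : (Opens X)ᵒᵖ) :
    Module (X.ringCatSheaf.obj.obj U) ((wedgePresheafAb T q).obj U) :=
  inferInstanceAs (Module Γ(X, U.unop) (⋀[Γ(X, U.unop)]^q Γ(T, U.unop)))

/-- The presheaf of modules `U ↦ ⋀^q Γ(T, U)`. -/
def wedgePresheaf : PresheafOfModules.{u} X.ringCatSheaf.obj :=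
  PresheafOfModules.ofPresheaf (wedgePresheafAb T q)
    (fun _ _ i r x => (wedgeRes T q i.unop.le).map_smulₛₗ r x)

/-- The exterior power `⋀^q T` of an `𝒪_X`-module `T`: the sheaf associated with
`U ↦ ⋀^q Γ(T, U)`. -/
def wedgeModule : X.Modules :=
  (PresheafOfModules.sheafification (𝟙 X.ringCatSheaf.obj)).obj (wedgePresheaf T q)

variable {T q} in
/-- A homomorphism from `⋀^q T` to an `𝒪_X`-module, from compatible linear maps on
`⋀^q Γ(T, U)`. -/
def wedgeModuleDesc {N : X.Modules}
    (φ : ∀ U : X.Opens, ⋀[Γ(X, U)]^q Γ(T, U) →ₗ[Γ(X, U)] Γ(N, U))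
    (hφ : ∀ (U V : X.Opens) (h : V ≤ U) (x : ⋀[Γ(X, U)]^q Γ(T, U)),
      φ V (wedgeRes T q h x) = resM N h (φ U x)) :
    wedgeModule T q ⟶ N :=
  (PresheafOfModules.sheafificationHomEquiv (𝟙 X.ringCatSheaf.obj)).symm
    (PresheafOfModules.homMk (M₁ := wedgePresheaf T q)
      (M₂ := (PresheafOfModules.restrictScalars (𝟙 X.ringCatSheaf.obj)).obj N.val)
      { app := fun U => AddCommGrpCat.ofHom (φ U.unop).toAddMonoidHom
        naturality := fun U V i => by
          ext x
          exact hφ U.unop V.unop i.unop.le x }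
      (fun U r x => (φ U.unop).map_smul r x))

end Polyvector

section Unit
open AlgebraicGeometry

variable (X : Scheme.{u})

/-- The structure sheaf `𝒪_X` as a module over itself. -/
def structureModule : X.Modules := SheafOfModules.unit X.ringCatSheaf

end Unit

section Aux
variable (K : Type u) {A A' : Type u} [CommRing K] [CommRing A] [Algebra K A] [CommRing A']
  [Algebra K A'] (g : A →ₐ[K] A')

theorem kaehlerMap_smul (a : A) (x : Ω[A⁄K]) :
    kaehlerMap K g (a • x) = g a • kaehlerMap K g x := (kaehlerMap K g).map_smulₛₗ a x

theorem formMap_smul {q : ℕ} (a : A) (x : ⋀[A]^q Ω[A⁄K]) :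
    formMap K g q (a • x) = g a • formMap K g q x := (formMap K g q).map_smulₛₗ a x

theorem formMap_comp {A'' : Type u} [CommRing A''] [Algebra K A''] (g' : A' →ₐ[K] A'')
    (m : A →ₐ[K] A'') (e : g'.comp g = m) {q : ℕ} (x : ⋀[A]^q Ω[A⁄K]) :
    formMap K g' q (formMap K g q x) = formMap K m q x :=
  wedgeMap_comp _ _ _ _ _ _ (congrArg AlgHom.toRingHom e) (fun m => kaehlerMap_comp K _ _ _ e m) q x

theorem formMap_id (g : A →ₐ[K] A) (e : g = AlgHom.id K A) {q : ℕ} (x : ⋀[A]^q Ω[A⁄K]) :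
    formMap K g q x = x :=
  wedgeMap_id _ _ (congrArg AlgHom.toRingHom e) (fun m => kaehlerMap_id K _ e m) q x
end Aux

section Main
open AlgebraicGeometry CategoryTheory Opposite TopologicalSpace Limits

variable {K : Type u} [CommRing K] {X : Scheme.{u}} (f : X ⟶ Spec (CommRingCat.of K))

/-- The structure morphism `K → Γ(X, V)` of a `K`-scheme `X`. -/
def structureHom (V : X.Opens) : K →+* Γ(X, V) :=
  (resO (le_top : V ≤ ⊤)).comp ((Scheme.ΓSpecIso (CommRingCat.of K)).inv ≫ f.appTop).hom

theorem resO_structureHom {V W : X.Opens} (h : W ≤ V) (c : K) :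
    resO h (structureHom f V c) = structureHom f W c :=
  resO_resO h le_top _

/-- The ring `Γ(X, V)`, regarded as a `K`-algebra by means of the morphism `f : X → Spec K`. -/
def Sec (_ : X ⟶ Spec (CommRingCat.of K)) (V : X.Opens) : Type u := Γ(X, V)

instance (V : X.Opens) : CommRing (Sec f V) := inferInstanceAs (CommRing Γ(X, V))
instance (V : X.Opens) : Algebra K (Sec f V) := (structureHom f V).toAlgebra

/-- Restriction of functions as a ring homomorphism to `Sec f V`. -/
def resToSec {U V : X.Opens} (h : V ≤ U) : Γ(X, U) →+* Sec f V := resO h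

/-- Restriction of functions as a homomorphism of `K`-algebras. -/
def resSec {V W : X.Opens} (h : W ≤ V) : Sec f V →ₐ[K] Sec f W where
  __ := (resO h : Γ(X, V) →+* Γ(X, W))
  commutes' c := resO_structureHom f h c

theorem resSec_comp {U V W : X.Opens} (h : W ≤ V) (h' : V ≤ U) :
    (resSec f h).comp (resSec f h') = resSec f (h.trans h') :=
  AlgHom.ext fun a => resO_resO h h' a

theorem resSec_self {V : X.Opens} (h : V ≤ V) : resSec f h = AlgHom.id K (Sec f V) :=
  AlgHom.ext fun a => resO_self h a

/-- The sheaf `Ĉ_q(X)` of complete Hochschild chains of degree `q`, with its adic topology: its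
sections over an affine open subset `V = Spec A` are `Ĉ_q(A)`. -/
def chainModule (q : ℕ) : AffineModule X where
  obj V := CChain K (Sec f V.1) q
  module V := inferInstanceAs (Module (Sec f V.1) (CChain K (Sec f V.1) q))
  top V := (chainIdeal K (Sec f V.1) q).adicTopology
  res h := (chainMap K (resSec f h) id rfl rfl).toAddMonoidHom
  res_smul h a x := chainMap_smul K (resSec f h) id rfl rfl a x
  res_self {V} x := by
    change chainMap K (resSec f (le_refl V.1)) id rfl rfl x = x
    rw [resSec_self]
    exact chainMap_id K rfl rfl x
  res_res h h' x := chainMap_chainMap K _ _ _ id id id rfl rfl rfl rfl rfl rfl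
    (resSec_comp f h h') rfl x
  continuous_res h := continuous_adic _ (chainIdeal_le_comap K (resSec f h) id rfl rfl)

/-- The complex `⋯ → Ĉ_2(X) → Ĉ_1(X) → Ĉ_0(X)` of complete Hochschild chains. -/
def chainComplex : AffineComplex X where
  obj q := chainModule f q
  d q :=
    { app := fun V => chainBoundary K (Sec f V.1) q
      naturality := fun h x => (chainMap_chainBoundary K (resSec f h) rfl rfl rfl rfl x).symm
      continuous_app := fun _ => continuous_chainBoundary K q }
  d_comp_d _ := AffineModule.Hom.ext (funext fun _ => LinearMap.ext fun x =>
    chainBoundary_chainBoundary K x)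

/-- The sheaf `Ω^1_{X/K}`, with the discrete topology: its sections over an affine open subset
`V = Spec A` are `Ω_{A/K}`. -/
def kaehlerModule : AffineModule X where
  obj V := Ω[Sec f V.1⁄K]
  module V := inferInstanceAs (Module (Sec f V.1) Ω[Sec f V.1⁄K])
  top _ := ⊥
  res h := (kaehlerMap K (resSec f h)).toAddMonoidHom
  res_smul h a x := by with_unfolding_all exact kaehlerMap_smul K (resSec f h) a x
  res_self x := kaehlerMap_id K _ (resSec_self f _) x
  res_res h h' x := kaehlerMap_comp K _ _ _ (resSec_comp f h h') x
  continuous_res _ := continuous_bot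

/-- The sheaf `Ω^q_{X/K}`, with the discrete topology: its sections over an affine open subset
`V = Spec A` are `⋀^q Ω_{A/K}`. -/
def formModule (q : ℕ) : AffineModule X where
  obj V := ⋀[Sec f V.1]^q Ω[Sec f V.1⁄K]
  module V := inferInstanceAs (Module (Sec f V.1) (⋀[Sec f V.1]^q Ω[Sec f V.1⁄K]))
  top _ := ⊥
  res h := (formMap K (resSec f h) q).toAddMonoidHom
  res_smul h a x := by with_unfolding_all exact formMap_smul K (resSec f h) a x
  res_self x := formMap_id K _ (resSec_self f _) x
  res_res h h' x := formMap_comp K _ _ _ (resSec_comp f h h') x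
  continuous_res _ := continuous_bot

/-- The complex `⨁_q Ω^q_{X/K}[q]` with zero differential. -/
def formComplex : AffineComplex X where
  obj q := formModule f q
  d _ := 0
  d_comp_d _ := rfl

/-- The homomorphism of complexes `π : Ĉ(X) → ⨁_q Ω^q_{X/K}[q]`. -/
def chainToForm : (chainComplex f).Hom (formComplex f) where
  app q :=
    { app := fun V => chainPi K (Sec f V.1) q
      naturality := fun h x => (formMap_chainPi K (resSec f h) rfl rfl x).symm
      continuous_app := fun _ => continuous_chainPi K q }
  comm _ := AffineModule.Hom.ext (funext fun _ => LinearMap.ext fun x =>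
    (chainPi_chainBoundary K x).symm)

/-- The tangent sheaf `𝒯_{X/K} = ℋom(Ω^1_{X/K}, 𝒪_X)`. -/
def tangentModule : X.Modules := homCont (kaehlerModule f) (structureModule X)

/-- The complex `C_cd(X) = ℋom^cont(Ĉ(X), 𝒪_X)` of continuous Hochschild cochains. -/
def cochainComplex : CochainComplex X.Modules ℕ :=
  homContComplex (chainComplex f) (structureModule X)

/-- The complex `⨁_q (⋀^q 𝒯_{X/K})[-q]` with zero differential. -/
def polyvectorComplex : CochainComplex X.Modules ℕ :=
  CochainComplex.of (fun q => wedgeModule (tangentModule f) q) (fun _ => 0) (fun _ => zero_comp)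

theorem polyvectorComplex_d (q : ℕ) : (polyvectorComplex f).d q (q + 1) = 0 :=
  CochainComplex.of_d (fun q => wedgeModule (tangentModule f) q) (fun _ => 0) q

theorem cochainComplex_d (q : ℕ) : (cochainComplex f).d q (q + 1) =
    (-1 : ℤˣ) ^ (q + 1) • homContPre ((chainComplex f).d q) (structureModule X) :=
  homContComplex_d _ _ _

/-- The value on `V ≤ U` of a vector field on `U`, as an `A`-linear form on `Ω_{A/K}`, where
`V = Spec A`. -/
def evalTangent {U : X.Opens} (V : {V : X.affineOpens // V.1 ≤ U}) :
    Γ(tangentModule f, U) →ₛₗ[resToSec f V.2]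
      Module.Dual (Sec f V.1.1) Ω[Sec f V.1.1⁄K] where
  toFun v :=
    { toFun := fun x => (show homSections (kaehlerModule f) (structureModule X) U from v).1 V x
      map_add' := fun x y =>
        ((show homSections (kaehlerModule f) (structureModule X) U from v).1 V).map_add x y
      map_smul' := fun a x =>
        ((show homSections (kaehlerModule f) (structureModule X) U from v).1 V).map_smul a x }
  map_add' _ _ := rfl
  map_smul' _ _ := rfl

/-- The linear form on `Ω^q_{A/K}`, where `V = Spec A`, defined by a polyvector field
`v₁ ∧ ⋯ ∧ v_q` on `U ≥ V`; it maps `ω₁ ∧ ⋯ ∧ ω_q` to `det (v_j(ω_i))`. -/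
def pairingForm {U : X.Opens} (q : ℕ) (V : {V : X.affineOpens // V.1 ≤ U})
    (v : ⋀[Γ(X, U)]^q Γ(tangentModule f, U)) :
    Module.Dual (Sec f V.1.1) (⋀[Sec f V.1.1]^q Ω[Sec f V.1.1⁄K]) :=
  exteriorPower.pairingDual (Sec f V.1.1) Ω[Sec f V.1.1⁄K] q
    (wedgeMap (resToSec f V.2) (evalTangent f V) q v)

variable {f} in
theorem pairingForm_add {U : X.Opens} {q : ℕ} (V : {V : X.affineOpens // V.1 ≤ U})
    (v w : ⋀[Γ(X, U)]^q Γ(tangentModule f, U)) :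
    pairingForm f q V (v + w) = pairingForm f q V v + pairingForm f q V w := by
  rw [pairingForm, map_add, map_add]; rfl

variable {f} in
theorem pairingForm_smul {U : X.Opens} {q : ℕ} (V : {V : X.affineOpens // V.1 ≤ U}) (a : Γ(X, U))
    (v : ⋀[Γ(X, U)]^q Γ(tangentModule f, U)) :
    pairingForm f q V (a • v) =
      (resToSec f V.2) a • pairingForm f q V v := by
  rw [pairingForm, map_smulₛₗ, map_smul]; rfl

theorem pairingForm_ιMulti {U : X.Opens} {q : ℕ} (V : {V : X.affineOpens // V.1 ≤ U})
    (v : Fin q → Γ(tangentModule f, U)) (x : Fin q → Ω[Sec f V.1.1⁄K]) :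
    pairingForm f q V (exteriorPower.ιMulti _ q v) (exteriorPower.ιMulti _ q x) =
      Matrix.det (Matrix.of fun i j => evalTangent f V (v j) (x i)) := by
  rw [pairingForm, wedgeMap_ιMulti, exteriorPower.pairingDual_ιMulti_ιMulti]

theorem evalTangent_res {U : X.Opens} (V W : {V : X.affineOpens // V.1 ≤ U}) (h : W.1.1 ≤ V.1.1)
    (v : Γ(tangentModule f, U)) (x : Ω[Sec f V.1.1⁄K]) :
    evalTangent f W v (kaehlerMap K (resSec f h) x) = resSec f h (evalTangent f V v x) :=
  (show homSections (kaehlerModule f) (structureModule X) U from v).2.1 V W h x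

theorem pairingForm_res {U : X.Opens} {q : ℕ} (V W : {V : X.affineOpens // V.1 ≤ U})
    (h : W.1.1 ≤ V.1.1) (v : ⋀[Γ(X, U)]^q Γ(tangentModule f, U))
    (x : ⋀[Sec f V.1.1]^q Ω[Sec f V.1.1⁄K]) :
    pairingForm f q W v (formMap K (resSec f h) q x) = resSec f h (pairingForm f q V v x) := by
  induction v using wedge_induction with
  | hs c v hv =>
    rw [pairingForm_smul, pairingForm_smul, LinearMap.smul_apply, LinearMap.smul_apply, hv,
      smul_eq_mul, smul_eq_mul, map_mul]
    exact congrArg (· * _) (resO_resO h V.2 c).symm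
  | ha v w hv hw =>
    rw [pairingForm_add, pairingForm_add, LinearMap.add_apply, LinearMap.add_apply, hv, hw, map_add]
  | hm v =>
    induction x using wedge_induction with
    | hm x =>
      have h1 : formMap K (resSec f h) q (exteriorPower.ιMulti _ q x) =
          exteriorPower.ιMulti _ q (fun i => kaehlerMap K (resSec f h) (x i)) :=
        wedgeMap_ιMulti _ _ q x
      have h2 := pairingForm_ιMulti f W v (fun i => kaehlerMap K (resSec f h) (x i))
      have h3 := pairingForm_ιMulti f V v x
      refine (congrArg _ h1).trans (h2.trans (Eq.trans ?_ (congrArg (resSec f h) h3).symm))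
      rw [AlgHom.map_det]
      refine congrArg _ (Matrix.ext fun i j => ?_)
      exact evalTangent_res f V W h (v j) (x i)
    | hs c x hx =>
      have h1 := formMap_smul K (resSec f h) c x
      have h2 := (pairingForm f q V (exteriorPower.ιMulti _ q v)).map_smul c x
      have h3 := (pairingForm f q W (exteriorPower.ιMulti _ q v)).map_smul (resSec f h c)
        (formMap K (resSec f h) q x)
      exact (congrArg _ h1).trans (h3.trans ((congrArg (resSec f h c * ·) hx).trans
        ((congrArg (resSec f h) h2).trans (map_mul (resSec f h) c _)).symm))
    | ha x y hx hy =>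
      have h1 := (formMap K (resSec f h) q).map_add x y
      have h2 := (pairingForm f q V (exteriorPower.ιMulti _ q v)).map_add x y
      have h3 := (pairingForm f q W (exteriorPower.ιMulti _ q v)).map_add
        (formMap K (resSec f h) q x) (formMap K (resSec f h) q y)
      exact (congrArg _ h1).trans (h3.trans ((congrArg₂ (· + ·) hx hy).trans
        ((congrArg (resSec f h) h2).trans (map_add (resSec f h) _ _)).symm))

/-- `pairingForm f q V v` as a `Γ(X, V)`-linear map. -/
def pairingLinear {U : X.Opens} (q : ℕ) (V : {V : X.affineOpens // V.1 ≤ U})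
    (v : ⋀[Γ(X, U)]^q Γ(tangentModule f, U)) :
    (formModule f q).obj V.1 →ₗ[Γ(X, V.1.1)] Γ(structureModule X, V.1.1) where
  toFun := fun x : ⋀[Sec f V.1.1]^q Ω[Sec f V.1.1⁄K] => pairingForm f q V v x
  map_add' := fun x y : ⋀[Sec f V.1.1]^q Ω[Sec f V.1.1⁄K] => (pairingForm f q V v).map_add x y
  map_smul' := fun (a : Sec f V.1.1) (x : ⋀[Sec f V.1.1]^q Ω[Sec f V.1.1⁄K]) =>
    (pairingForm f q V v).map_smul a x

/-- The section of `ℋom(Ω^q_{X/K}, 𝒪_X)` over `U` defined by an element of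
`⋀^q 𝒯_{X/K}(U)`. -/
def pairingSection {U : X.Opens} {q : ℕ} (v : ⋀[Γ(X, U)]^q Γ(tangentModule f, U)) :
    homSections (formModule f q) (structureModule X) U :=
  ⟨fun V => pairingLinear f q V v,
    fun V W h (x : ⋀[Sec f V.1.1]^q Ω[Sec f V.1.1⁄K]) => pairingForm_res f V W h v x,
    fun _ => continuous_bot⟩

/-- The homomorphism `⋀^q 𝒯_{X/K} → ℋom(Ω^q_{X/K}, 𝒪_X)` that maps `v₁ ∧ ⋯ ∧ v_q` to
`ω₁ ∧ ⋯ ∧ ω_q ↦ det (v_j(ω_i)) = ∑_σ sgn(σ) v_{σ(1)}(ω₁) ⋯ v_{σ(q)}(ω_q)`. -/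
def wedgeDual (q : ℕ) :
    wedgeModule (tangentModule f) q ⟶ homCont (formModule f q) (structureModule X) :=
  wedgeModuleDesc
    (fun _ =>
      { toFun := fun v => pairingSection f v
        map_add' := fun v w => homSections_ext _ _ fun V x =>
          DFunLike.congr_fun (pairingForm_add V v w) x
        map_smul' := fun a v => homSections_ext _ _ fun V x =>
          DFunLike.congr_fun (pairingForm_smul V a v) x })
    (fun _ _ h v => homSections_ext _ _ fun V x =>
      DFunLike.congr_fun (congrArg (exteriorPower.pairingDual (Sec f V.1.1) Ω[Sec f V.1.1⁄K] q)
        (wedgeMap_comp _ _ _ (resML (tangentModule f) h) (evalTangent f V)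
          (evalTangent f ⟨V.1, V.2.trans h⟩) (RingHom.ext fun a => resO_resO _ _ a)
          (fun _ => rfl) q v)) x)

theorem homContPre_chainToForm_d (q : ℕ) (N : X.Modules) :
    homContPre ((chainToForm f).app q) N ≫
      ((-1 : ℤˣ) ^ (q + 1) • homContPre ((chainComplex f).d q) N) = 0 := by
  rw [Linear.comp_units_smul, homContPre_comp, ← (chainToForm f).comm]
  exact (congrArg _ (homContPre_zero _)).trans (smul_zero _)

/-- The homomorphism of complexes `π_cd : ⨁_q (⋀^q 𝒯_{X/K})[-q] → C_cd(X)`: the composition of the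
canonical map `⋀^q 𝒯_{X/K} → ℋom(Ω^q_{X/K}, 𝒪_X)` with the map induced by `π`. -/
def piCd : polyvectorComplex f ⟶ cochainComplex f :=
  CochainComplex.ofHom
    (fun q => wedgeDual f q ≫ homContPre ((chainToForm f).app q) (structureModule X))
    (fun q => by
      rw [polyvectorComplex_d, cochainComplex_d, zero_comp]
      exact (Category.assoc _ _ _).trans
        ((congrArg _ (homContPre_chainToForm_d f q _)).trans comp_zero))

end Main

end

end CompleteHochschild

/-! The problem is local, and étale coordinates turn it into a computation with polynomial rings.
Let `t₁, …, t_n` be étale coordinates of `A`, and let `x_{rj}` be the copy of `t_j` in the factor `r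
+ 1` minus the copy in the factor `0`. This gives a map `A[x_{rj}] → Ĉ_q(A)` (`polyToChain`). Formal
étaleness provides Taylor expansions `a ↦ a(t + x)`, and the uniqueness of étale lifts shows that
the two rings agree modulo the `m`-th powers of their ideals, for every `m`
(`chainTaylor_polyToChain`, `exists_polyToChain_rep`). Hence a continuous homomorphism from `Ĉ_q(A)`
to a discrete module is the same as an `A`-linear map on `A[x]` that kills a power of `(x)`. Nothing
is asked of the target, which is why `M` need not be quasi-coherent.

The boundary restricts to `A[x]`, where it becomes the bar construction computing `Tor^{A[t]}(A,
A)`. To find the cycles, start from the bar resolution of `A` over `A[t]` and divide by `t₁, …, t_n`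
one after another. Each `t_i` is regular, and the connecting homomorphism sends the determinant
attached to `(i, J)` to the one attached to `J`. So every cycle is, up to a boundary, a combination
of the antisymmetrized monomials `det (x_{r,J(s)})` (`exists_polyChain_decomp`). Since `π` maps such
a determinant to `q! dt_{J(1)} ∧ ⋯ ∧ dt_{J(q)}`, division by `q!` gives a section `s` of `π`; this
is possible for `q ≤ n`, and for `q > n` there are no forms.

As `A[x]` is free over `A`, cycles can be lifted one monomial at a time, which yields an `A`-linear
homotopy `h` from `sπ` to the identity (`exists_polyChain_homotopy`). The homotopy on chains of
degree `q` is chosen to preserve polynomial degrees above `q`. It therefore respects high powers of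
`(x)`, and composition with it preserves continuity.

Composition with `s` and `h` gives operators `σ` and `η` on sections over a chart, natural in `M`
(`exists_section_homotopy`). Naturality makes them commute with `d_M`, so they show, for an
arbitrary complex `M`, that the map of complexes of sections over each chart is bijective on
cohomology. Charts form a basis of the topology, and this suffices for a quasi-isomorphism of
sheaves (`quasiIso_of_sections`). The second assertion uses the same operators with the coefficients
`𝒪_X`, together with the fact that over a chart `⋀^q 𝒯_X` is the dual of the free module `Ω^q`
(`wedgeDual_bijective`). -/

namespace CompleteHochschild
open TensorProduct

noncomputable section

/-! ### The bar resolution of `A` over `A[t₁, …, t_n]` and its quotients by some of the variables.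
-/

section PolynomialBar
open MvPolynomial

variable (A : Type u) [CommRing A] (n : ℕ)

/-- The bar resolution of the polynomial ring `A[t₁, …, t_n]` in degree `q`: the variable `(s, j)`
is the copy of `t_j` in the `s`-th tensor factor. -/
abbrev PolyBar (q : ℕ) : Type u := MvPolynomial (Fin (q + 1) × Fin n) A

/-- The variables of `PolyBar A n q`, extended by zero to one more factor on the right. -/
def polyBarVar (q : ℕ) (s : Fin (q + 2)) (j : Fin n) : PolyBar A n q :=
  Fin.lastCases (motive := fun _ => PolyBar A n q) 0 (fun s => X (s, j)) s

variable {n} in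
@[simp] theorem polyBarVar_last (q : ℕ) (j : Fin n) : polyBarVar A n q (Fin.last _) j = 0 := by
  simp [polyBarVar]

variable {n} in
@[simp] theorem polyBarVar_castSucc (q : ℕ) (s : Fin (q + 1)) (j : Fin n) :
    polyBarVar A n q s.castSucc j = X (s, j) := by
  simp [polyBarVar]

/-- The faces of the bar resolution; the last one is the augmentation of the last factor. -/
def polyBarFace (q : ℕ) (i : Fin (q + 2)) : PolyBar A n (q + 1) →ₐ[A] PolyBar A n q :=
  aeval fun p => polyBarVar A n q (i.predAbove p.1.castSucc) p.2

theorem polyBarFace_X (q : ℕ) (i : Fin (q + 2)) (p : Fin (q + 2) × Fin n) :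
    polyBarFace A n q i (X p) = polyBarVar A n q (i.predAbove p.1.castSucc) p.2 := by
  simp [polyBarFace]

theorem polyBarFace_var (q : ℕ) (i : Fin (q + 2)) (s : Fin (q + 3)) (j : Fin n) :
    polyBarFace A n q i (polyBarVar A n (q + 1) s j) = polyBarVar A n q (i.predAbove s) j := by
  induction s using Fin.lastCases with
  | last => simp
  | cast s => simp [polyBarFace]

/-- The differential of the bar resolution. -/
def polyBarD (q : ℕ) : PolyBar A n (q + 1) →ₗ[A] PolyBar A n q :=
  ∑ i : Fin (q + 2), (-1 : ℤ) ^ (i : ℕ) • (polyBarFace A n q i).toLinearMap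

theorem polyBarD_apply (q : ℕ) (z : PolyBar A n (q + 1)) :
    polyBarD A n q z = ∑ i : Fin (q + 2), (-1 : ℤ) ^ (i : ℕ) • polyBarFace A n q i z := by
  simp [polyBarD]

theorem polyBarFace_comp (q : ℕ) (i j : Fin (q + 2)) (hij : i ≤ j) (z : PolyBar A n (q + 2)) :
    polyBarFace A n q j (polyBarFace A n (q + 1) i.castSucc z) =
      polyBarFace A n q i (polyBarFace A n (q + 1) j.succ z) := by
  have : (polyBarFace A n q j).comp (polyBarFace A n (q + 1) i.castSucc) =
      (polyBarFace A n q i).comp (polyBarFace A n (q + 1) j.succ) := by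
    refine algHom_ext fun p => ?_
    rw [AlgHom.comp_apply, AlgHom.comp_apply, polyBarFace_X, polyBarFace_X, polyBarFace_var,
      polyBarFace_var]
    exact congrArg (polyBarVar A n q · p.2) (congrFun (predAbove_comp_predAbove i j hij) _)
  exact DFunLike.congr_fun this z

theorem polyBarD_polyBarD (q : ℕ) (z : PolyBar A n (q + 2)) :
    polyBarD A n q (polyBarD A n (q + 1) z) = 0 := by
  simp only [polyBarD_apply]
  exact alternating_sum_sq (fun i => (polyBarFace A n (q + 1) i).toRingHom.toAddMonoidHom)
    (fun i => (polyBarFace A n q i).toRingHom.toAddMonoidHom)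
    (fun i j hij x => polyBarFace_comp A n q i j hij x) z

/-- Every face sends the factor `0` to the factor `0`, so the differential is linear over the
polynomial ring of that factor. The extra degeneracy is not, which is why homology appears after
dividing by its variables. -/
theorem polyBarD_X_zero_mul (q : ℕ) (j : Fin n) (z : PolyBar A n (q + 1)) :
    polyBarD A n q (X (0, j) * z) = X (0, j) * polyBarD A n q z := by
  simp only [polyBarD_apply, Finset.mul_sum, map_mul, polyBarFace_X]
  refine Finset.sum_congr rfl fun i _ => ?_
  have : (i.predAbove (0 : Fin (q + 2)).castSucc : Fin (q + 2)) = (0 : Fin (q + 1)).castSucc := by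
    simp
  rw [this, polyBarVar_castSucc, mul_smul_comm]

/-- The extra degeneracy of the bar resolution. -/
def polyBarShift (q : ℕ) : PolyBar A n q →ₐ[A] PolyBar A n (q + 1) :=
  aeval fun p => X (p.1.succ, p.2)

theorem polyBarFace_zero_shift (q : ℕ) (z : PolyBar A n q) :
    polyBarFace A n q 0 (polyBarShift A n q z) = z := by
  have : (polyBarFace A n q 0).comp (polyBarShift A n q) = AlgHom.id A _ := by
    refine algHom_ext fun p => ?_
    have h : (0 : Fin (q + 2)).predAbove p.1.succ.castSucc = p.1.castSucc := by
      rw [← Fin.succ_castSucc, Fin.predAbove_zero_succ]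
    simp [polyBarShift, polyBarFace_X]
  exact DFunLike.congr_fun this z

theorem polyBarFace_succ_shift (q : ℕ) (i : Fin (q + 2)) (z : PolyBar A n (q + 1)) :
    polyBarFace A n (q + 1) i.succ (polyBarShift A n (q + 1) z) =
      polyBarShift A n q (polyBarFace A n q i z) := by
  have : (polyBarFace A n (q + 1) i.succ).comp (polyBarShift A n (q + 1)) =
      (polyBarShift A n q).comp (polyBarFace A n q i) := by
    refine algHom_ext fun p => ?_
    have h : i.succ.predAbove p.1.succ.castSucc = (i.predAbove p.1.castSucc).succ := by
      rw [← Fin.succ_castSucc, Fin.succ_predAbove_succ]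
    have h2 : ∀ s : Fin (q + 2), polyBarVar A n (q + 1) s.succ p.2 =
        polyBarShift A n q (polyBarVar A n q s p.2) := by
      intro s
      induction s using Fin.lastCases with
      | last => simp
      | cast s => rw [Fin.succ_castSucc, polyBarVar_castSucc, polyBarVar_castSucc]; simp [polyBarShift]
    rw [AlgHom.comp_apply, AlgHom.comp_apply, polyBarFace_X, ← h2, ← h]
    simp [polyBarShift, polyBarFace_X]
  exact DFunLike.congr_fun this z

/-- Face `0` undoes the shift, and face `i + 1` of the shift is the shift of face `i`, with the
opposite sign. So the shift is a contracting homotopy. -/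
theorem polyBarD_shift (q : ℕ) (z : PolyBar A n (q + 1)) :
    polyBarD A n (q + 1) (polyBarShift A n (q + 1) z) =
      z - polyBarShift A n q (polyBarD A n q z) := by
  rw [polyBarD_apply, Fin.sum_univ_succ, polyBarFace_zero_shift, polyBarD_apply]
  simp only [polyBarFace_succ_shift, map_sum, map_zsmul, Fin.val_succ, pow_succ, Fin.val_zero,
    pow_zero, one_smul, mul_neg, mul_one, neg_smul, Finset.sum_neg_distrib, sub_eq_add_neg]

/-- In degree `0` the remaining face is the augmentation, so the contraction leaves the constant
term. -/
theorem polyBarD_shift_zero (z : PolyBar A n 0) :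
    polyBarD A n 0 (polyBarShift A n 0 z) = z - C (constantCoeff z) := by
  rw [polyBarD_apply, Fin.sum_univ_two, polyBarFace_zero_shift]
  have : (polyBarFace A n 0 1).comp (polyBarShift A n 0) =
      (Algebra.ofId A _).comp (aeval fun _ => (0 : A)) := by
    refine algHom_ext fun p => ?_
    have h : (1 : Fin 2).predAbove p.1.succ.castSucc = Fin.last 1 := by
      obtain ⟨p, j⟩ := p
      fin_cases p
      rfl
    rw [AlgHom.comp_apply, polyBarShift, aeval_X, polyBarFace_X, h, polyBarVar_last]
    simp
  have h2 := DFunLike.congr_fun this z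
  simp only [AlgHom.comp_apply] at h2
  rw [h2, aeval_zero']
  simp [Algebra.ofId_apply, sub_eq_add_neg]

/-- The endomorphism of `PolyBar A n q` that kills the variables `(0, j)` with `j < i`. -/
def polyBarKill (i q : ℕ) : PolyBar A n q →ₐ[A] PolyBar A n q :=
  aeval fun p => if p.1 = 0 ∧ (p.2 : ℕ) < i then 0 else X p

theorem polyBarKill_X (i q : ℕ) (p : Fin (q + 1) × Fin n) :
    polyBarKill A n i q (X p) = if p.1 = 0 ∧ (p.2 : ℕ) < i then 0 else X p := by
  simp [polyBarKill]

theorem polyBarKill_zero (q : ℕ) (z : PolyBar A n q) : polyBarKill A n 0 q z = z := by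
  have : polyBarKill A n 0 q = AlgHom.id A _ := algHom_ext fun p => by simp [polyBarKill_X]
  rw [this]; rfl

theorem polyBarKill_kill (i q : ℕ) (z : PolyBar A n q) :
    polyBarKill A n i q (polyBarKill A n i q z) = polyBarKill A n i q z := by
  have : (polyBarKill A n i q).comp (polyBarKill A n i q) = polyBarKill A n i q := by
    refine algHom_ext fun p => ?_
    rw [AlgHom.comp_apply, polyBarKill_X]
    split_ifs with h
    · simp
    · rw [polyBarKill_X, if_neg h]
  exact DFunLike.congr_fun this z

theorem polyBarKill_succ_kill (i q : ℕ) (z : PolyBar A n q) :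
    polyBarKill A n (i + 1) q (polyBarKill A n i q z) = polyBarKill A n (i + 1) q z := by
  have : (polyBarKill A n (i + 1) q).comp (polyBarKill A n i q) = polyBarKill A n (i + 1) q := by
    refine algHom_ext fun p => ?_
    rw [AlgHom.comp_apply, polyBarKill_X]
    split_ifs with h
    · rw [polyBarKill_X, if_pos ⟨h.1, by omega⟩, map_zero]
    · rfl
  exact DFunLike.congr_fun this z

/-- The ideal of the killed variables is stable under the faces. The kill map itself is not a chain
map, since merging the factors `0` and `1` creates new variables of the factor `0`; applying it
again afterwards amounts to computing in the quotient complex. -/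
theorem polyBarKill_face (i q : ℕ) (k : Fin (q + 2)) (z : PolyBar A n (q + 1)) :
    polyBarKill A n i q (polyBarFace A n q k (polyBarKill A n i (q + 1) z)) =
      polyBarKill A n i q (polyBarFace A n q k z) := by
  have : ((polyBarKill A n i q).comp (polyBarFace A n q k)).comp (polyBarKill A n i (q + 1)) =
      (polyBarKill A n i q).comp (polyBarFace A n q k) := by
    refine algHom_ext fun p => ?_
    rw [AlgHom.comp_apply, polyBarKill_X]
    split_ifs with h
    · obtain ⟨s, j⟩ := p
      obtain ⟨rfl, h⟩ := h
      have h0 : k.predAbove (0 : Fin (q + 2)).castSucc = (0 : Fin (q + 1)).castSucc := by simp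
      rw [map_zero, AlgHom.comp_apply, polyBarFace_X, h0, polyBarVar_castSucc, polyBarKill_X,
        if_pos ⟨rfl, h⟩]
    · rfl
  exact DFunLike.congr_fun this z

theorem polyBarKill_d (i q : ℕ) (z : PolyBar A n (q + 1)) :
    polyBarKill A n i q (polyBarD A n q (polyBarKill A n i (q + 1) z)) =
      polyBarKill A n i q (polyBarD A n q z) := by
  simp only [polyBarD_apply, map_sum, map_zsmul, polyBarKill_face]

/-- Passing from `i` to `i + 1` divides by one more variable, so what dies in this step is a
multiple of it. This is the exactness of `C_i → C_i → C_{i+1}`, the first map being multiplication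
by that variable. -/
theorem exists_polyBarKill_eq_X_mul (q : ℕ) (i : Fin n) (z : PolyBar A n q)
    (hz : polyBarKill A n (i + 1) q z = 0) :
    ∃ y, polyBarKill A n i q z = X (0, i) * y ∧ polyBarKill A n i q y = y := by
  let I : Ideal (PolyBar A n q) := Ideal.span {X (0, i)}
  have : (Ideal.Quotient.mkₐ A I).comp (polyBarKill A n i q) =
      (Ideal.Quotient.mkₐ A I).comp (polyBarKill A n (i + 1) q) := by
    refine algHom_ext fun p => ?_
    rw [AlgHom.comp_apply, AlgHom.comp_apply, polyBarKill_X, polyBarKill_X]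
    by_cases h : p.1 = 0 ∧ (p.2 : ℕ) < i
    · rw [if_pos h, if_pos ⟨h.1, by omega⟩]
    · rw [if_neg h]
      split_ifs with h'
      · have : p = (0, i) := Prod.ext h'.1 (Fin.ext (by
          have := h'.2
          have := fun h2 => h ⟨h'.1, h2⟩
          dsimp only
          omega))
        rw [map_zero, this]
        exact Ideal.Quotient.eq_zero_iff_mem.mpr (Ideal.mem_span_singleton_self _)
      · rfl
  have h2 := DFunLike.congr_fun this z
  rw [AlgHom.comp_apply, AlgHom.comp_apply, hz, map_zero] at h2
  obtain ⟨y, hy⟩ := Ideal.mem_span_singleton.mp (Ideal.Quotient.eq_zero_iff_mem.mp h2)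
  refine ⟨polyBarKill A n i q y, ?_, polyBarKill_kill _ _ _ _ _⟩
  rw [← polyBarKill_kill, hy, map_mul, polyBarKill_X, if_neg (by simp)]

/-- The antisymmetrization of the monomial `∏_r X (r + 1, J r)`. -/
def polyBarAlt {n q : ℕ} (J : Fin q → Fin n) : PolyBar A n q :=
  Matrix.det (Matrix.of fun r s => X (r.succ, J s))

theorem polyBarKill_alt (i q : ℕ) (J : Fin q → Fin n) :
    polyBarKill A n i q (polyBarAlt A J) = polyBarAlt A J := by
  rw [polyBarAlt, AlgHom.map_det]
  congr 1
  ext r s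
  simp [polyBarKill_X]

theorem polyBarFace_alt (q : ℕ) (k : Fin (q + 2)) (J : Fin (q + 1) → Fin n) :
    polyBarFace A n q k (polyBarAlt A J) = Matrix.det (Matrix.of fun r s : Fin (q + 1) =>
      polyBarVar A n q (k.predAbove r.succ.castSucc) (J s)) := by
  rw [polyBarAlt, AlgHom.map_det]
  congr 1
  ext r s : 2
  simp [polyBarFace_X]

/-- Only face `0` contributes: an inner face makes two rows equal, and the last face produces a zero
row. -/
theorem polyBarD_alt (q : ℕ) (J : Fin (q + 1) → Fin n) :
    polyBarD A n q (polyBarAlt A J) = Matrix.det (Matrix.of fun r s => X (r, J s)) := by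
  rw [polyBarD_apply, Fin.sum_univ_succ, Finset.sum_eq_zero, add_zero]
  · rw [polyBarFace_alt]
    simp only [← Fin.succ_castSucc, Fin.predAbove_zero_succ, polyBarVar_castSucc]
    simp
  · intro k _
    rw [polyBarFace_alt]
    refine smul_eq_zero_of_right _ ?_
    induction k using Fin.lastCases with
    | last =>
      refine Matrix.det_eq_zero_of_row_eq_zero (Fin.last q) fun s => ?_
      have : (Fin.last q).succ.predAbove (Fin.last q).succ.castSucc = Fin.last (q + 1) := by
        rw [Fin.predAbove_castSucc_self, Fin.succ_last]
      rw [Matrix.of_apply, this, polyBarVar_last]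
    | cast k =>
      refine Matrix.det_zero_of_row_eq (i := k.castSucc) (j := k.succ) (Fin.castSucc_lt_succ).ne ?_
      funext s
      have e1 : k.castSucc.succ.predAbove k.castSucc.succ.castSucc = k.castSucc.succ :=
        Fin.predAbove_castSucc_self _
      have e2 : k.castSucc.succ.predAbove k.succ.succ.castSucc = k.castSucc.succ := by
        have : k.succ.succ.castSucc = k.castSucc.succ.succ := rfl
        rw [this, Fin.predAbove_succ_self]
      simp only [Matrix.of_apply, e1, e2]

/-- Expand the determinant along the row of the factor `0`: modulo the variables below `i`, only the
entry `X (0, i)` of that row survives. This computes the connecting homomorphism of multiplication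
by `X (0, i)`. -/
theorem polyBarKill_d_alt_cons (q : ℕ) (i : Fin n) (J : Fin q → Fin n) (hJ : ∀ s, J s < i) :
    polyBarKill A n i q (polyBarD A n q (polyBarAlt A (Fin.cons i J : Fin (q + 1) → Fin n))) =
      X (0, i) * polyBarAlt A J := by
  rw [polyBarD_alt, AlgHom.map_det, Matrix.det_succ_row_zero, Fin.sum_univ_succ,
    Finset.sum_eq_zero, add_zero]
  · rw [polyBarAlt]
    simp only [AlgHom.mapMatrix_apply, Matrix.map_apply, Matrix.of_apply, Fin.cons_zero,
      polyBarKill_X, lt_irrefl, and_false, if_false, Fin.val_zero, pow_zero, one_mul,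
      Fin.succAbove_zero]
    congr 2
    ext r s
    simp [polyBarKill_X]
  · intro s _
    have : (J s : ℕ) < i := hJ s
    simp [polyBarKill_X, this]

/-- The span of the antisymmetrized monomials in the variables `(s, j)` with `j < i`. -/
def polyBarAltSpan (i q : ℕ) : Submodule A (PolyBar A n q) :=
  Submodule.span A (Set.range fun J : {J : Fin q → Fin n // ∀ s, (J s : ℕ) < i} => polyBarAlt A J.1)

theorem polyBarKill_altSpan {i k q : ℕ} {c : PolyBar A n q} (hc : c ∈ polyBarAltSpan A n k q) :
    polyBarKill A n i q c = c := by
  induction hc using Submodule.span_induction with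
  | mem x hx => obtain ⟨J, rfl⟩ := hx; exact polyBarKill_alt _ _ _ _ _
  | zero => simp
  | add x y _ _ hx hy => rw [map_add, hx, hy]
  | smul a x _ hx => rw [map_smul, hx]

theorem polyBarAltSpan_mono {i k : ℕ} (h : i ≤ k) (q : ℕ) :
    polyBarAltSpan A n i q ≤ polyBarAltSpan A n k q := by
  refine Submodule.span_mono ?_
  rintro _ ⟨J, rfl⟩
  exact ⟨⟨J.1, fun s => (J.2 s).trans_le h⟩, rfl⟩

/-- Every combination of determinants with indices below `i` is hit by the connecting homomorphism,
by prepending the index `i` to each of them. -/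
theorem exists_altSpan_succ (q : ℕ) (i : Fin n) {c : PolyBar A n q}
    (hc : c ∈ polyBarAltSpan A n i q) :
    ∃ c' ∈ polyBarAltSpan A n (i + 1) (q + 1),
      polyBarKill A n i q (polyBarD A n q c') = X (0, i) * c := by
  induction hc using Submodule.span_induction with
  | mem x hx =>
    obtain ⟨J, rfl⟩ := hx
    refine ⟨polyBarAlt A (Fin.cons i J.1 : Fin (q + 1) → Fin n), Submodule.subset_span ⟨⟨_, ?_⟩, rfl⟩,
      polyBarKill_d_alt_cons A n q i J.1 J.2⟩
    intro s
    induction s using Fin.cases with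
    | zero => exact Nat.lt_succ_self _
    | succ s => exact (J.2 s).trans (Nat.lt_succ_self _)
  | zero => exact ⟨0, zero_mem _, by simp⟩
  | add x y _ _ hx hy =>
    obtain ⟨x', hx', hx⟩ := hx
    obtain ⟨y', hy', hy⟩ := hy
    exact ⟨x' + y', add_mem hx' hy', by rw [map_add, map_add, hx, hy, mul_add]⟩
  | smul a x _ hx =>
    obtain ⟨x', hx', hx⟩ := hx
    exact ⟨a • x', Submodule.smul_mem _ _ hx', by rw [map_smul, map_smul, hx, mul_smul_comm]⟩

theorem exists_polyBar_decomp_zero (i : ℕ) (z : PolyBar A n 0) :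
    ∃ c ∈ polyBarAltSpan A n i 0, ∃ w, polyBarKill A n i 0 (z - c - polyBarD A n 0 w) = 0 := by
  refine ⟨C (constantCoeff z), ?_, polyBarShift A n 0 z, by rw [polyBarD_shift_zero]; simp⟩
  have : C (constantCoeff z) = constantCoeff z • polyBarAlt (n := n) A (Fin.elim0 : Fin 0 → Fin n) := by
    simp [polyBarAlt, smul_eq_C_mul]
  rw [this]
  exact Submodule.smul_mem _ _ (Submodule.subset_span ⟨⟨_, fun s => s.elim0⟩, rfl⟩)

/-- Cycles of the bar resolution modulo the variables `(0, j)` with `j < i` are antisymmetrized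
monomials up to boundaries. -/
theorem exists_polyBar_decomp (i : ℕ) (hi : i ≤ n) (q : ℕ) (z : PolyBar A n (q + 1))
    (hz : polyBarKill A n i q (polyBarD A n q z) = 0) :
    ∃ c ∈ polyBarAltSpan A n i (q + 1), ∃ w,
      polyBarKill A n i (q + 1) (z - c - polyBarD A n (q + 1) w) = 0 := by
  induction i generalizing q z with
  | zero =>
    -- No variable is killed yet, so this is the exactness of the bar resolution itself, and no
    -- determinant is needed.
    rw [polyBarKill_zero] at hz
    exact ⟨0, zero_mem _, polyBarShift A n (q + 1) z, by rw [polyBarD_shift, hz]; simp⟩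
  | succ i ih =>
    let i' : Fin n := ⟨i, hi⟩
    -- Diagram chase: the boundary of `z` vanishes after `X (0, i')` is killed as well, so before
    -- that it is `X (0, i')` times some `y`, which represents the image of `z` under the connecting
    -- homomorphism.
    obtain ⟨y, hy, hy'⟩ := exists_polyBarKill_eq_X_mul A n q i' _ hz
    have hreg : ∀ {q : ℕ} (x : PolyBar A n q), X (0, i') * x = 0 → x = 0 := fun x hx =>
      isRegular_X.left (hx.trans (mul_zero _).symm)
    obtain ⟨c, hc, w, hw⟩ : ∃ c ∈ polyBarAltSpan A n i q, ∃ w,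
        polyBarKill A n i q (y - c - polyBarD A n q w) = 0 := by
      -- In positive degree `y` is again a cycle, because `X (0, i')` is a nonzerodivisor; in degree
      -- `0` there is no cycle condition.
      rcases q with - | q
      · exact exists_polyBar_decomp_zero A n i y
      · refine ih (by omega) q y (hreg _ ?_)
        have h := polyBarKill_d A n i q (polyBarD A n (q + 1) z)
        rw [polyBarD_polyBarD, map_zero, hy, polyBarD_X_zero_mul, map_mul, polyBarKill_X,
          if_neg (by simp [i'])] at h
        exact h
    obtain ⟨c', hc', hcc'⟩ := exists_altSpan_succ A n q i' hc
    -- Subtracting `c'` and `X (0, i') * w` removes both parts of `y` and leaves a cycle already at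
    -- stage `i`. The second correction disappears at stage `i + 1`.
    obtain ⟨c'', hc'', w', hw'⟩ := ih (by omega) q (z - X (0, i') * w - c') (by
      rw [map_sub, map_sub, map_sub, map_sub, hcc', hy, polyBarD_X_zero_mul, map_mul, polyBarKill_X,
        if_neg (by simp [i']), ← mul_sub, ← mul_sub]
      rw [map_sub, map_sub, hy', polyBarKill_altSpan A n hc] at hw
      rw [sub_right_comm, hw, mul_zero])
    refine ⟨c' + c'', add_mem hc' (polyBarAltSpan_mono A n (Nat.le_succ i) _ hc''), w', ?_⟩
    have h := congrArg (polyBarKill A n (i + 1) (q + 1)) hw'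
    rw [polyBarKill_succ_kill, map_zero] at h
    have h0 : polyBarKill A n (i + 1) (q + 1) (X (0, i') * w) = 0 := by
      rw [map_mul, polyBarKill_X, if_pos (by simp [i']), zero_mul]
    rw [← h]
    simp only [map_sub, map_add, h0]
    abel

end PolynomialBar

/-! ### The Hochschild complex in polynomial coordinates, and its cycles. -/

section PolynomialChains
open MvPolynomial

variable (A : Type u) [CommRing A] (n : ℕ)

/-- The Hochschild chains of degree `q` of a polynomial ring in `n` variables with coefficients in
`A`; the variable `(r, j)` is the copy of `t_j` in the factor `r + 1`, minus that in the factor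
`0`. -/
abbrev PolyChain (q : ℕ) : Type u := MvPolynomial (Fin q × Fin n) A

/-- The variables of `PolyChain A n q`, extended by zero to the first and the last factor. -/
def polyChainVar (q : ℕ) (s : Fin (q + 2)) (j : Fin n) : PolyChain A n q :=
  Fin.cases (motive := fun _ => PolyChain A n q) 0
    (fun s => Fin.lastCases (motive := fun _ => PolyChain A n q) 0 (fun r => X (r, j)) s) s

variable {n} in
@[simp] theorem polyChainVar_zero (q : ℕ) (j : Fin n) : polyChainVar A n q 0 j = 0 := rfl

variable {n} in
@[simp] theorem polyChainVar_last (q : ℕ) (j : Fin n) :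
    polyChainVar A n q (Fin.last (q + 1)) j = 0 := by
  rw [← Fin.succ_last, polyChainVar, Fin.cases_succ, Fin.lastCases_last]

variable {n} in
@[simp] theorem polyChainVar_castSucc_succ (q : ℕ) (r : Fin q) (j : Fin n) :
    polyChainVar A n q r.castSucc.succ j = X (r, j) := by
  simp [polyChainVar]

/-- The faces of the Hochschild complex. -/
def polyChainFace (q : ℕ) (i : Fin (q + 2)) : PolyChain A n (q + 1) →ₐ[A] PolyChain A n q :=
  aeval fun p => polyChainVar A n q (i.predAbove p.1.castSucc.succ) p.2

theorem polyChainFace_X (q : ℕ) (i : Fin (q + 2)) (p : Fin (q + 1) × Fin n) :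
    polyChainFace A n q i (X p) = polyChainVar A n q (i.predAbove p.1.castSucc.succ) p.2 := by
  simp [polyChainFace]

theorem polyChainFace_var (q : ℕ) (i : Fin (q + 2)) (s : Fin (q + 3)) (j : Fin n) :
    polyChainFace A n q i (polyChainVar A n (q + 1) s j) =
      polyChainVar A n q (i.predAbove s) j := by
  induction s using Fin.cases with
  | zero => simp
  | succ s =>
    induction s using Fin.lastCases with
    | last => rw [Fin.succ_last, polyChainVar_last, Fin.predAbove_right_last, polyChainVar_last,
        map_zero]
    | cast s => rw [polyChainVar_castSucc_succ, polyChainFace_X]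

/-- The differential of the Hochschild complex. -/
def polyChainD (q : ℕ) : PolyChain A n (q + 1) →ₗ[A] PolyChain A n q :=
  ∑ i : Fin (q + 2), (-1 : ℤ) ^ (i : ℕ) • (polyChainFace A n q i).toLinearMap

theorem polyChainD_apply (q : ℕ) (z : PolyChain A n (q + 1)) :
    polyChainD A n q z = ∑ i : Fin (q + 2), (-1 : ℤ) ^ (i : ℕ) • polyChainFace A n q i z := by
  simp [polyChainD]

/-- The projection from the bar resolution that kills the variables of the factor `0`. -/
def polyBarProj (q : ℕ) : PolyBar A n q →ₐ[A] PolyChain A n q :=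
  aeval fun p => polyChainVar A n q p.1.castSucc p.2

theorem polyBarProj_var (q : ℕ) (s : Fin (q + 2)) (j : Fin n) :
    polyBarProj A n q (polyBarVar A n q s j) = polyChainVar A n q s j := by
  induction s using Fin.lastCases with
  | last => simp
  | cast s => simp [polyBarProj]

theorem polyBarProj_d (q : ℕ) (z : PolyBar A n (q + 1)) :
    polyBarProj A n q (polyBarD A n q z) = polyChainD A n q (polyBarProj A n (q + 1) z) := by
  rw [polyBarD_apply, polyChainD_apply, map_sum]
  refine Finset.sum_congr rfl fun i _ => ?_
  rw [map_zsmul]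
  have : (polyBarProj A n q).comp (polyBarFace A n q i) =
      (polyChainFace A n q i).comp (polyBarProj A n (q + 1)) := by
    refine algHom_ext fun p => ?_
    rw [AlgHom.comp_apply, AlgHom.comp_apply, polyBarFace_X, polyBarProj_var, polyBarProj, aeval_X,
      polyChainFace_var]
  exact congrArg _ (DFunLike.congr_fun this z)

/-- The section of `polyBarProj`. -/
def polyBarIncl (q : ℕ) : PolyChain A n q →ₐ[A] PolyBar A n q :=
  aeval fun p => X (p.1.succ, p.2)

theorem polyBarProj_incl (q : ℕ) (z : PolyChain A n q) :
    polyBarProj A n q (polyBarIncl A n q z) = z := by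
  have : (polyBarProj A n q).comp (polyBarIncl A n q) = AlgHom.id A _ := by
    refine algHom_ext fun p => ?_
    rw [AlgHom.comp_apply, polyBarIncl, aeval_X, polyBarProj, aeval_X, ← Fin.succ_castSucc,
      polyChainVar_castSucc_succ]
    rfl
  exact DFunLike.congr_fun this z

/-- Identifies the Hochschild chains with the bar resolution modulo all variables of the factor `0`,
that is, with the last stage `i = n` of the dévissage. -/
theorem polyBarIncl_proj (q : ℕ) (z : PolyBar A n q) :
    polyBarIncl A n q (polyBarProj A n q z) = polyBarKill A n n q z := by
  have : (polyBarIncl A n q).comp (polyBarProj A n q) = polyBarKill A n n q := by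
    refine algHom_ext fun p => ?_
    obtain ⟨s, j⟩ := p
    rw [AlgHom.comp_apply, polyBarProj, aeval_X, polyBarKill_X]
    induction s using Fin.cases with
    | zero => simp
    | succ s =>
      rw [← Fin.succ_castSucc, polyChainVar_castSucc_succ, polyBarIncl, aeval_X, if_neg]
      simp
  exact DFunLike.congr_fun this z

theorem polyChainD_polyChainD (q : ℕ) (z : PolyChain A n (q + 2)) :
    polyChainD A n q (polyChainD A n (q + 1) z) = 0 := by
  rw [← polyBarProj_incl A n (q + 2) z, ← polyBarProj_d, ← polyBarProj_d, polyBarD_polyBarD,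
    map_zero]

/-- The antisymmetrization of the monomial `∏_r X (r, J r)`. -/
def polyChainAlt {n q : ℕ} (J : Fin q → Fin n) : PolyChain A n q :=
  Matrix.det (Matrix.of fun r s => X (r, J s))

theorem polyBarProj_alt (q : ℕ) (J : Fin q → Fin n) :
    polyBarProj A n q (polyBarAlt A J) = polyChainAlt A J := by
  rw [polyBarAlt, AlgHom.map_det, polyChainAlt]
  congr 1
  ext r s : 2
  simp only [AlgHom.mapMatrix_apply, Matrix.map_apply, Matrix.of_apply, polyBarProj, aeval_X,
    ← Fin.succ_castSucc, polyChainVar_castSucc_succ]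

/-- The boundary in the bar resolution is a determinant whose first row consists of variables of the
factor `0`, which the projection kills. -/
theorem polyChainD_alt (q : ℕ) (J : Fin (q + 1) → Fin n) :
    polyChainD A n q (polyChainAlt A J) = 0 := by
  rw [← polyBarProj_alt, ← polyBarProj_d, polyBarD_alt, AlgHom.map_det]
  refine Matrix.det_eq_zero_of_row_eq_zero 0 fun s => ?_
  simp [polyBarProj]

/-- Cycles are antisymmetrized monomials up to boundaries. -/
theorem exists_polyChain_decomp (q : ℕ) (z : PolyChain A n (q + 1))
    (hz : polyChainD A n q z = 0) :
    ∃ c ∈ Submodule.span A (Set.range (polyChainAlt (n := n) (q := q + 1) A)), ∃ w,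
      z = c + polyChainD A n (q + 1) w := by
  -- The inclusion is not a chain map, but it is one modulo the variables of the factor `0`, which
  -- is all that the dévissage requires.
  obtain ⟨c, hc, w, hw⟩ := exists_polyBar_decomp A n n le_rfl q (polyBarIncl A n (q + 1) z) (by
    rw [← polyBarIncl_proj, polyBarProj_d, polyBarProj_incl, hz, map_zero])
  rw [← polyBarIncl_proj] at hw
  have h := congrArg (polyBarProj A n (q + 1)) hw
  rw [polyBarProj_incl, map_zero, map_sub, map_sub, polyBarProj_incl, polyBarProj_d] at h
  refine ⟨polyBarProj A n (q + 1) c, ?_, polyBarProj A n (q + 2) w, ?_⟩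
  · clear hw h
    induction hc using Submodule.span_induction with
    | mem x hx =>
      obtain ⟨J, rfl⟩ := hx
      exact Submodule.subset_span ⟨J.1, (polyBarProj_alt A n _ _).symm⟩
    | zero => rw [map_zero]; exact zero_mem _
    | add x y _ _ hx hy => rw [map_add]; exact add_mem hx hy
    | smul a x _ hx => rw [map_smul]; exact Submodule.smul_mem _ _ hx
  · rw [← sub_eq_zero, ← h]; abel

theorem mem_span_polyChainAlt_zero (z : PolyChain A n 0) :
    z ∈ Submodule.span A (Set.range (polyChainAlt (n := n) (q := 0) A)) := by
  have : z = coeff 0 z • polyChainAlt (n := n) A (Fin.elim0 : Fin 0 → Fin n) := by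
    conv_lhs => rw [eq_C_of_isEmpty z]
    simp [polyChainAlt, smul_eq_C_mul]
  rw [this]
  exact Submodule.smul_mem _ _ (Submodule.subset_span ⟨_, rfl⟩)

/-- A face sends each variable to a variable or to zero. The resulting grading of the complex is
what later gives control of continuity. -/
theorem polyChainFace_isHomogeneous (q : ℕ) (i : Fin (q + 2)) {d : ℕ} {z : PolyChain A n (q + 1)}
    (hz : z.IsHomogeneous d) : (polyChainFace A n q i z).IsHomogeneous d := by
  have h := hz.aeval (S := A) (n := 1)
    (fun p => polyChainVar A n q (i.predAbove p.1.castSucc.succ) p.2) (fun p => by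
      generalize i.predAbove p.1.castSucc.succ = s
      induction s using Fin.cases with
      | zero => exact isHomogeneous_zero _ _ _
      | succ s =>
        induction s using Fin.lastCases with
        | last => rw [Fin.succ_last, polyChainVar_last]; exact isHomogeneous_zero _ _ _
        | cast s => rw [polyChainVar_castSucc_succ]; exact isHomogeneous_X _ _)
  rwa [one_mul] at h

theorem polyChainD_isHomogeneous (q : ℕ) {d : ℕ} {z : PolyChain A n (q + 1)}
    (hz : z.IsHomogeneous d) : (polyChainD A n q z).IsHomogeneous d := by
  rw [polyChainD_apply]
  refine IsHomogeneous.sum _ _ _ fun i _ => ?_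
  exact (homogeneousSubmodule _ A d).smul_of_tower_mem _ (polyChainFace_isHomogeneous A n q i hz)

theorem homogeneousComponent_polyChainD (q d : ℕ) (z : PolyChain A n (q + 1)) :
    homogeneousComponent d (polyChainD A n q z) = polyChainD A n q (homogeneousComponent d z) := by
  conv_lhs => rw [← sum_homogeneousComponent z, map_sum, map_sum]
  have : ∀ e, homogeneousComponent d (polyChainD A n q (homogeneousComponent e z)) =
      if e = d then polyChainD A n q (homogeneousComponent d z) else 0 := by
    intro e
    rw [homogeneousComponent_of_mem
      (polyChainD_isHomogeneous A n q (homogeneousComponent_isHomogeneous e z))]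
    split_ifs with h1 h2 h2
    · rw [h1]
    · exact absurd h1.symm h2
    · exact absurd h2.symm h1
    · rfl
  simp only [this, Finset.sum_ite_eq', Finset.mem_range]
  split_ifs with h
  · rfl
  · rw [homogeneousComponent_eq_zero _ _ (by omega), map_zero]

end PolynomialChains

/-! ### An `A`-linear homotopy on polynomial chains with control of degrees. -/

section Homotopy
open MvPolynomial

variable {A : Type u} [CommRing A] {n : ℕ}

theorem isHomogeneous_of_monomial {σ τ : Type*} (f : MvPolynomial σ A →ₗ[A] MvPolynomial τ A) (q : ℕ)
    (hf : ∀ α : σ →₀ ℕ, q < α.degree → (f (monomial α 1)).IsHomogeneous α.degree)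
    {d : ℕ} (hd : q < d) {z : MvPolynomial σ A} (hz : z.IsHomogeneous d) :
    (f z).IsHomogeneous d := by
  rw [z.as_sum, map_sum]
  refine IsHomogeneous.sum _ _ _ fun α hα => ?_
  have h1 : α.degree = d := hz.degree_eq_sum_deg_support hα |>.symm
  have h2 : monomial α (coeff α z) = coeff α z • monomial α 1 := by
    rw [smul_monomial, smul_eq_mul, mul_one]
  rw [h2, map_smul]
  exact (homogeneousSubmodule τ A d).smul_mem _ (h1 ▸ hf α (h1 ▸ hd))

/-- A polynomial lies in the `m`-th power of the ideal of the variables exactly when all its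
monomials have degree at least `m`. If `m > q`, all of these degrees are in the range where `f`
preserves the degree. -/
theorem map_mem_pow_idealOfVars {σ τ : Type*} (f : MvPolynomial σ A →ₗ[A] MvPolynomial τ A) (q : ℕ)
    (hf : ∀ d, q < d → ∀ z : MvPolynomial σ A, z.IsHomogeneous d → (f z).IsHomogeneous d)
    {m : ℕ} (hm : q < m) {z : MvPolynomial σ A} (hz : z ∈ idealOfVars σ A ^ m) :
    f z ∈ idealOfVars τ A ^ m := by
  rw [z.as_sum, map_sum]
  refine sum_mem fun α hα => ?_
  have h1 : m ≤ α.degree := (mem_pow_idealOfVars_iff m z).mp hz α hα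
  have h3 := hf α.degree (hm.trans_le h1) (monomial α (coeff α z)) (isHomogeneous_monomial _ rfl)
  refine (mem_pow_idealOfVars_iff' m _).mpr fun x hx => ?_
  by_contra h
  have := h3 h
  rw [show Finsupp.weight 1 x = x.degree from
    (DFunLike.congr_fun Finsupp.degree_eq_weight_one x).symm] at this
  omega

variable {L : ℕ → Type u} [∀ q, AddCommGroup (L q)] [∀ q, Module A (L q)]
  (p : ∀ q, PolyChain A n q →ₗ[A] L q) (s : ∀ q, L q →ₗ[A] PolyChain A n q)

/-- A map to cycles in the kernel of `p` lifts along the differential. -/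
theorem exists_polyChain_lift (hps : ∀ q x, p q (s q x) = x)
    (hpd : ∀ q z, p q (polyChainD A n q z) = 0)
    (hsd : ∀ q x, polyChainD A n q (s (q + 1) x) = 0)
    (halt : ∀ q (J : Fin q → Fin n), polyChainAlt A J ∈ LinearMap.range (s q))
    (hs : ∀ q x, (s q x).IsHomogeneous q)
    (hp : ∀ q d (z : PolyChain A n q), q < d → z.IsHomogeneous d → p q z = 0)
    (q : ℕ) (g : PolyChain A n (q + 1) →ₗ[A] PolyChain A n (q + 1))
    (hg : ∀ z, polyChainD A n q (g z) = 0) (hpg : ∀ z, p (q + 1) (g z) = 0)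
    (hgh : ∀ d, q + 1 < d → ∀ z, z.IsHomogeneous d → (g z).IsHomogeneous d) :
    ∃ h : PolyChain A n (q + 1) →ₗ[A] PolyChain A n (q + 2),
      (∀ z, polyChainD A n (q + 1) (h z) = g z) ∧ (∀ z, p (q + 2) (h z) = 0) ∧
      (∀ d, q + 1 < d → ∀ z, z.IsHomogeneous d → (h z).IsHomogeneous d) := by
  have hspan : ∀ (q : ℕ) (c : PolyChain A n q),
      c ∈ Submodule.span A (Set.range (polyChainAlt (n := n) (q := q) A)) →
      c ∈ LinearMap.range (s q) := by
    intro q c hc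
    refine (Submodule.span_le.mpr ?_) hc
    rintro _ ⟨J, rfl⟩
    exact halt q J
  have hlift : ∀ α : Fin (q + 1) × Fin n →₀ ℕ, ∃ w, polyChainD A n (q + 1) w = g (monomial α 1) ∧
      p (q + 2) w = 0 ∧ (q + 1 < α.degree → w.IsHomogeneous α.degree) := by
    intro α
    -- The module of chains is free on the monomials, so it suffices to choose a lift for each of
    -- them.
    obtain ⟨c, hc, w, hw⟩ := exists_polyChain_decomp A n q _ (hg (monomial α 1))
    obtain ⟨x, rfl⟩ := hspan _ _ hc
    -- Applying `p` kills the boundary and recovers `x`. As `p` vanishes on the cycle, `x = 0` and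
    -- the cycle is a boundary.
    have hx := hpg (monomial α 1)
    rw [hw, map_add, hps, hpd, add_zero] at hx
    rw [hx, map_zero, zero_add] at hw
    obtain ⟨w', hw', hw''⟩ : ∃ w, polyChainD A n (q + 1) w = g (monomial α 1) ∧
        (q + 1 < α.degree → w.IsHomogeneous α.degree) := by
      -- The differential is graded, so the component of `w` in the degree of `α` is again a lift
      -- when `g` preserves that degree.
      by_cases h : q + 1 < α.degree
      · refine ⟨homogeneousComponent α.degree w, ?_, fun _ => homogeneousComponent_isHomogeneous _ _⟩
        rw [← homogeneousComponent_polyChainD, ← hw]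
        exact homogeneousComponent_eq_self (hgh _ h _ (isHomogeneous_monomial _ rfl))
      · exact ⟨w, hw.symm, fun h' => absurd h' h⟩
    -- The subtracted term is a cycle and makes `p` vanish. It has degree `q + 2`, which is harmless
    -- if `α` has this degree; in higher degrees the term is zero.
    refine ⟨w' - s (q + 2) (p (q + 2) w'), by rw [map_sub, hw', hsd, sub_zero],
      by rw [map_sub, hps, sub_self], fun h => ?_⟩
    rcases (show q + 2 ≤ α.degree from h).eq_or_lt with h2 | h2
    · exact (hw'' h).sub (h2 ▸ hs _ _)
    · rw [hp _ _ _ h2 (hw'' h), map_zero, sub_zero]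
      exact hw'' h
  choose w hw hpw hwh using hlift
  have hb : ∀ α, (basisMonomials (Fin (q + 1) × Fin n) A).constr A w (monomial α 1) = w α :=
    fun α => (basisMonomials _ A).constr_basis A w α
  refine ⟨(basisMonomials (Fin (q + 1) × Fin n) A).constr A w, fun z => ?_, fun z => ?_,
    fun d hd z hz => isHomogeneous_of_monomial _ (q + 1) (fun α hα => ?_) hd hz⟩
  · refine DFunLike.congr_fun (f := (polyChainD A n (q + 1)).comp
      ((basisMonomials (Fin (q + 1) × Fin n) A).constr A w)) (g := g) ?_ z
    refine (basisMonomials _ A).ext fun α => ?_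
    rw [coe_basisMonomials, LinearMap.comp_apply, hb, hw]
  · refine DFunLike.congr_fun (f := (p (q + 2)).comp
      ((basisMonomials (Fin (q + 1) × Fin n) A).constr A w)) (g := 0) ?_ z
    refine (basisMonomials _ A).ext fun α => ?_
    rw [coe_basisMonomials, LinearMap.comp_apply, hb, hpw]; rfl
  · rw [hb]; exact hwh α hα

/-- The map `p` from the Hochschild chains to its homology is a homotopy equivalence. -/
theorem exists_polyChain_homotopy (hps : ∀ q x, p q (s q x) = x)
    (hpd : ∀ q z, p q (polyChainD A n q z) = 0)
    (hsd : ∀ q x, polyChainD A n q (s (q + 1) x) = 0)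
    (halt : ∀ q (J : Fin q → Fin n), polyChainAlt A J ∈ LinearMap.range (s q))
    (hs : ∀ q x, (s q x).IsHomogeneous q)
    (hp : ∀ q d (z : PolyChain A n q), q < d → z.IsHomogeneous d → p q z = 0) :
    ∃ h : ∀ q, PolyChain A n q →ₗ[A] PolyChain A n (q + 1),
      (∀ z, z - s 0 (p 0 z) = polyChainD A n 0 (h 0 z)) ∧
      (∀ q z, z - s (q + 1) (p (q + 1) z) =
        polyChainD A n (q + 1) (h (q + 1) z) + h q (polyChainD A n q z)) ∧
      (∀ q m, q < m → ∀ z ∈ idealOfVars (Fin q × Fin n) A ^ m,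
        h q z ∈ idealOfVars (Fin (q + 1) × Fin n) A ^ m) := by
  -- The invariant of the recursion. The first condition makes the next defect a cycle, the second
  -- puts it in the kernel of `p`, and both are needed to lift it. The third carries the degree
  -- control along.
  let Q : ∀ q, (PolyChain A n q →ₗ[A] PolyChain A n (q + 1)) → Prop := fun q h =>
    (∀ z, polyChainD A n q (h (polyChainD A n q z)) = polyChainD A n q z) ∧
    (∀ z, p (q + 1) (h z) = 0) ∧
    (∀ d, q < d → ∀ z, z.IsHomogeneous d → (h z).IsHomogeneous d)
  have h0 : ∀ z, s 0 (p 0 z) = z := by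
    intro z
    have hz : z ∈ LinearMap.range (s 0) := by
      refine (Submodule.span_le.mpr ?_) (mem_span_polyChainAlt_zero A n z)
      rintro _ ⟨J, rfl⟩
      exact halt 0 J
    obtain ⟨x, rfl⟩ := hz
    rw [hps]
  have base : Q 0 0 := by
    refine ⟨fun z => ?_, fun z => map_zero _, fun d _ z _ => isHomogeneous_zero _ _ _⟩
    -- There are no variables in degree `0`, so `s 0 ∘ p 0` is the identity there. Since `p` kills
    -- boundaries, the differential from degree `1` vanishes, and the homotopy can start with zero.
    rw [LinearMap.zero_apply, map_zero, ← h0 (polyChainD A n 0 z), hpd, map_zero]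
  have step : ∀ q (h : {h // Q q h}), ∃ h' : {h' // Q (q + 1) h'}, ∀ z,
      z - s (q + 1) (p (q + 1) z) =
        polyChainD A n (q + 1) (h'.1 z) + h.1 (polyChainD A n q z) := by
    rintro q ⟨h, h1, h2, h3⟩
    -- The defect `1 - s p - h ∂` takes values in cycles killed by `p`. Above degree `q + 1` the
    -- term `s p` is absent, so the degree is preserved.
    obtain ⟨h', e1, e2, e3⟩ := exists_polyChain_lift p s hps hpd hsd halt hs hp q
      (LinearMap.id - (s (q + 1)).comp (p (q + 1)) - h.comp (polyChainD A n q))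
      (fun z => by simp [hsd, h1]) (fun z => by simp [hps, h2])
      (fun d hd z hz => by
        have : p (q + 1) z = 0 := hp _ _ _ hd hz
        simp only [LinearMap.sub_apply, LinearMap.id_apply, LinearMap.comp_apply, this, map_zero,
          sub_zero]
        exact hz.sub (h3 d (by omega) _ (polyChainD_isHomogeneous A n q hz)))
    refine ⟨⟨h', fun z => ?_, e2, e3⟩, fun z => ?_⟩
    · rw [e1]
      simp [hpd, polyChainD_polyChainD]
    · rw [e1]
      simp
  choose F hF using step
  let H : ∀ q, {h // Q q h} := fun q => Nat.rec ⟨0, base⟩ F q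
  refine ⟨fun q => (H q).1, fun z => ?_, fun q z => hF q (H q) z, fun q m hm z hz =>
    map_mem_pow_idealOfVars _ q (H q).2.2.2 hm hz⟩
  rw [h0, sub_self]
  exact (map_zero _).symm

end Homotopy

/-! ### Infinitesimal lifting along formally étale ring homomorphisms. -/

section Lifting
variable {R A B : Type u} [CommRing R] [CommRing A] [CommRing B]

theorem exists_lift_of_formallyEtale (φ : R →+* A) (hφ : φ.FormallyEtale) (I : Ideal B)
    (hI : IsNilpotent I) (g : R →+* B) (a : A →+* B ⧸ I)
    (h : a.comp φ = (Ideal.Quotient.mk I).comp g) :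
    ∃ l : A →+* B, l.comp φ = g ∧ (Ideal.Quotient.mk I).comp l = a := by
  algebraize [φ, g]
  let a' : A →ₐ[R] B ⧸ I := { a with commutes' := fun r => DFunLike.congr_fun h r }
  obtain ⟨l, hl⟩ := Algebra.FormallySmooth.exists_lift I hI a'
  exact ⟨l, l.comp_algebraMap, congrArg AlgHom.toRingHom hl⟩

theorem lift_unique_of_formallyEtale (φ : R →+* A) (hφ : φ.FormallyEtale) (I : Ideal B)
    (hI : IsNilpotent I) (l l' : A →+* B) (h : l.comp φ = l'.comp φ) (h' : ∀ x, l x - l' x ∈ I) :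
    l = l' := by
  algebraize [φ, l.comp φ]
  let l₁ : A →ₐ[R] B := { l with commutes' := fun r => rfl }
  let l₂ : A →ₐ[R] B := { l' with commutes' := fun r => (DFunLike.congr_fun h r).symm }
  have := Algebra.FormallyUnramified.lift_unique I hI l₁ l₂
    (AlgHom.ext fun x => Ideal.Quotient.eq.mpr (h' x))
  exact congrArg AlgHom.toRingHom this

end Lifting

/-! ### Taylor expansion: `Ĉ_q(A)` and `A[x]` agree modulo powers of their ideals. -/

section Taylor
open MvPolynomial
variable {K A : Type u} [CommRing K] [CommRing A] [Algebra K A]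

theorem bar_ringHom_ext {B : Type u} [CommRing B] {q : ℕ} {f g : Bar K A q →+* B}
    (h : ∀ s a, f (slot K A q s a) = g (slot K A q s a)) : f = g := by
  refine RingHom.ext fun x => ?_
  induction x using bar_induction K with
  | ht a => rw [tprod_eq_prod, map_prod, map_prod]; exact Finset.prod_congr rfl fun i _ => h _ _
  | hs c x hx =>
    have : c • x = slot K A q 0 (algebraMap K A c) * x := by
      rw [AlgHom.commutes, ← Algebra.smul_def]
    rw [this, map_mul, map_mul, hx, h]
  | ha x y hx hy => rw [map_add, map_add, hx, hy]

variable {n : ℕ}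

/-- The polynomials in `q` families of `n` variables, truncated at degree `m`. -/
abbrev PolyTrunc (A : Type u) [CommRing A] (n q m : ℕ) : Type u :=
  PolyChain A n q ⧸ idealOfVars (Fin q × Fin n) A ^ m

/-- The ideal of `PolyTrunc A n q m` generated by the variables. -/
def truncIdeal (A : Type u) [CommRing A] (n q m : ℕ) : Ideal (PolyTrunc A n q m) :=
  (idealOfVars (Fin q × Fin n) A).map (Ideal.Quotient.mk _)

theorem truncIdeal_pow (q m : ℕ) : truncIdeal A n q m ^ m = ⊥ := by
  rw [truncIdeal, ← Ideal.map_pow, Ideal.map_quotient_self]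

theorem mk_X_mem_truncIdeal (q m : ℕ) (p : Fin q × Fin n) :
    (Ideal.Quotient.mk _ (X p) : PolyTrunc A n q m) ∈ truncIdeal A n q m :=
  Ideal.mem_map_of_mem _ (Ideal.subset_span ⟨p, rfl⟩)

/-- The elements `t₁, …, t_n` are étale coordinates of the algebra `A`. -/
def IsEtaleCoord (K : Type u) [CommRing K] [Algebra K A] (t : Fin n → A) : Prop :=
  RingHom.FormallyEtale ((aeval t : MvPolynomial (Fin n) K →ₐ[K] A) : MvPolynomial (Fin n) K →+* A)

variable {t : Fin n → A} (ht : IsEtaleCoord K t)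

include ht in
-- The substitution `t_j ↦ t_j + x_{rj}` is defined on `K[t]` and reduces to the structure map
-- modulo the variables. These generate a nilpotent ideal of the truncation, so the infinitesimal
-- lifting property extends the substitution to `A`.
theorem exists_taylor (q m : ℕ) (r : Fin q) : ∃ T : A →ₐ[K] PolyTrunc A n q m,
    (∀ j, T (t j) = Ideal.Quotient.mk _ (C (t j) + X (r, j))) ∧
    ∀ a, T a - algebraMap A _ a ∈ truncIdeal A n q m := by
  let g : MvPolynomial (Fin n) K →ₐ[K] PolyTrunc A n q m :=
    aeval fun j => Ideal.Quotient.mk _ (C (t j) + X (r, j))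
  obtain ⟨l, h1, h2⟩ := exists_lift_of_formallyEtale _ ht (truncIdeal A n q m)
    ⟨m, truncIdeal_pow q m⟩ (g : _ →+* _)
    ((Ideal.Quotient.mk (truncIdeal A n q m)).comp (algebraMap A _)) (by
      have : (((Ideal.Quotient.mkₐ K (truncIdeal A n q m)).comp
          (IsScalarTower.toAlgHom K A (PolyTrunc A n q m))).comp (aeval t)) =
          (Ideal.Quotient.mkₐ K (truncIdeal A n q m)).comp g := by
        refine algHom_ext fun j => ?_
        simp only [AlgHom.comp_apply, aeval_X, g, Ideal.Quotient.mkₐ_eq_mk,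
          IsScalarTower.coe_toAlgHom', map_add]
        rw [Ideal.Quotient.eq_zero_iff_mem.mpr (mk_X_mem_truncIdeal q m (r, j)), add_zero]
        rfl
      exact congrArg AlgHom.toRingHom this)
  refine ⟨{ l with commutes' := fun k => ?_ }, fun j => ?_, fun a => ?_⟩
  · have := DFunLike.congr_fun h1 (C k)
    simpa [g] using this
  · have := DFunLike.congr_fun h1 (X j)
    simpa [g] using this
  · exact Ideal.Quotient.eq.mp (DFunLike.congr_fun h2 a)

/-- The Taylor expansion `A → A[u]/(u)^m` in the variables `X (r, j)`. -/
def taylor (q m : ℕ) (r : Fin q) : A →ₐ[K] PolyTrunc A n q m := (exists_taylor ht q m r).choose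

theorem taylor_coord (q m : ℕ) (r : Fin q) (j : Fin n) :
    taylor ht q m r (t j) = Ideal.Quotient.mk _ (C (t j) + X (r, j)) :=
  (exists_taylor ht q m r).choose_spec.1 j

theorem taylor_sub_mem (q m : ℕ) (r : Fin q) (a : A) :
    taylor ht q m r a - algebraMap A _ a ∈ truncIdeal A n q m :=
  (exists_taylor ht q m r).choose_spec.2 a

/-- The Taylor expansion on the `s`-th tensor factor. -/
def slotTaylor (q m : ℕ) (s : Fin (q + 2)) : A →ₐ[K] PolyTrunc A n q m :=
  Fin.cases (motive := fun _ => A →ₐ[K] PolyTrunc A n q m) (IsScalarTower.toAlgHom K A _)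
    (fun s => Fin.lastCases (motive := fun _ => A →ₐ[K] PolyTrunc A n q m)
      (IsScalarTower.toAlgHom K A _) (fun r => taylor ht q m r) s) s

theorem slotTaylor_zero (q m : ℕ) (a : A) : slotTaylor ht q m 0 a = algebraMap A _ a := rfl

theorem slotTaylor_last (q m : ℕ) (a : A) :
    slotTaylor ht q m (Fin.last (q + 1)) a = algebraMap A _ a := by
  rw [← Fin.succ_last, slotTaylor, Fin.cases_succ, Fin.lastCases_last]
  rfl

theorem slotTaylor_cast (q m : ℕ) (r : Fin q) :
    slotTaylor ht q m r.castSucc.succ = taylor ht q m r := by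
  rw [slotTaylor, Fin.cases_succ, Fin.lastCases_castSucc]

theorem slotTaylor_sub_mem (q m : ℕ) (s : Fin (q + 2)) (a : A) :
    slotTaylor ht q m s a - algebraMap A _ a ∈ truncIdeal A n q m := by
  induction s using Fin.cases with
  | zero => rw [slotTaylor_zero, sub_self]; exact zero_mem _
  | succ s =>
    induction s using Fin.lastCases with
    | last => rw [Fin.succ_last, slotTaylor_last, sub_self]; exact zero_mem _
    | cast r => rw [slotTaylor_cast]; exact taylor_sub_mem ht q m r a

/-- The Taylor expansion on `B_q(A)`. -/
def barTaylor (q m : ℕ) : Bar K A q →ₐ[K] PolyTrunc A n q m :=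
  PiTensorProduct.liftAlgHom
    ((MultilinearMap.mkPiAlgebra K (Fin (q + 2)) (PolyTrunc A n q m)).compLinearMap
      (fun s => (slotTaylor ht q m s).toLinearMap))
    (by simp) (fun x y => by simp [Finset.prod_mul_distrib])

theorem barTaylor_slot (q m : ℕ) (s : Fin (q + 2)) (a : A) :
    barTaylor ht q m (slot K A q s a) = slotTaylor ht q m s a := by
  have : barTaylor ht q m (slot K A q s a)
      = ∏ j, slotTaylor ht q m j ((Pi.mulSingle s a : Fin (q+2) → A) j) := by
    exact (PiTensorProduct.lift.tprod (R := K)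
      (φ := (MultilinearMap.mkPiAlgebra K (Fin (q + 2)) (PolyTrunc A n q m)).compLinearMap
      (fun s => (slotTaylor ht q m s).toLinearMap)) (Pi.mulSingle s a)).trans (by simp)
  rw [this, Finset.prod_eq_single s]
  · simp
  · intro j _ hj; simp [Pi.mulSingle_eq_of_ne hj]
  · simp

theorem barIdeal_le_comap_barTaylor (q m : ℕ) :
    barIdeal K A q ≤ (truncIdeal A n q m).comap (barTaylor ht q m : Bar K A q →+* _) := by
  refine (barIdeal_le_span K q).trans (Ideal.span_le.mpr ?_)
  rintro _ ⟨⟨s, a⟩, rfl⟩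
  change barTaylor ht q m (slot K A q s a - slot K A q 0 a) ∈ truncIdeal A n q m
  rw [map_sub, barTaylor_slot, barTaylor_slot, slotTaylor_zero]
  exact slotTaylor_sub_mem ht q m s a

theorem barTaylor_eq_zero (q m : ℕ) (x : Bar K A q) (hx : x ∈ barIdeal K A q ^ m) :
    barTaylor ht q m x = 0 := by
  have h := (Ideal.pow_right_mono (barIdeal_le_comap_barTaylor ht q m) m).trans
    (Ideal.le_comap_pow _ m) hx
  rw [truncIdeal_pow] at h
  exact h

/-- The Taylor expansion on the completion of `B_q(A)`. -/
def cbarTaylor (q m : ℕ) : CBar K A q →+* PolyTrunc A n q m :=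
  (Ideal.Quotient.lift (barIdeal K A q ^ m) (barTaylor ht q m : Bar K A q →+* _)
    (barTaylor_eq_zero ht q m)).comp (AdicCompletion.evalₐ (barIdeal K A q) m : CBar K A q →+* _)

theorem cbarTaylor_algebraMap (q m : ℕ) (x : Bar K A q) :
    cbarTaylor ht q m (algebraMap _ _ x) = barTaylor ht q m x := by
  rw [cbarTaylor, RingHom.comp_apply]
  have : (AdicCompletion.evalₐ (barIdeal K A q) m : CBar K A q →+* Bar K A q ⧸ barIdeal K A q ^ m)
      (algebraMap _ _ x) = Ideal.Quotient.mk (barIdeal K A q ^ m) x :=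
    (AdicCompletion.evalₐ (barIdeal K A q) m).commutes x
  rw [this]
  rfl

attribute [local instance] envAlgebraBar envAlgebra

/-- The Taylor expansion on `Ĉ_q(A)`. -/
def chainTaylorHom (q m : ℕ) : CChain K A q →+* PolyTrunc A n q m :=
  (Algebra.TensorProduct.lift (R := A ⊗[K] A) (S := A ⊗[K] A)
    ({ algebraMap A (PolyTrunc A n q m) with commutes' := fun _ => rfl } :
      A →ₐ[A ⊗[K] A] PolyTrunc A n q m)
    ({ cbarTaylor ht q m with
        commutes' := fun x => by
          -- The first and the last factor both go to constants, so `A ⊗ A` acts on the target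
          -- through multiplication, as it does on `A`.
          have : (barTaylor ht q m).comp (Algebra.TensorProduct.lift (slot K A q 0)
              (slot K A q (Fin.last (q + 1))) (fun _ _ => Commute.all _ _)) =
              (IsScalarTower.toAlgHom K A (PolyTrunc A n q m)).comp
                (Algebra.TensorProduct.lmul' K) := by
            ext a
            · simp [barTaylor_slot, slotTaylor_zero]
            · simp [barTaylor_slot, slotTaylor_last]
          exact (cbarTaylor_algebraMap ht q m _).trans (DFunLike.congr_fun this x) } :
      CBar K A q →ₐ[A ⊗[K] A] PolyTrunc A n q m) (fun _ _ => Commute.all _ _)).toRingHom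

theorem chainTaylorHom_tmul (q m : ℕ) (a : A) (x : CBar K A q) :
    chainTaylorHom ht q m (show CChain K A q from (a ⊗ₜ[A ⊗[K] A] x)) =
      algebraMap A _ a * cbarTaylor ht q m x :=
  Algebra.TensorProduct.lift_tmul _ _ _ _ _

theorem chainTaylorHom_toCChain (q m : ℕ) (x : Bar K A q) :
    chainTaylorHom ht q m (toCChain K A q x) = barTaylor ht q m x := by
  refine (chainTaylorHom_tmul ht q m 1 _).trans ?_
  rw [map_one, one_mul, cbarTaylor_algebraMap]

theorem algebraMap_CChain (q : ℕ) (a : A) : algebraMap A (CChain K A q) a =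
    (show CChain K A q from (a ⊗ₜ[A ⊗[K] A] 1)) := rfl

/-- Scalars move across the tensor product over `A ⊗ A`, where the left copy of `A` acts as the
factor `0` on one side and by multiplication on the other. The same argument applies to the last
factor, so the two end factors become equal. -/
theorem toCChain_slot_zero (q : ℕ) (a : A) :
    toCChain K A q (slot K A q 0 a) = algebraMap A _ a := by
  rw [algebraMap_CChain]
  have h1 : algebraMap (Bar K A q) (CBar K A q) (slot K A q 0 a) =
      (a ⊗ₜ[K] 1 : A ⊗[K] A) • (1 : CBar K A q) := by
    rw [Algebra.smul_def, mul_one]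
    refine congrArg (algebraMap (Bar K A q) (CBar K A q)) ?_
    exact (by simp : slot K A q 0 a = Algebra.TensorProduct.lift (slot K A q 0)
      (slot K A q (Fin.last (q + 1))) (fun _ _ => Commute.all _ _) (a ⊗ₜ[K] 1))
  have h2 : (a ⊗ₜ[K] 1 : A ⊗[K] A) • (1 : A) = a := by
    rw [Algebra.smul_def, mul_one]
    exact (by simp : Algebra.TensorProduct.lmul' K (a ⊗ₜ[K] (1 : A)) = a)
  change (1 : A) ⊗ₜ[A ⊗[K] A] algebraMap (Bar K A q) (CBar K A q) (slot K A q 0 a) = _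
  rw [h1, ← TensorProduct.smul_tmul, h2]

theorem toCChain_slot_last (q : ℕ) (a : A) :
    toCChain K A q (slot K A q (Fin.last (q + 1)) a) = algebraMap A _ a := by
  rw [algebraMap_CChain]
  have h1 : algebraMap (Bar K A q) (CBar K A q) (slot K A q (Fin.last (q + 1)) a) =
      (1 ⊗ₜ[K] a : A ⊗[K] A) • (1 : CBar K A q) := by
    rw [Algebra.smul_def, mul_one]
    refine congrArg (algebraMap (Bar K A q) (CBar K A q)) ?_
    exact (by simp : slot K A q (Fin.last (q + 1)) a = Algebra.TensorProduct.lift (slot K A q 0)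
      (slot K A q (Fin.last (q + 1))) (fun _ _ => Commute.all _ _) (1 ⊗ₜ[K] a))
  have h2 : (1 ⊗ₜ[K] a : A ⊗[K] A) • (1 : A) = a := by
    rw [Algebra.smul_def, mul_one]
    exact (by simp : Algebra.TensorProduct.lmul' K ((1 : A) ⊗ₜ[K] a) = a)
  change (1 : A) ⊗ₜ[A ⊗[K] A] algebraMap (Bar K A q) (CBar K A q) (slot K A q _ a) = _
  rw [h1, ← TensorProduct.smul_tmul, h2]

/-- The Taylor expansion on `Ĉ_q(A)`, as an `A`-algebra homomorphism. -/
def chainTaylor (q m : ℕ) : CChain K A q →ₐ[A] PolyTrunc A n q m :=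
  { chainTaylorHom ht q m with
    commutes' := fun a => by
      change chainTaylorHom ht q m (algebraMap A _ a) = _
      rw [← toCChain_slot_zero, chainTaylorHom_toCChain, barTaylor_slot, slotTaylor_zero] }

theorem chainTaylor_toCChain (q m : ℕ) (x : Bar K A q) :
    chainTaylor ht q m (toCChain K A q x) = barTaylor ht q m x := chainTaylorHom_toCChain ht q m x

theorem chainIdeal_pow (q m : ℕ) :
    chainIdeal K A q ^ m = (barIdeal K A q ^ m).map (toCChain K A q) := by
  rw [chainIdeal, Ideal.map_pow]

theorem chainTaylor_eq_zero (q m : ℕ) (x : CChain K A q) (hx : x ∈ chainIdeal K A q ^ m) :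
    chainTaylor ht q m x = 0 := by
  rw [chainIdeal_pow] at hx
  have : (barIdeal K A q ^ m).map (toCChain K A q) ≤
      RingHom.ker (chainTaylor ht q m : CChain K A q →+* PolyTrunc A n q m) := by
    rw [Ideal.map_le_iff_le_comap]
    intro y hy
    change chainTaylor ht q m (toCChain K A q y) = 0
    rw [chainTaylor_toCChain, barTaylor_eq_zero ht q m y hy]
  exact this hx

variable (K) in
/-- The variables of `PolyChain A n q` as elements of `Ĉ_q(A)`. -/
def polyToChain (t : Fin n → A) (q : ℕ) : PolyChain A n q →ₐ[A] CChain K A q :=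
  aeval fun p => toCChain K A q (slotDiff K q p.1.castSucc.succ (t p.2))

theorem polyToChain_X (t : Fin n → A) (q : ℕ) (p : Fin q × Fin n) :
    polyToChain K t q (X p) = toCChain K A q (slotDiff K q p.1.castSucc.succ (t p.2)) := by
  simp [polyToChain]

theorem slotDiff_mem (q : ℕ) (s : Fin (q + 2)) (a : A) : slotDiff K q s a ∈ barIdeal K A q := by
  rw [barIdeal, RingHom.mem_ker, slotDiff]
  rw [map_sub, barMul_slot, barMul_slot, sub_self]

theorem idealOfVars_le_comap_polyToChain (t : Fin n → A) (q : ℕ) :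
    idealOfVars (Fin q × Fin n) A ≤
      (chainIdeal K A q).comap (polyToChain K t q : PolyChain A n q →+* _) := by
  rw [Ideal.span_le]
  rintro _ ⟨p, rfl⟩
  change polyToChain K t q (X p) ∈ chainIdeal K A q
  rw [polyToChain_X]
  exact Ideal.mem_map_of_mem _ (slotDiff_mem _ _ _)

theorem polyToChain_mem_pow (t : Fin n → A) (q m : ℕ) {z : PolyChain A n q}
    (hz : z ∈ idealOfVars (Fin q × Fin n) A ^ m) :
    polyToChain K t q z ∈ chainIdeal K A q ^ m :=
  (Ideal.pow_right_mono (idealOfVars_le_comap_polyToChain t q) m).trans (Ideal.le_comap_pow _ m) hz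

/-- Expanding `1 ⊗ ⋯ ⊗ t_j ⊗ ⋯ ⊗ 1 - t_j ⊗ 1 ⊗ ⋯ ⊗ 1` gives `(t_j + x_{rj}) - t_j`. Hence
polynomials embed into `Ĉ_q(A)` modulo the powers of the ideals, which is the injective half of the
comparison. -/
theorem chainTaylor_polyToChain (q m : ℕ) (z : PolyChain A n q) :
    chainTaylor ht q m (polyToChain K t q z) = Ideal.Quotient.mk _ z := by
  have : (chainTaylor ht q m).comp (polyToChain K t q) = Ideal.Quotient.mkₐ A _ := by
    refine algHom_ext fun p => ?_
    rw [AlgHom.comp_apply, polyToChain_X, chainTaylor_toCChain, slotDiff, map_sub, barTaylor_slot,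
      barTaylor_slot, slotTaylor_zero, slotTaylor_cast, taylor_coord, map_add]
    exact add_sub_cancel_left _ _
  exact DFunLike.congr_fun this z

/-- Modulo the differences attached to a finite set of algebra generators, all factor embeddings
coincide on the generators and hence on `A`. Finite generation is what makes the kernel of the map
from the completion to `B_q(A)/I^m` equal to `I^m` times the completion. -/
theorem barIdeal_fg [Algebra.FiniteType K A] (q : ℕ) : (barIdeal K A q).FG := by
  obtain ⟨S, hS⟩ := Algebra.FiniteType.out (R := K) (A := A)
  let G : Set (Bar K A q) :=
    (fun p : Fin (q + 2) × A => slotDiff K q p.1 p.2) '' (Set.univ ×ˢ (S : Set A))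
  have hG : G.Finite := (Set.finite_univ.prod S.finite_toSet).image _
  refine ⟨hG.toFinset, le_antisymm ?_ ((barIdeal_le_span K q).trans ?_)⟩
  · rw [hG.coe_toFinset, Submodule.span_le]
    rintro _ ⟨p, _, rfl⟩
    exact slotDiff_mem q p.1 p.2
  · rw [hG.coe_toFinset, Ideal.span_le]
    rintro _ ⟨⟨s, a⟩, rfl⟩
    change slot K A q s a - slot K A q 0 a ∈ Ideal.span G
    rw [← Ideal.Quotient.eq]
    refine DFunLike.congr_fun (AlgHom.ext_of_adjoin_eq_top
      (φ₁ := (Ideal.Quotient.mkₐ K (Ideal.span G)).comp (slot K A q s))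
      (φ₂ := (Ideal.Quotient.mkₐ K (Ideal.span G)).comp (slot K A q 0)) hS fun a ha => ?_) a
    exact Ideal.Quotient.eq.mpr (Ideal.subset_span ⟨(s, a), ⟨trivial, ha⟩, rfl⟩)

/-- Density of the uncompleted ring. An element of the completion with trivial image modulo `I^m`
lies in `I^m` times the completion, and this property survives the tensor product with `A`. -/
theorem exists_toCChain_rep [Algebra.FiniteType K A] (q m : ℕ) (x : CChain K A q) :
    ∃ b, x - toCChain K A q b ∈ chainIdeal K A q ^ m := by
  induction x using chain_induction with
  | ht a y =>
    obtain ⟨b, hb⟩ := exists_bar_rep K m y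
    refine ⟨slot K A q 0 a * b, ?_⟩
    have hy : y - algebraMap (Bar K A q) _ b ∈
        (barIdeal K A q ^ m • ⊤ : Submodule (Bar K A q) (CBar K A q)) := by
      rw [AdicCompletion.pow_smul_top_eq_ker_eval (barIdeal_fg q), LinearMap.mem_ker,
        ← AdicCompletion.factor_evalₐ_eq_eval _ _ (by simp), map_sub, hb,
        (AdicCompletion.evalₐ (barIdeal K A q) m).commutes b]
      exact (congrArg _ (sub_self _)).trans (map_zero _)
    have h1 : ∀ w ∈ (barIdeal K A q ^ m • ⊤ : Submodule (Bar K A q) (CBar K A q)),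
        (show CChain K A q from (a ⊗ₜ[A ⊗[K] A] w)) ∈ chainIdeal K A q ^ m := by
      intro w hw
      induction hw using Submodule.smul_induction_on' with
      | smul r hr w _ =>
        rw [Algebra.smul_def]
        rw [← toCChain_mul_tmul, chainIdeal_pow]
        exact Ideal.mul_mem_right _ _ (Ideal.mem_map_of_mem _ hr)
      | add x _ y _ hx hy =>
        have : (show CChain K A q from (a ⊗ₜ[A ⊗[K] A] (x + y))) =
          (show CChain K A q from (a ⊗ₜ[A ⊗[K] A] x)) + (show CChain K A q from (a ⊗ₜ[A ⊗[K] A] y)) :=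
          TensorProduct.tmul_add _ _ _
        rw [this]
        exact add_mem hx hy
    have h2 := h1 _ hy
    have e : toCChain K A q (slot K A q 0 a * b) =
        (show CChain K A q from (a ⊗ₜ[A ⊗[K] A] (algebraMap _ (CBar K A q) b))) := by
      rw [mul_comm, map_mul, toCChain_slot_zero, algebraMap_CChain, toCChain_mul_tmul, mul_one]
    rw [e]
    have e2 : (show CChain K A q from (a ⊗ₜ[A ⊗[K] A] (y - algebraMap (Bar K A q) _ b))) =
        (show CChain K A q from (a ⊗ₜ[A ⊗[K] A] y)) -
          (show CChain K A q from (a ⊗ₜ[A ⊗[K] A] (algebraMap (Bar K A q) _ b))) :=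
      TensorProduct.tmul_sub _ _ _
    exact e2 ▸ h2
  | ha x y hx hy =>
    obtain ⟨b, hb⟩ := hx
    obtain ⟨c, hc⟩ := hy
    exact ⟨b + c, by rw [map_add, add_sub_add_comm]; exact add_mem hb hc⟩

/-- Surjective half of the comparison: modulo `I^m`, every chain is a polynomial in the coordinates
`x_{rj}`, namely a representative of its Taylor expansion. That Taylor expansion loses nothing
follows from the uniqueness of étale lifts. -/
theorem exists_polyToChain_rep [Algebra.FiniteType K A] (ht : IsEtaleCoord K t) (q m : ℕ)
    (x : CChain K A q) : ∃ z, x - polyToChain K t q z ∈ chainIdeal K A q ^ m := by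
  obtain ⟨b, hb⟩ := exists_toCChain_rep q m x
  let Q := CChain K A q ⧸ chainIdeal K A q ^ m
  let J : Ideal Q := (chainIdeal K A q).map (Ideal.Quotient.mk _)
  have hJ : J ^ m = ⊥ := by rw [← Ideal.map_pow, Ideal.map_quotient_self]
  let κ : PolyTrunc A n q m →ₐ[A] Q := Ideal.Quotient.liftₐ _
    ((Ideal.Quotient.mkₐ A (chainIdeal K A q ^ m)).comp (polyToChain K t q))
    (fun z hz => Ideal.Quotient.eq_zero_iff_mem.mpr (polyToChain_mem_pow t q m hz))
  have hκ : ∀ z, κ (Ideal.Quotient.mk _ z) = Ideal.Quotient.mk _ (polyToChain K t q z) :=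
    fun z => rfl
  have hκJ : ∀ y ∈ truncIdeal A n q m, κ y ∈ J := by
    intro y hy
    have : truncIdeal A n q m ≤ J.comap (κ : PolyTrunc A n q m →+* Q) := by
      rw [truncIdeal, Ideal.map_le_iff_le_comap]
      intro z hz
      exact Ideal.mem_map_of_mem _ (idealOfVars_le_comap_polyToChain t q hz)
    exact this hy
  -- Two ways to map `B_q(A)` to the quotient: directly, or by Taylor expansion followed by
  -- evaluation at the coordinates. They are compared on each factor.
  have key : (Ideal.Quotient.mk (chainIdeal K A q ^ m)).comp (toCChain K A q) =
      (κ : PolyTrunc A n q m →+* Q).comp (barTaylor ht q m : Bar K A q →+* PolyTrunc A n q m) := by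
    refine bar_ringHom_ext fun s a => ?_
    change Ideal.Quotient.mk _ (toCChain K A q (slot K A q s a)) =
      κ (barTaylor ht q m (slot K A q s a))
    rw [barTaylor_slot]
    induction s using Fin.cases with
    | zero => rw [toCChain_slot_zero, slotTaylor_zero, AlgHom.commutes]; rfl
    | succ s =>
    induction s using Fin.lastCases with
    | last => rw [Fin.succ_last, toCChain_slot_last, slotTaylor_last, AlgHom.commutes]; rfl
    | cast r =>
      rw [slotTaylor_cast]
      -- On an inner factor both maps send `t_j` to the same element, and both reduce to the scalar
      -- action modulo the nilpotent ideal `J`. Formal unramifiedness then forces them to agree on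
      -- `A`.
      refine DFunLike.congr_fun (lift_unique_of_formallyEtale _ ht J ⟨m, hJ⟩
        (((Ideal.Quotient.mk (chainIdeal K A q ^ m)).comp (toCChain K A q)).comp
          (slot K A q r.castSucc.succ : A →+* Bar K A q))
        ((κ : PolyTrunc A n q m →+* Q).comp (taylor ht q m r : A →+* PolyTrunc A n q m)) ?_ ?_) a
      · refine MvPolynomial.ringHom_ext (fun k => ?_) (fun j => ?_)
        · simp only [RingHom.comp_apply, RingHom.coe_coe, ← algebraMap_eq, AlgHom.commutes]
          rw [← (slot K A q 0).commutes, toCChain_slot_zero,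
            IsScalarTower.algebraMap_apply K A (PolyTrunc A n q m), AlgHom.commutes]
          rfl
        · simp only [RingHom.comp_apply, RingHom.coe_coe, aeval_X, taylor_coord]
          rw [hκ, map_add, polyToChain_X, slotDiff, map_sub (toCChain K A q), toCChain_slot_zero,
            ← algebraMap_eq, AlgHom.commutes, add_sub_cancel]
      · intro x
        have h1 : Ideal.Quotient.mk (chainIdeal K A q ^ m) (toCChain K A q
            (slot K A q r.castSucc.succ x)) - algebraMap A Q x ∈ J := by
          have : algebraMap A Q x = Ideal.Quotient.mk _ (toCChain K A q (slot K A q 0 x)) := by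
            rw [toCChain_slot_zero]; rfl
          rw [this, ← map_sub, ← map_sub]
          exact Ideal.mem_map_of_mem _ (Ideal.mem_map_of_mem _ (slotDiff_mem q _ x))
        have h2 := hκJ _ (taylor_sub_mem ht q m r x)
        rw [map_sub, AlgHom.commutes] at h2
        have := sub_mem h1 h2
        rwa [sub_sub_sub_cancel_right] at this
  obtain ⟨z, hz⟩ := Ideal.Quotient.mk_surjective (barTaylor ht q m b)
  refine ⟨z, ?_⟩
  have h := DFunLike.congr_fun key b
  simp only [RingHom.comp_apply, RingHom.coe_coe, ← hz, hκ] at h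
  have := add_mem hb (Ideal.Quotient.eq.mp h)
  rwa [sub_add_sub_cancel] at this

end Taylor

/-! ### Compatibility of the coordinates with `∂` and `π`. -/

section ChainMaps
open MvPolynomial
variable {K A : Type u} [CommRing K] [CommRing A] [Algebra K A] {n : ℕ} (t : Fin n → A)

/-- Explains the convention that the variables of both end factors are zero: in `Ĉ_q(A)` the first
and the last factor are identified. -/
theorem toCChain_slotDiff (q : ℕ) (s : Fin (q + 2)) (j : Fin n) :
    toCChain K A q (slotDiff K q s (t j)) = polyToChain K t q (polyChainVar A n q s j) := by
  induction s using Fin.cases with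
  | zero => rw [slotDiff, sub_self, map_zero, polyChainVar_zero, map_zero]
  | succ s =>
  induction s using Fin.lastCases with
  | last => rw [Fin.succ_last, slotDiff, map_sub, toCChain_slot_zero, toCChain_slot_last, sub_self,
      polyChainVar_last, map_zero]
  | cast r => rw [polyChainVar_castSucc_succ, polyToChain_X]

theorem chainMap_toCChain {A' : Type u} [CommRing A'] [Algebra K A'] {q r : ℕ} (g : A →ₐ[K] A')
    (σ : Fin (q + 2) → Fin (r + 2)) (h0 hl) (x : Bar K A q) :
    chainMap K g σ h0 hl (toCChain K A q x) = toCChain K A' r (barMap K g σ x) := by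
  refine (chainMap_tmul K g σ h0 hl 1 _).trans ?_
  have : cbarMap K g σ (algebraMap _ _ x) = algebraMap _ _ (barMap K g σ x) :=
    adicMap_algebraMap _ _ _
  rw [this, map_one]; rfl

theorem chainMap_algebraMap {A' : Type u} [CommRing A'] [Algebra K A'] {q r : ℕ} (g : A →ₐ[K] A')
    (σ : Fin (q + 2) → Fin (r + 2)) (h0 hl) (a : A) :
    chainMap K g σ h0 hl (algebraMap A (CChain K A q) a) = algebraMap A' (CChain K A' r) (g a) := by
  rw [Algebra.algebraMap_eq_smul_one, chainMap_smul, map_one, Algebra.algebraMap_eq_smul_one]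

/-- A face fixes the factor `0`, so it carries the difference attached to a factor to the difference
attached to the image of that factor. -/
theorem chainFace_polyToChain (q : ℕ) (i : Fin (q + 2)) (z : PolyChain A n (q + 1)) :
    chainFace K q i (polyToChain K t (q + 1) z) =
      polyToChain K t q (polyChainFace A n q i z) := by
  have : (chainFace K q i).comp (polyToChain K t (q + 1) : PolyChain A n (q + 1) →+* _) =
      (polyToChain K t q : PolyChain A n q →+* CChain K A q).comp
        (polyChainFace A n q i : PolyChain A n (q + 1) →+* PolyChain A n q) := by
    refine MvPolynomial.ringHom_ext (fun a => ?_) (fun p => ?_)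
    · simp only [RingHom.comp_apply, RingHom.coe_coe, ← algebraMap_eq, AlgHom.commutes]
      exact chainMap_algebraMap _ _ _ _ a
    · simp only [RingHom.comp_apply, RingHom.coe_coe, polyToChain_X, polyChainFace_X]
      rw [← toCChain_slotDiff, chainFace, chainMap_toCChain, slotDiff, map_sub, barMap_slot,
        barMap_slot, Fin.predAbove_right_zero]
      rfl
  exact DFunLike.congr_fun this z

theorem chainBoundary_polyToChain (q : ℕ) (z : PolyChain A n (q + 1)) :
    chainBoundary K A q (polyToChain K t (q + 1) z) = polyToChain K t q (polyChainD A n q z) := by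
  rw [chainBoundary_apply, polyChainD_apply, map_sum]
  refine Finset.sum_congr rfl fun i _ => ?_
  rw [chainFace_polyToChain, map_zsmul]

theorem chainPi_toCChain (q : ℕ) (x : Bar K A q) :
    chainPi K A q (toCChain K A q x) = barPi K A q x := by
  refine (chainPi_tmul K 1 _).trans ?_
  rw [one_smul]
  exact cbarPi_eq K _ _ ((AdicCompletion.evalₐ (barIdeal K A q) (q + 1)).commutes x)

/-- By the Leibniz rule, multiplication by the difference attached to `a_r` replaces `db_r` by
`d(a_r b_r) - a_r db_r = b_r da_r`. The subset `S` records the places already treated and allows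
induction. -/
theorem barPi_prod_slotDiff_mul_tprod (q : ℕ) (a : Fin q → A) (S : Finset (Fin q))
    (b : Fin (q + 2) → A) :
    barPi K A q ((∏ r ∈ S, slotDiff K q r.castSucc.succ (a r)) * PiTensorProduct.tprod K b) =
      (b 0 * b (Fin.last (q + 1))) • exteriorPower.ιMulti A q (fun i : Fin q =>
        if i ∈ S then b i.castSucc.succ • KaehlerDifferential.D K A (a i)
        else KaehlerDifferential.D K A (b i.castSucc.succ)) := by
  induction S using Finset.induction_on generalizing b with
  | empty => rw [Finset.prod_empty, one_mul, barPi_tprod]; simp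
  | insert r S hr ih =>
    have h1 : (0 : Fin (q + 2)) ≠ r.castSucc.succ := (Fin.succ_ne_zero _).symm
    have h2 : Fin.last (q + 1) ≠ r.castSucc.succ := by
      rw [← Fin.succ_last, Ne, Fin.succ_inj]; exact (Fin.castSucc_lt_last r).ne'
    let G : Fin q → Ω[A⁄K] := fun i =>
        if i ∈ S then b i.castSucc.succ • KaehlerDifferential.D K A (a i)
        else KaehlerDifferential.D K A (b i.castSucc.succ)
    have e1 : (fun i : Fin q => if i ∈ S then
        Function.update b r.castSucc.succ (a r * b r.castSucc.succ) i.castSucc.succ •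
          KaehlerDifferential.D K A (a i)
        else KaehlerDifferential.D K A
          (Function.update b r.castSucc.succ (a r * b r.castSucc.succ) i.castSucc.succ)) =
        Function.update G r (a r • KaehlerDifferential.D K A (b r.castSucc.succ) +
          b r.castSucc.succ • KaehlerDifferential.D K A (a r)) := by
      ext i
      by_cases h : i = r
      · subst h
        simp [hr]
      · have : i.castSucc.succ ≠ r.castSucc.succ := by simpa using h
        simp only [Function.update_of_ne this, Function.update_of_ne h]
        rfl
    have e2 : (fun i : Fin q => if i ∈ insert r S then
        b i.castSucc.succ • KaehlerDifferential.D K A (a i)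
        else KaehlerDifferential.D K A (b i.castSucc.succ)) =
        Function.update G r (b r.castSucc.succ • KaehlerDifferential.D K A (a r)) := by
      ext i
      by_cases h : i = r
      · subst h; simp
      · simp [G, h]
    have e3 : Function.update G r (KaehlerDifferential.D K A (b r.castSucc.succ)) = G := by
      conv_rhs => rw [← Function.update_eq_self r G]
      simp [G, hr]
    rw [Finset.prod_insert hr, mul_comm (slotDiff K q _ _), mul_assoc]
    conv_lhs => rw [slotDiff, sub_mul, mul_sub, slot_mul_tprod, mul_left_comm, map_sub,
      barPi_slot_zero, ih, ih, Function.update_of_ne h1, Function.update_of_ne h2]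
    rw [e1, e2, AlternatingMap.map_update_add, AlternatingMap.map_update_smul, e3, smul_add,
      smul_comm (a r)]
    exact add_sub_cancel_left _ _

theorem barPi_prod_slotDiff_eq_ιMulti (q : ℕ) (a : Fin q → A) :
    barPi K A q (∏ r, slotDiff K q r.castSucc.succ (a r)) =
      exteriorPower.ιMulti A q (fun i => KaehlerDifferential.D K A (a i)) := by
  have h := barPi_prod_slotDiff_mul_tprod (K := K) q a Finset.univ 1
  have h1 : (PiTensorProduct.tprod K (1 : Fin (q + 2) → A) : Bar K A q) = 1 := rfl
  rw [h1, mul_one] at h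
  simpa using h

theorem chainPi_polyToChain_prod (q : ℕ) (J : Fin q → Fin n) :
    chainPi K A q (polyToChain K t q (∏ r, X (r, J r))) =
      exteriorPower.ιMulti A q (fun i => KaehlerDifferential.D K A (t (J i))) := by
  simp only [map_prod, polyToChain_X]
  rw [← map_prod, chainPi_toCChain, barPi_prod_slotDiff_eq_ιMulti]

end ChainMaps

/-! ### Splitting `π` over étale coordinates, with the division by `q!`. -/

section Split
open MvPolynomial
variable {K A : Type u} [CommRing K] [CommRing A] [Algebra K A] {n : ℕ} {t : Fin n → A}

/-- Differentials are compatible with formally étale extensions: `Ω_{A/K}` is the base change of the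
differentials of `K[t]`, which are free on the `dt_j`. -/
theorem exists_kaehlerBasis (ht : IsEtaleCoord K t) :
    ∃ b : Module.Basis (Fin n) A Ω[A⁄K], ∀ j, b j = KaehlerDifferential.D K A (t j) := by
  let := ((aeval t : MvPolynomial (Fin n) K →ₐ[K] A) : MvPolynomial (Fin n) K →+* A).toAlgebra
  have : IsScalarTower K (MvPolynomial (Fin n) K) A :=
    IsScalarTower.of_algebraMap_eq fun r => ((aeval t).commutes r).symm
  have : Algebra.FormallyEtale (MvPolynomial (Fin n) K) A := ht
  refine ⟨((KaehlerDifferential.mvPolynomialBasis K (Fin n)).baseChange A).map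
    (KaehlerDifferential.tensorKaehlerEquivOfFormallyEtale K (MvPolynomial (Fin n) K) A),
    fun j => ?_⟩
  simp
  exact congrArg _ (aeval_X t j)

/-- The `A`-linear map `Ω_{A/K} → A[u]`, `dt_j ↦ X (r, j)`. -/
def kaehlerToPoly (b : Module.Basis (Fin n) A Ω[A⁄K]) (q : ℕ) (r : Fin q) :
    Ω[A⁄K] →ₗ[A] PolyChain A n q :=
  b.constr A fun j => X (r, j)

/-- The section `ω₁ ∧ ⋯ ∧ ω_q ↦ (1/q!) ∑_σ sgn(σ) ω_{σ(1)} ⊗ ⋯ ⊗ ω_{σ(q)}` of `π`. -/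
def formToPoly (b : Module.Basis (Fin n) A Ω[A⁄K]) (q : ℕ) :
    ⋀[A]^q Ω[A⁄K] →ₗ[A] PolyChain A n q :=
  Ring.inverse ((q.factorial : ℕ) : A) • exteriorPower.alternatingMapLinearEquiv
    (MultilinearMap.alternatization
      ((MultilinearMap.mkPiAlgebra A (Fin q) (PolyChain A n q)).compLinearMap
        (kaehlerToPoly b q)))

theorem formToPoly_ιMulti (b : Module.Basis (Fin n) A Ω[A⁄K]) (q : ℕ) (v : Fin q → Ω[A⁄K]) :
    formToPoly b q (exteriorPower.ιMulti A q v) = Ring.inverse ((q.factorial : ℕ) : A) •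
      ∑ σ : Equiv.Perm (Fin q), Equiv.Perm.sign σ • ∏ r, kaehlerToPoly b q r (v (σ r)) := by
  rw [formToPoly, LinearMap.smul_apply, exteriorPower.alternatingMapLinearEquiv_apply_ιMulti,
    MultilinearMap.alternatization_apply]
  rfl

theorem polyChainAlt_eq_sum {q : ℕ} (J : Fin q → Fin n) :
    polyChainAlt A J = ∑ σ : Equiv.Perm (Fin q), Equiv.Perm.sign σ • ∏ r, X (r, J (σ r)) := by
  rw [polyChainAlt, ← Matrix.det_transpose, Matrix.det_apply]
  rfl

theorem formToPoly_basis (b : Module.Basis (Fin n) A Ω[A⁄K]) (q : ℕ) (J : Fin q → Fin n) :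
    formToPoly b q (exteriorPower.ιMulti A q (fun i => b (J i))) =
      Ring.inverse ((q.factorial : ℕ) : A) • polyChainAlt A J := by
  rw [formToPoly_ιMulti, polyChainAlt_eq_sum]
  simp [kaehlerToPoly]

theorem formToPoly_isHomogeneous (b : Module.Basis (Fin n) A Ω[A⁄K]) (q : ℕ)
    (x : ⋀[A]^q Ω[A⁄K]) : (formToPoly b q x).IsHomogeneous q := by
  have h1 : ∀ (r : Fin q) (ω : Ω[A⁄K]), (kaehlerToPoly b q r ω).IsHomogeneous 1 := by
    intro r ω
    rw [kaehlerToPoly, Module.Basis.constr_apply_fintype]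
    exact IsHomogeneous.sum _ _ _ fun j _ =>
      (homogeneousSubmodule _ A 1).smul_mem _ (isHomogeneous_X _ _)
  induction x using wedge_induction with
  | hm v =>
    rw [formToPoly_ιMulti]
    refine (homogeneousSubmodule _ A q).smul_mem _ (IsHomogeneous.sum _ _ _ fun σ _ => ?_)
    refine (homogeneousSubmodule _ A q).smul_of_tower_mem _ ?_
    have := IsHomogeneous.prod Finset.univ (fun r => kaehlerToPoly b q r (v (σ r))) (fun _ => 1)
      (fun r _ => h1 r _)
    simpa using this
  | hs c x hx => rw [map_smul]; exact (homogeneousSubmodule _ A q).smul_mem _ hx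
  | ha x y hx hy => rw [map_add]; exact hx.add hy

theorem isUnit_factorial_of_le {q : ℕ} (h : q ≤ n) (hn : IsUnit ((n.factorial : ℕ) : A)) :
    IsUnit ((q.factorial : ℕ) : A) :=
  isUnit_of_dvd_unit (Nat.cast_dvd_cast (Nat.factorial_dvd_factorial h)) hn

/-- Each of the `q!` terms contributes the same form, since the sign of the permutation cancels the
sign from reordering the wedge product. -/
theorem chainPi_polyChainAlt {q : ℕ} (J : Fin q → Fin n) :
    chainPi K A q (polyToChain K t q (polyChainAlt A J)) = (q.factorial : A) •
      exteriorPower.ιMulti A q (fun i => KaehlerDifferential.D K A (t (J i))) := by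
  rw [polyChainAlt_eq_sum, map_sum, map_sum]
  have : ∀ σ : Equiv.Perm (Fin q), chainPi K A q (polyToChain K t q
      (Equiv.Perm.sign σ • ∏ r, X (r, J (σ r)))) =
      exteriorPower.ιMulti A q (fun i => KaehlerDifferential.D K A (t (J i))) := by
    intro σ
    rw [Units.smul_def, map_zsmul, map_zsmul,
      show chainPi K A q (polyToChain K t q (∏ r, X (r, J (σ r)))) = _ from
        chainPi_polyToChain_prod t q (fun r => J (σ r))]
    have h := AlternatingMap.map_perm (exteriorPower.ιMulti A q)
      (fun i => KaehlerDifferential.D K A (t (J i))) σ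
    have h2 : (fun i => KaehlerDifferential.D K A (t (J (σ i)))) =
      (fun i => KaehlerDifferential.D K A (t (J i))) ∘ σ := rfl
    rw [h2, h, Units.smul_def, smul_smul, ← Units.val_mul, Int.units_mul_self, Units.val_one,
      one_smul]
  simp only [this]
  rw [Finset.sum_const, Finset.card_univ, Fintype.card_perm, Fintype.card_fin, Nat.cast_smul_eq_nsmul]

/-- On an affine scheme with étale coordinates, `π` has a homotopy inverse. -/
theorem exists_chart_homotopy (ht : IsEtaleCoord K t) (hn : IsUnit ((n.factorial : ℕ) : A)) :
    ∃ (s : ∀ q, ⋀[A]^q Ω[A⁄K] →ₗ[A] PolyChain A n q)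
      (h : ∀ q, PolyChain A n q →ₗ[A] PolyChain A n (q + 1)),
      (∀ q x, chainPi K A q (polyToChain K t q (s q x)) = x) ∧
      (∀ q x, polyChainD A n q (s (q + 1) x) = 0) ∧
      (∀ z, z - s 0 (chainPi K A 0 (polyToChain K t 0 z)) = polyChainD A n 0 (h 0 z)) ∧
      (∀ q z, z - s (q + 1) (chainPi K A (q + 1) (polyToChain K t (q + 1) z)) =
        polyChainD A n (q + 1) (h (q + 1) z) + h q (polyChainD A n q z)) ∧
      (∀ q m, q < m → ∀ z ∈ idealOfVars (Fin q × Fin n) A ^ m,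
        h q z ∈ idealOfVars (Fin (q + 1) × Fin n) A ^ m) := by
  obtain ⟨b, hb⟩ := exists_kaehlerBasis ht
  -- An injective multi-index has length at most `n`, so `q!` divides the invertible `n!`. Only such
  -- indices matter; for `q > n` the forms vanish, and the value of `Ring.inverse` plays no role.
  have hq : ∀ {q} {J : Fin q → Fin n}, Function.Injective J → IsUnit ((q.factorial : ℕ) : A) := by
    intro q J hJ
    exact isUnit_factorial_of_le (by simpa using Fintype.card_le_of_injective J hJ) hn
  have hps : ∀ q x, chainPi K A q (polyToChain K t q (formToPoly b q x)) = x := by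
    intro q x
    refine DFunLike.congr_fun (f := (chainPi K A q).comp
      ((polyToChain K t q).toLinearMap.comp (formToPoly b q))) (g := LinearMap.id) ?_ x
    refine exteriorPower.linearMap_ext (b.ext_alternating fun J hJ => ?_)
    change chainPi K A q (polyToChain K t q
      (formToPoly b q (exteriorPower.ιMulti A q (fun i => b (J i))))) = _
    rw [formToPoly_basis, map_smul, map_smul, chainPi_polyChainAlt, smul_smul,
      Ring.inverse_mul_cancel _ (hq hJ), one_smul]
    simp only [← hb]
    rfl
  have hsd : ∀ q x, polyChainD A n q (formToPoly b (q + 1) x) = 0 := by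
    intro q x
    refine DFunLike.congr_fun (f := (polyChainD A n q).comp (formToPoly b (q + 1))) (g := 0) ?_ x
    refine exteriorPower.linearMap_ext (b.ext_alternating fun J hJ => ?_)
    change polyChainD A n q
      (formToPoly b (q + 1) (exteriorPower.ιMulti A (q + 1) (fun i => b (J i)))) = 0
    rw [formToPoly_basis, map_smul, polyChainD_alt, smul_zero]
  obtain ⟨h, h1, h2, h3⟩ := exists_polyChain_homotopy
    (fun q => (chainPi K A q).comp (polyToChain K t q).toLinearMap) (formToPoly b) hps
    (fun q z => by
      change chainPi K A q (polyToChain K t q (polyChainD A n q z)) = 0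
      rw [← chainBoundary_polyToChain, chainPi_chainBoundary])
    hsd
    (fun q J => by
      -- With a repeated index the determinant has two equal columns and is the image of zero;
      -- otherwise it is `q!` times the value of the section on a wedge of basis elements.
      by_cases hJ : Function.Injective J
      · refine ⟨(q.factorial : A) • exteriorPower.ιMulti A q (fun i => b (J i)), ?_⟩
        rw [map_smul, formToPoly_basis, smul_smul, Ring.mul_inverse_cancel _ (hq hJ), one_smul]
      · obtain ⟨i, j, hij, hne⟩ := Function.not_injective_iff.mp hJ
        refine ⟨0, ?_⟩
        rw [map_zero, polyChainAlt, Matrix.det_zero_of_column_eq hne]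
        intro r
        simp [hij])
    (formToPoly_isHomogeneous b)
    (fun q d z hd hz => by
      -- A polynomial of degree above `q` lies in the power `q + 1` of the ideal, where `π`
      -- vanishes.
      refine chainPi_eq_zero_of_mem_pow K _ (polyToChain_mem_pow t q (q + 1) ?_)
      refine (mem_pow_idealOfVars_iff _ _).mpr fun α hα => ?_
      have := (hz.degree_eq_sum_deg_support hα)
      change d = α.degree at this
      omega)
  exact ⟨formToPoly b, h, hps, hsd, h1, h2, h3⟩

end Split

/-! ### A criterion for quasi-isomorphisms by sections over a basis of open sets. -/

section Sections
open AlgebraicGeometry CategoryTheory Opposite TopologicalSpace Limits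

variable {X : Scheme.{u}}

/-- Sections over `W` as a functor to types. -/
def sectionsFunctor (W : X.Opens) : X.Modules ⥤ Type u :=
  Scheme.Modules.toPresheaf X ⋙ (evaluation _ _).obj (op W) ⋙ forget Ab.{u}

instance (W : X.Opens) : PreservesLimitsOfSize.{0, 0} (sectionsFunctor W) := by
  have h1 : PreservesLimitsOfSize.{u, u} (sectionsFunctor W) := by
    have h2 : PreservesLimitsOfSize.{u, u} ((evaluation (Opens X)ᵒᵖ Ab.{u}).obj (op W)) := inferInstance
    have h3 : PreservesLimitsOfSize.{u, u} ((evaluation (Opens X)ᵒᵖ Ab.{u}).obj (op W) ⋙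
      forget Ab.{u}) := comp_preservesLimits _ _
    exact comp_preservesLimits (Scheme.Modules.toPresheaf X) _
  exact preservesLimitsOfSize_shrink _

theorem exists_pullback_section {M N P : X.Modules} (a : M ⟶ P) (b : N ⟶ P) (W : X.Opens)
    (m : Γ(M, W)) (n : Γ(N, W)) (h : a.app W m = b.app W n) :
    ∃ s : Γ(pullback a b, W), (pullback.fst a b).app W s = m := by
  obtain ⟨s, hs, -⟩ := Types.exists_of_isPullback
    ((IsPullback.of_hasPullback a b).map (sectionsFunctor W)) m n h
  exact ⟨s, hs⟩

theorem pi_section_ext {ι : Type} (F : ι → X.Modules) (W : X.Opens) (s s' : Γ(∏ᶜ F, W))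
    (h : ∀ i, (Pi.π F i).app W s = (Pi.π F i).app W s') : s = s' := by
  refine Concrete.isLimit_ext _ (isLimitOfPreserves (sectionsFunctor W)
    (limit.isLimit (Discrete.functor F))) s s' ?_
  rintro ⟨i⟩
  exact h i

theorem exists_pi_section {ι : Type} (F : ι → X.Modules) (W : X.Opens) (m : ∀ i, Γ(F i, W)) :
    ∃ s : Γ(∏ᶜ F, W), ∀ i, (Pi.π F i).app W s = m i := by
  have hl := isLimitOfPreserves (sectionsFunctor W) (limit.isLimit (Discrete.functor F))
  let σ : (Discrete.functor F ⋙ sectionsFunctor W).sections :=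
    ⟨fun i => m i.as, by
      rintro ⟨i⟩ ⟨j⟩ ⟨⟨h⟩⟩
      obtain rfl : i = j := h
      exact congrArg (fun ψ => (ConcreteCategory.hom ψ) (m i))
        ((Discrete.functor F ⋙ sectionsFunctor W).map_id ⟨i⟩)⟩
  refine ⟨(Types.isLimitEquivSections hl).symm σ, fun i => ?_⟩
  exact Types.isLimitEquivSections_symm_apply hl σ ⟨i⟩

theorem section_ext_of_locally (M : X.Modules)
    {U : X.Opens} (m m' : Γ(M, U))
    (h : ∀ x ∈ U, ∃ (V : X.Opens) (hV : V ≤ U), x ∈ V ∧ resM M hV m = resM M hV m') : m = m' := by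
  choose V hV hx he using h
  refine resM_ext M (fun x : U => V x.1 x.2) (fun x => hV _ _) (fun x hx' => ?_) _ _
    fun x => he x.1 x.2
  exact Opens.mem_iSup.mpr ⟨⟨x, hx'⟩, hx _ _⟩

/-- Two morphisms that agree after composition agree on all sections over the basis, and sections of
a sheaf are determined locally. -/
theorem epi_of_surjective_on_basis {B : Set X.Opens} (hB : Opens.IsBasis B) {M N : X.Modules}
    (φ : M ⟶ N) (h : ∀ W ∈ B, Function.Surjective (φ.app W)) : Epi φ where
  left_cancellation {P} a b hab := by
    refine modules_hom_ext fun U m => section_ext_of_locally P _ _ fun x hx => ?_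
    obtain ⟨W, hW, hxW, hWU⟩ := Opens.isBasis_iff_nbhd.mp hB hx
    refine ⟨W, hWU, hxW, ?_⟩
    obtain ⟨n, hn⟩ := h W hW (resM N hWU m)
    rw [← app_resM, ← app_resM, ← hn]
    exact congrArg (fun ψ : M ⟶ P => ψ.app W n) hab

/-- The fibre product is the universal refinement on which the lift exists, and its sections are
pairs of compatible sections. This turns a lifting property for sections into one for generalized
elements of the abelian category. -/
theorem exists_refinement {B : Set X.Opens} (hB : Opens.IsBasis B) {A P Y : X.Modules}
    (a : A ⟶ Y) (b : P ⟶ Y) (h : ∀ W ∈ B, ∀ s : Γ(A, W), ∃ p : Γ(P, W), b.app W p = a.app W s) :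
    ∃ (A' : X.Modules) (π : A' ⟶ A) (_ : Epi π) (p : A' ⟶ P), π ≫ a = p ≫ b := by
  refine ⟨pullback a b, pullback.fst a b, ?_, pullback.snd a b, pullback.condition⟩
  refine epi_of_surjective_on_basis hB _ fun W hW s => ?_
  obtain ⟨p, hp⟩ := h W hW s
  exact exists_pullback_section a b W s p hp.symm

/-- A homomorphism of complexes of `𝒪_X`-modules is a quasi-isomorphism if it induces
isomorphisms on the cohomology of the complexes of sections over a basis of open subsets. -/
theorem quasiIso_of_sections {ι : Type*} {c : ComplexShape ι}
    {P Q : HomologicalComplex X.Modules c} (φ : P ⟶ Q) {B : Set X.Opens} (hB : Opens.IsBasis B)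
    (hsurj : ∀ W ∈ B, ∀ i j k, c.prev j = i → c.next j = k → ∀ z : Γ(Q.X j, W),
      (Q.d j k).app W z = 0 → ∃ (y : Γ(P.X j, W)) (w : Γ(Q.X i, W)),
        (P.d j k).app W y = 0 ∧ z = (φ.f j).app W y + (Q.d i j).app W w)
    (hinj : ∀ W ∈ B, ∀ i j k, c.prev j = i → c.next j = k → ∀ (y : Γ(P.X j, W)) (w : Γ(Q.X i, W)),
      (P.d j k).app W y = 0 → (φ.f j).app W y = (Q.d i j).app W w →
        ∃ v : Γ(P.X i, W), y = (P.d i j).app W v) : QuasiIso φ := by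
  rw [quasiIso_iff]
  intro j
  rw [quasiIsoAt_iff_isIso_homologyMap]
  have : Mono (HomologicalComplex.homologyMap φ j) := by
    rw [HomologicalComplex.mono_homologyMap_iff_up_to_refinements φ _ j _ rfl rfl]
    intro A x hx y hxy
    refine exists_refinement hB x (P.d _ j) fun W hW s => ?_
    obtain ⟨v, hv⟩ := hinj W hW _ j _ rfl rfl (x.app W s) (y.app W s)
      (congrArg (fun ψ : A ⟶ P.X _ => ψ.app W s) hx)
      (congrArg (fun ψ : A ⟶ Q.X _ => ψ.app W s) hxy)
    exact ⟨v, hv.symm⟩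
  have : Epi (HomologicalComplex.homologyMap φ j) := by
    rw [HomologicalComplex.epi_homologyMap_iff_up_to_refinements φ _ j _ rfl rfl]
    intro A z hz
    -- The two conditions `z = φ(y) + dw` and `dy = 0` are combined into one lifting problem: `(z,
    -- 0)` is to be lifted along `(y, w) ↦ (φ(y) + dw, dy)`.
    obtain ⟨A', π, hπ, p, hp⟩ := exists_refinement hB (biprod.lift z (0 : A ⟶ P.X (c.next j)))
      (biprod.lift (biprod.desc (φ.f j) (Q.d (c.prev j) j)) (biprod.fst ≫ P.d j _))
      fun W hW s => by
        obtain ⟨y, w, hy, h⟩ := hsurj W hW _ j _ rfl rfl (z.app W s)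
          (congrArg (fun ψ : A ⟶ Q.X _ => ψ.app W s) hz)
        have e1 : (biprod.inl : P.X j ⟶ P.X j ⊞ Q.X (c.prev j)) ≫
            biprod.lift (biprod.desc (φ.f j) (Q.d (c.prev j) j)) (biprod.fst ≫ P.d j _) =
            φ.f j ≫ biprod.inl + P.d j (c.next j) ≫ biprod.inr := by
          refine biprod.hom_ext _ _ ?_ ?_ <;> simp
        have e2 : (biprod.inr : Q.X (c.prev j) ⟶ P.X j ⊞ Q.X (c.prev j)) ≫
            biprod.lift (biprod.desc (φ.f j) (Q.d (c.prev j) j)) (biprod.fst ≫ P.d j (c.next j)) =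
            Q.d _ j ≫ biprod.inl := by
          refine biprod.hom_ext _ _ ?_ ?_ <;> simp
        have e3 : biprod.lift z (0 : A ⟶ P.X (c.next j)) = z ≫ biprod.inl := by
          refine biprod.hom_ext _ _ ?_ ?_ <;> simp
        refine ⟨(biprod.inl : P.X j ⟶ P.X j ⊞ Q.X (c.prev j)).app W y +
          (biprod.inr : Q.X (c.prev j) ⟶ P.X j ⊞ Q.X (c.prev j)).app W w, ?_⟩
        have e1' := congrArg (fun ψ : P.X j ⟶ Q.X j ⊞ P.X (c.next j) => ψ.app W y) e1
        have e2' := congrArg (fun ψ : Q.X _ ⟶ Q.X j ⊞ P.X (c.next j) => ψ.app W w) e2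
        have e3' := congrArg (fun ψ : A ⟶ Q.X j ⊞ P.X (c.next j) => ψ.app W s) e3
        refine (map_add _ _ _).trans (((congrArg₂ (· + ·) e1' e2')).trans (Eq.trans ?_ e3'.symm))
        change (biprod.inl : Q.X j ⟶ _).app W ((φ.f j).app W y) +
          (biprod.inr : P.X (c.next j) ⟶ _).app W ((P.d j _).app W y) +
          (biprod.inl : Q.X j ⟶ _).app W ((Q.d _ j).app W w) =
          (biprod.inl : Q.X j ⟶ _).app W (z.app W s)
        rw [hy, map_zero, add_zero, ← map_add, ← h]
    have h1 := congrArg (· ≫ biprod.fst) hp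
    have h2 := congrArg (· ≫ biprod.snd) hp
    simp only [Category.assoc, biprod.lift_fst, biprod.lift_snd, comp_zero] at h1 h2
    refine ⟨A', π, hπ, p ≫ biprod.fst, by rw [Category.assoc, ← h2], p ≫ biprod.snd, ?_⟩
    rw [h1, biprod.desc_eq, Preadditive.comp_add, Category.assoc, Category.assoc]
  exact isIso_of_mono_of_epi _

end Sections

/-! ### Étale coordinates on a smooth scheme. -/

section Charts
open AlgebraicGeometry CategoryTheory Opposite TopologicalSpace Limits

theorem RingHom.Etale.formallyEtale {R S : Type*} [CommRing R] [CommRing S] {g : R →+* S}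
    (hg : g.Etale) : g.FormallyEtale := by
  algebraize [g]
  exact inferInstanceAs (Algebra.FormallyEtale R S)

theorem etale_mvPolynomial_map {R S : Type u} [CommRing R] [CommRing S] {g : R →+* S}
    (hg : g.Etale) (n : ℕ) : (MvPolynomial.map (σ := Fin n) g).Etale := by
  algebraize [g]
  let := MvPolynomial.algebraMvPolynomial (R := R) (S := S) (σ := Fin n)
  exact RingHom.Etale.isStableUnderBaseChange R S (MvPolynomial (Fin n) R) (MvPolynomial (Fin n) S)
    (RingHom.etale_algebraMap.mpr ‹_›)

variable {K : Type u} [CommRing K] {X : Scheme.{u}} (f : X ⟶ Spec (CommRingCat.of K))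

theorem etale_resO {Y : Scheme.{u}} {V W : Y.Opens} (hV : IsAffineOpen V) (hW : IsAffineOpen W)
    (h : W ≤ V) : (resO h : Γ(Y, V) →+* Γ(Y, W)).Etale := by
  have h1 := (𝟙 Y : Y ⟶ Y).etale_appLE hV hW h
  have h2 : (𝟙 Y : Y ⟶ Y).appLE V W h = Y.presheaf.map (homOfLE h).op := by
    simp [Scheme.Hom.appLE]
    rfl
  rw [h2] at h1
  exact h1

/-- The local structure of a smooth morphism is expressed over an affine open `U` of the base. This
passes from `K` to the functions on `U`. -/
theorem structureHom_eq {U : (Spec (CommRingCat.of K)).Opens} {V : X.Opens} (e : V ≤ f ⁻¹ᵁ U) :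
    structureHom f V = (f.appLE U V e).hom.comp ((resO (le_top : U ≤ ⊤)).comp
      (Scheme.ΓSpecIso (CommRingCat.of K)).inv.hom) := by
  have h : (Scheme.ΓSpecIso (CommRingCat.of K)).inv ≫ f.appTop ≫
      X.presheaf.map (homOfLE (le_top : V ≤ ⊤)).op =
      (Scheme.ΓSpecIso (CommRingCat.of K)).inv ≫
        (Spec (CommRingCat.of K)).presheaf.map (homOfLE (le_top : U ≤ ⊤)).op ≫ f.appLE U V e := by
    rw [Scheme.Hom.map_appLE, Scheme.Hom.appTop, Scheme.Hom.appLE]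
    rfl
  exact congrArg CommRingCat.Hom.hom h

theorem finiteType_sec [LocallyOfFiniteType f] {V : X.Opens} (hV : IsAffineOpen V) :
    Algebra.FiniteType K (Sec f V) := by
  have h1 := f.finiteType_appLE (isAffineOpen_top _) hV (by simp)
  have h2 := structureHom_eq f (U := ⊤) (V := V) (by simp)
  have h3 : (structureHom f V).FiniteType := by
    rw [h2]
    refine RingHom.FiniteType.comp h1 (RingHom.FiniteType.of_surjective _ ?_)
    intro a
    refine ⟨(Scheme.ΓSpecIso (CommRingCat.of K)).hom a, ?_⟩
    change resO _ ((Scheme.ΓSpecIso (CommRingCat.of K)).inv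
      ((Scheme.ΓSpecIso (CommRingCat.of K)).hom a)) = a
    rw [resO_self]
    simp
  exact h3

/-- The functions `t₁, …, t_n` are étale coordinates on every affine open subset of `W`. -/
def IsChart (n : ℕ) (W : X.Opens) : Prop := IsAffineOpen W ∧ ∃ t : Fin n → Sec f W,
  ∀ (V : X.Opens) (h : V ≤ W), IsAffineOpen V → IsEtaleCoord K (fun i => resSec f h (t i))

variable {f} in
theorem IsChart.mono {n : ℕ} {V W : X.Opens} (hW : IsChart f n W) (hV : IsAffineOpen V)
    (h : V ≤ W) : IsChart f n V := by
  obtain ⟨-, t, ht⟩ := hW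
  refine ⟨hV, fun i => resSec f h (t i), fun U hU hU' => ?_⟩
  have := ht U (hU.trans h) hU'
  convert this using 2 with i
  exact DFunLike.congr_fun (resSec_comp f hU h) (t i)

/-- A smooth morphism is locally étale over an affine space. On an affine `V'`, the homomorphism
`K[t] → Γ(V')` factors as `K[t] → Γ(U)[t] → Γ(V) → Γ(V')`. The first map is a base change of the
étale map `K → Γ(U)`, the second is étale by standard smoothness, and the third is restriction to an
open subset. -/
theorem exists_chart {n : ℕ} [hf : SmoothOfRelativeDimension n f] (x : X) :
    ∃ W : X.Opens, x ∈ W ∧ IsChart f n W := by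
  obtain ⟨U, hU, V, hV, hx, e, hstd⟩ :=
    hf.exists_isStandardSmoothOfRelativeDimension x
  obtain ⟨g, hgC, hg⟩ := hstd.exists_etale_mvPolynomial
  refine ⟨V, hx, hV, fun i => g (MvPolynomial.X i), fun V' h hV' => ?_⟩
  have h1 : ((resO (le_top : U ≤ ⊤)).comp
      (Scheme.ΓSpecIso (CommRingCat.of K)).inv.hom).Etale := by
    refine RingHom.Etale.stableUnderComposition _ _ (RingHom.Etale.of_bijective ?_)
      (etale_resO (isAffineOpen_top _) hU le_top)
    exact ConcreteCategory.bijective_of_isIso (Scheme.ΓSpecIso (CommRingCat.of K)).inv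
  have h2 := RingHom.Etale.stableUnderComposition _ _ (RingHom.Etale.stableUnderComposition _ _
    (etale_mvPolynomial_map h1 n) hg) (etale_resO hV hV' h)
  have h3 : ((MvPolynomial.aeval (fun i => resSec f h (g (MvPolynomial.X i))) :
      MvPolynomial (Fin n) K →ₐ[K] Sec f V') : MvPolynomial (Fin n) K →+* Sec f V') =
      (resO h).comp (g.comp (MvPolynomial.map (σ := Fin n) ((resO (le_top : U ≤ ⊤)).comp
        (Scheme.ΓSpecIso (CommRingCat.of K)).inv.hom))) := by
    refine MvPolynomial.ringHom_ext (fun c => ?_) (fun i => ?_)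
    · have h4 : structureHom f V' c = resO h (structureHom f V c) := (resO_structureHom f h c).symm
      rw [structureHom_eq f e] at h4
      have h5 : g (MvPolynomial.C (resO (le_top : U ≤ ⊤)
          ((Scheme.ΓSpecIso (CommRingCat.of K)).inv.hom c))) = _ :=
        RingHom.congr_fun hgC (resO (le_top : U ≤ ⊤)
          ((Scheme.ΓSpecIso (CommRingCat.of K)).inv.hom c))
      refine (AlgHom.commutes (MvPolynomial.aeval (fun i => resSec f h (g (MvPolynomial.X i))) :
        MvPolynomial (Fin n) K →ₐ[K] Sec f V') c).trans (h4.trans ?_)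
      change _ = resO h (g (MvPolynomial.map _ (MvPolynomial.C c)))
      rw [MvPolynomial.map_C]
      exact congrArg (resO h) h5.symm
    · have h6 : (MvPolynomial.aeval (fun i => resSec f h (g (MvPolynomial.X i))) :
        MvPolynomial (Fin n) K →ₐ[K] Sec f V') (MvPolynomial.X i) = _ := MvPolynomial.aeval_X _ i
      refine h6.trans ?_
      change _ = resO h (g (MvPolynomial.map _ (MvPolynomial.X i)))
      rw [MvPolynomial.map_X]
      rfl
  rw [IsEtaleCoord, h3]
  exact RingHom.Etale.formallyEtale h2

theorem isBasis_chart (n : ℕ) [SmoothOfRelativeDimension n f] :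
    Opens.IsBasis {W : X.Opens | IsChart f n W} := by
  rw [Opens.isBasis_iff_nbhd]
  intro U x hx
  obtain ⟨W, hxW, hW⟩ := exists_chart f (n := n) x
  obtain ⟨V, hxV, hVU, hVW⟩ := exists_affine U W x hx hxW
  exact ⟨V.1, hW.mono V.2 hVW, hxV, hVU⟩

end Charts

/-! ### Sections of `ℋom^cont(F, M)` over an affine open set by their values on a topological basis.
-/

section TopBasis
open AlgebraicGeometry CategoryTheory Opposite TopologicalSpace Limits
open scoped Topology

variable {X : Scheme.{u}}

/-- The sections `e i` of `F` over `W` restrict to a topological basis of `F(V)`, for every affine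
`V ⊆ W`: a continuous homomorphism to a discrete module is the same as a family of values on the
`e i`, which vanish if the degree of `i` is large. -/
structure IsTopBasis (F : AffineModule X) (W : X.affineOpens) {I : Type} (deg : I → ℕ)
    (e : I → F.obj W) : Prop where
  exists_hom : ∀ (V : X.affineOpens) (h : V.1 ≤ W.1) (L : Type u) [AddCommGroup L]
    [Module Γ(X, V.1) L] (ψ : I → L), (∃ m, ∀ i, m ≤ deg i → ψ i = 0) →
    ∃ φ : F.obj V →ₗ[Γ(X, V.1)] L, Continuous[F.top V, ⊥] φ ∧ ∀ i, φ (F.res h (e i)) = ψ i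
  eq_zero : ∀ (V : X.affineOpens) (h : V.1 ≤ W.1) (L : Type u) [AddCommGroup L]
    (δ : F.obj V →+ L), Continuous[F.top V, ⊥] δ →
    (∀ (a : Γ(X, V.1)) x, δ x = 0 → δ (a • x) = 0) → (∀ i, δ (F.res h (e i)) = 0) → δ = 0
  bounded : ∀ (L : Type u) [AddCommGroup L] (δ : F.obj W →+ L), Continuous[F.top W, ⊥] δ →
    ∃ m, ∀ i, m ≤ deg i → δ (e i) = 0

theorem continuous_sub_discrete {E L : Type u} [AddCommGroup L] (T : TopologicalSpace E)
    {φ ψ : E → L} (hφ : Continuous[T, ⊥] φ) (hψ : Continuous[T, ⊥] ψ) :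
    Continuous[T, ⊥] fun x => φ x - ψ x := by
  let : TopologicalSpace L := ⊥
  have : DiscreteTopology L := ⟨rfl⟩
  exact hφ.sub hψ

theorem continuous_comp_discrete {E L L' : Type u} (T : TopologicalSpace E)
    {φ : E → L} (hφ : Continuous[T, ⊥] φ) (g : L → L') : Continuous[T, ⊥] fun x => g (φ x) := by
  let : TopologicalSpace L := ⊥
  have : DiscreteTopology L := ⟨rfl⟩
  let : TopologicalSpace L' := ⊥
  exact (continuous_of_discreteTopology (f := g)).comp hφ

theorem homSections_res_apply {F : AffineModule X} {M : X.Modules} {W : X.affineOpens}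
    (s : homSections F M W.1) (V : {V : X.affineOpens // V.1 ≤ W.1}) (x : F.obj W) :
    s.1 V (F.res V.2 x) = resM M V.2 (s.1 ⟨W, le_rfl⟩ x) := s.2.1 ⟨W, le_rfl⟩ V V.2 x

variable {F : AffineModule X} {W : X.affineOpens} {I : Type} {deg : I → ℕ} {e : I → F.obj W}
  {M : X.Modules}

/-- The values on the restricted basis over a smaller affine set are restrictions of the values over
`W`, and continuous linear maps are determined there by these values. -/
theorem IsTopBasis.homSections_ext (hF : IsTopBasis F W deg e) {s s' : homSections F M W.1}
    (h : ∀ i, s.1 ⟨W, le_rfl⟩ (e i) = s'.1 ⟨W, le_rfl⟩ (e i)) : s = s' := by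
  refine CompleteHochschild.homSections_ext F M fun V x => ?_
  have h0 := hF.eq_zero V.1 V.2 _ ((s.1 V).toAddMonoidHom - (s'.1 V).toAddMonoidHom)
    (continuous_sub_discrete _ (s.2.2 V) (s'.2.2 V))
    (fun a x hx => by
      change s.1 V (a • x) - s'.1 V (a • x) = 0
      rw [map_smul, map_smul, ← smul_sub]
      exact (congrArg (a • ·) hx).trans (smul_zero a))
    (fun i => by
      change s.1 V _ - s'.1 V _ = 0
      rw [homSections_res_apply, homSections_res_apply, h, sub_self])
  exact sub_eq_zero.mp (DFunLike.congr_fun h0 x)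

/-- The prescribed values are restricted to every affine `V` and extended there linearly and
continuously. Compatibility with restriction from `V` to `V'` says that a map semilinear over `Γ(V)
→ Γ(V')` vanishes, and can be checked on the basis. For this reason `eq_zero` concerns additive maps
whose kernel is stable under scalars. Quasi-coherence of `M` is nowhere involved. -/
theorem IsTopBasis.exists_homSections (hF : IsTopBasis F W deg e) (ψ : I → Γ(M, W.1))
    (hψ : ∃ m, ∀ i, m ≤ deg i → ψ i = 0) :
    ∃ s : homSections F M W.1, ∀ i, s.1 ⟨W, le_rfl⟩ (e i) = ψ i := by
  have hb : ∀ V : {V : X.affineOpens // V.1 ≤ W.1},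
      ∃ m, ∀ i, m ≤ deg i → resM M V.2 (ψ i) = 0 := fun V =>
    hψ.imp fun m hm i hi => by rw [hm i hi, map_zero]
  choose φ hc hφ using fun V : {V : X.affineOpens // V.1 ≤ W.1} =>
    hF.exists_hom V.1 V.2 Γ(M, V.1.1) (fun i => resM M V.2 (ψ i)) (hb V)
  refine ⟨⟨φ, fun V V' h x => ?_, hc⟩, fun i => ?_⟩
  · let : TopologicalSpace Γ(M, V'.1.1) := ⊥
    have h0 := hF.eq_zero V.1 V.2 Γ(M, V'.1.1)
      ((φ V').toAddMonoidHom.comp (F.res h) - (resM M h).comp (φ V).toAddMonoidHom)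
      (continuous_sub_discrete _
        (@Continuous.comp _ _ _ (F.top V.1) (F.top V'.1) _ _ _ (hc V') (F.continuous_res h))
        (continuous_comp_discrete _ (hc V) _))
      (fun a x hx => by
        change φ V' (F.res h (a • x)) - resM M h (φ V (a • x)) = 0
        rw [F.res_smul, map_smul, map_smul, resM_smul, ← smul_sub]
        exact (congrArg (resO h a • ·) hx).trans (smul_zero _))
      (fun i => by
        change φ V' (F.res h (F.res V.2 (e i))) - resM M h (φ V (F.res V.2 (e i))) = 0
        rw [F.res_res, hφ V, hφ V', resM_resM, sub_self])
    exact sub_eq_zero.mp (DFunLike.congr_fun h0 x)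
  · have := hφ ⟨W, le_rfl⟩ i
    rw [F.res_self, resM_self] at this
    exact this

end TopBasis

/-! ### Continuous linear maps on `Ĉ_q(A)` in coordinates. -/

section ChainHoms
open MvPolynomial

variable {K A : Type u} [CommRing K] [CommRing A] [Algebra K A] {n : ℕ} {t : Fin n → A}

/-- A linear map that kills `(x)^m` factors through the truncated polynomial ring, to which Taylor
expansion maps `Ĉ_q(A)`. -/
theorem exists_chainHom (ht : IsEtaleCoord K t) (q m : ℕ) {L : Type u} [AddCommGroup L] [Module A L]
    (ψ : PolyChain A n q →ₗ[A] L) (hψ : ∀ z ∈ idealOfVars (Fin q × Fin n) A ^ m, ψ z = 0) :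
    ∃ φ : CChain K A q →ₗ[A] L, (∀ x ∈ chainIdeal K A q ^ m, φ x = 0) ∧
      ∀ z, φ (polyToChain K t q z) = ψ z := by
  let ψ' : PolyTrunc A n q m →ₗ[A] L :=
    { toFun := QuotientAddGroup.lift (idealOfVars (Fin q × Fin n) A ^ m).toAddSubgroup
        ψ.toAddMonoidHom (fun z hz => hψ z hz)
      map_add' := map_add _
      map_smul' := fun a x => by
        obtain ⟨z, rfl⟩ := Ideal.Quotient.mk_surjective x
        exact ψ.map_smul a z }
  refine ⟨ψ'.comp (chainTaylor ht q m).toLinearMap, fun x hx => ?_, fun z => ?_⟩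
  · change ψ' (chainTaylor ht q m x) = 0
    rw [chainTaylor_eq_zero ht q m x hx, map_zero]
  · change ψ' (chainTaylor ht q m (polyToChain K t q z)) = ψ z
    rw [chainTaylor_polyToChain]
    rfl

/-- Modulo the power of the ideal that `δ` kills, every chain is a polynomial, hence a combination
of monomials. -/
theorem chainHom_eq_zero [Algebra.FiniteType K A] (ht : IsEtaleCoord K t) (q m : ℕ) {L : Type u}
    [AddCommGroup L] (δ : CChain K A q →+ L) (hm : ∀ x ∈ chainIdeal K A q ^ m, δ x = 0)
    (hs : ∀ (a : A) x, δ x = 0 → δ (a • x) = 0)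
    (hδ : ∀ α, δ (polyToChain K t q (monomial α 1)) = 0) : δ = 0 := by
  ext x
  obtain ⟨z, hz⟩ := exists_polyToChain_rep ht q m x
  have h1 := hm _ hz
  rw [map_sub, sub_eq_zero] at h1
  rw [h1]
  clear hz h1
  induction z using MvPolynomial.induction_on' with
  | monomial α a =>
    rw [show monomial α a = a • (monomial α 1 : PolyChain A n q) by rw [smul_monomial, smul_eq_mul,
      mul_one], map_smul]
    exact hs a _ (hδ α)
  | add z w hz hw =>
    rw [map_add, map_add, hz, hw]
    exact add_zero _

theorem exists_pow_of_continuous_adic {R L : Type u} [CommRing R] (J : Ideal R) [AddCommGroup L]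
    (δ : R →+ L) (h : @Continuous _ _ J.adicTopology ⊥ δ) : ∃ m, ∀ x ∈ J ^ m, δ x = 0 := by
  let := J.adicTopology
  let : TopologicalSpace L := ⊥
  have : DiscreteTopology L := ⟨rfl⟩
  have h1 : δ ⁻¹' {0} ∈ nhds (0 : R) :=
    (isOpen_discrete {(0 : L)}).preimage h |>.mem_nhds (map_zero δ)
  obtain ⟨m, -, hm⟩ := J.hasBasis_nhds_zero_adic.mem_iff.mp h1
  exact ⟨m, fun x hx => hm hx⟩

/-- Restriction sends coordinates to coordinates, so only the coefficients change. In particular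
monomials restrict to monomials, which lets one family serve all smaller affine sets. -/
theorem chainMap_polyToChain {A' : Type u} [CommRing A'] [Algebra K A'] (g : A →ₐ[K] A') (q : ℕ)
    (h0 hl) (z : PolyChain A n q) :
    chainMap K g id h0 hl (polyToChain K t q z) =
      polyToChain K (fun j => g (t j)) q (MvPolynomial.map (g : A →+* A') z) := by
  have : (chainMap K g id h0 hl).comp (polyToChain K t q : PolyChain A n q →+* _) =
      (polyToChain K (fun j => g (t j)) q : PolyChain A' n q →+* CChain K A' q).comp
        (MvPolynomial.map (g : A →+* A')) := by
    refine MvPolynomial.ringHom_ext (fun a => ?_) (fun p => ?_)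
    · simp only [RingHom.comp_apply, RingHom.coe_coe, map_C]
      simp only [← algebraMap_eq, AlgHom.commutes]
      exact chainMap_algebraMap _ _ _ _ a
    · simp only [RingHom.comp_apply, RingHom.coe_coe, polyToChain_X, map_X]
      rw [chainMap_toCChain, slotDiff, slotDiff, map_sub, barMap_slot, barMap_slot]
      rfl
  exact DFunLike.congr_fun this z

end ChainHoms

/-! ### Monomials as a topological basis of the complete chains. -/

section Model
open AlgebraicGeometry CategoryTheory Opposite TopologicalSpace Limits MvPolynomial

variable {K : Type u} [CommRing K] {X : Scheme.{u}} (f : X ⟶ Spec (CommRingCat.of K))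

/-- Existence is Taylor expansion and uniqueness is the density of polynomials. The bound on the
degrees expresses continuity: a power of the adic ideal contains all monomials of high degree. -/
theorem isTopBasis_chainModule [LocallyOfFiniteType f] {n : ℕ} (W : X.affineOpens)
    (t : Fin n → Sec f W.1)
    (ht : ∀ (V : X.Opens) (h : V ≤ W.1), IsAffineOpen V →
      IsEtaleCoord K (fun i => resSec f h (t i)))
    (q : ℕ) : IsTopBasis (chainModule f q) W (I := Fin q × Fin n →₀ ℕ) Finsupp.degree
      (fun α => (polyToChain K t q (monomial α 1) : CChain K (Sec f W.1) q)) := by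
  have hres : ∀ (V : X.affineOpens) (h : V.1 ≤ W.1) (α : Fin q × Fin n →₀ ℕ),
      (chainModule f q).res h (polyToChain K t q (monomial α 1) : CChain K (Sec f W.1) q) =
      (polyToChain K (fun i => resSec f h (t i)) q (monomial α 1) : CChain K (Sec f V.1) q) := by
    intro V h α
    refine (chainMap_polyToChain (resSec f h) q rfl rfl _).trans ?_
    rw [map_monomial, map_one]
  refine ⟨fun V h L _ _ ψ ⟨m, hm⟩ => ?_, fun V h L _ δ hδ hs h0 => ?_, fun L _ δ hδ => ?_⟩
  · let : Module (Sec f V.1) L := inferInstanceAs (Module Γ(X, V.1) L)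
    obtain ⟨φ, hφ, hφ'⟩ := exists_chainHom (ht V.1 h V.2) q m
      ((basisMonomials (Fin q × Fin n) (Sec f V.1)).constr ℕ ψ) (fun z hz => by
        rw [Module.Basis.constr_apply]
        refine Finset.sum_eq_zero fun α hα => ?_
        change _ • ψ α = 0
        rw [hm α ((mem_pow_idealOfVars_iff _ _).mp hz α hα), smul_zero])
    refine ⟨φ, continuous_adic_discrete φ.toAddMonoidHom m hφ, fun α => ?_⟩
    rw [hres]
    refine (hφ' _).trans ?_
    exact (basisMonomials (Fin q × Fin n) (Sec f V.1)).constr_basis ℕ ψ α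
  · have := finiteType_sec f V.2
    obtain ⟨m, hm⟩ := exists_pow_of_continuous_adic (chainIdeal K (Sec f V.1) q) δ hδ
    exact chainHom_eq_zero (ht V.1 h V.2) q m δ hm hs fun α => by rw [← hres V h]; exact h0 α
  · obtain ⟨m, hm⟩ := exists_pow_of_continuous_adic (chainIdeal K (Sec f W.1) q) δ hδ
    refine ⟨m, fun α hα => hm _ (polyToChain_mem_pow t q m ?_)⟩
    refine (mem_pow_idealOfVars_iff _ _).mpr fun β hβ => ?_
    obtain rfl := Finset.mem_singleton.mp (support_monomial_subset hβ)
    exact hα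

/-- A discrete module with compatible bases over the affine open subsets of `W`. -/
theorem isTopBasis_of_basis {F : AffineModule X} {W : X.affineOpens} {I : Type}
    {e : I → F.obj W} (htop : ∀ V, F.top V = ⊥)
    (b : ∀ V : X.affineOpens, V.1 ≤ W.1 → Module.Basis I Γ(X, V.1) (F.obj V))
    (hb : ∀ V h i, F.res h (e i) = b V h i) : IsTopBasis F W (fun _ => 0) e := by
  refine ⟨fun V h L _ _ ψ _ => ?_, fun V h L _ δ hδ hs h0 => ?_, fun L _ δ hδ => ?_⟩
  · refine ⟨(b V h).constr ℕ ψ, ?_, fun i => ?_⟩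
    · rw [htop]
      exact continuous_bot
    · rw [hb, Module.Basis.constr_basis]
  · ext x
    induction (b V h).mem_span x using Submodule.span_induction with
    | mem x hx => obtain ⟨i, rfl⟩ := hx; rw [← hb]; exact h0 i
    | zero => rw [map_zero, map_zero]
    | add x y _ _ hx hy => rw [map_add, hx, hy, map_add]
    | smul a x _ hx => exact hs a x hx
  -- All degrees are `0`, so the bound `1` makes the condition vacuous.
  · exact ⟨1, fun i hi => absurd hi (by norm_num)⟩

end Model

/-! ### Sections over a chart as linear maps on forms and on polynomials. -/

section Bases
open AlgebraicGeometry CategoryTheory Opposite TopologicalSpace Limits MvPolynomial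

variable {K : Type u} [CommRing K] {X : Scheme.{u}} (f : X ⟶ Spec (CommRingCat.of K))

theorem isTopBasis_kaehlerModule {n : ℕ} (W : X.affineOpens) (t : Fin n → Sec f W.1)
    (ht : ∀ (V : X.Opens) (h : V ≤ W.1), IsAffineOpen V →
      IsEtaleCoord K (fun i => resSec f h (t i))) :
    IsTopBasis (kaehlerModule f) W (I := Fin n) (fun _ => 0)
      (fun j => (KaehlerDifferential.D K (Sec f W.1) (t j) : Ω[Sec f W.1⁄K])) := by
  choose b hb using fun (V : X.affineOpens) (h : V.1 ≤ W.1) => exists_kaehlerBasis (ht V.1 h V.2)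
  refine isTopBasis_of_basis (F := kaehlerModule f) (fun _ => rfl) (fun V h => b V h)
    fun V h j => ?_
  exact (kaehlerMap_D K (resSec f h) (t j)).trans (hb V h j).symm

theorem isTopBasis_formModule {n : ℕ} (W : X.affineOpens) (t : Fin n → Sec f W.1)
    (ht : ∀ (V : X.Opens) (h : V ≤ W.1), IsAffineOpen V →
      IsEtaleCoord K (fun i => resSec f h (t i)))
    (q : ℕ) : IsTopBasis (formModule f q) W (I := Set.powersetCard (Fin n) q) (fun _ => 0)
      (fun j => (exteriorPower.ιMulti_family (Sec f W.1) q
        (fun j => KaehlerDifferential.D K (Sec f W.1) (t j)) j : ⋀[Sec f W.1]^q Ω[Sec f W.1⁄K])) := by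
  choose b hb using fun (V : X.affineOpens) (h : V.1 ≤ W.1) => exists_kaehlerBasis (ht V.1 h V.2)
  refine isTopBasis_of_basis (F := formModule f q) (fun _ => rfl)
    (fun V h => (b V h).exteriorPower q) fun V h j => ?_
  refine (wedgeMap_ιMulti (resSec f h : Sec f W.1 →+* Sec f V.1) (kaehlerMap K (resSec f h)) q
    _).trans ?_
  refine Eq.trans ?_ (exteriorPower.basis_apply (Sec f V.1) q (b V h) j).symm
  refine congrArg (exteriorPower.ιMulti (Sec f V.1) q) (funext fun i => ?_)
  exact (kaehlerMap_D K (resSec f h) _).trans (hb V h _).symm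

variable {f} in
-- A continuous linear map over `W` alone determines compatible maps over all smaller affine sets.
-- Thus sections of the sheaf over `W` are continuous linear maps on `F(W)`, as they would be for a
-- quasi-coherent target.
theorem IsTopBasis.exists_homSections_linear {F : AffineModule X} {W : X.affineOpens} {I : Type}
    {deg : I → ℕ} {e : I → F.obj W} {M : X.Modules} (hF : IsTopBasis F W deg e)
    (φ : F.obj W →ₗ[Γ(X, W.1)] Γ(M, W.1)) (hφ : @Continuous _ _ (F.top W) ⊥ φ) :
    ∃ s : homSections F M W.1, s.1 ⟨W, le_rfl⟩ = φ := by
  obtain ⟨s, hs⟩ := hF.exists_homSections (fun i => φ (e i))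
    (hF.bounded _ φ.toAddMonoidHom hφ)
  refine ⟨s, LinearMap.ext fun x => ?_⟩
  have h0 := hF.eq_zero W le_rfl _ ((s.1 ⟨W, le_rfl⟩).toAddMonoidHom - φ.toAddMonoidHom)
    (continuous_sub_discrete _ (s.2.2 _) hφ)
    (fun a x hx => by
      change s.1 ⟨W, le_rfl⟩ (a • x) - φ (a • x) = 0
      rw [map_smul, map_smul, ← smul_sub]
      exact (congrArg (a • ·) hx).trans (smul_zero a))
    (fun i => by
      change s.1 ⟨W, le_rfl⟩ _ - φ _ = 0
      rw [F.res_self, hs, sub_self])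
  exact sub_eq_zero.mp (DFunLike.congr_fun h0 x)

instance secModule (M : X.Modules) (V : X.Opens) : Module (Sec f V) Γ(M, V) :=
  inferInstanceAs (Module Γ(X, V) Γ(M, V))

/-- The value of a section of `ℋom^cont(Ĉ_q(X), M)` over an affine open subset. -/
def chainValue {M : X.Modules} (W : X.affineOpens) (q : ℕ)
    (s : homSections (chainModule f q) M W.1) :
    CChain K (Sec f W.1) q →ₗ[Sec f W.1] Γ(M, W.1) where
  toFun := fun x : CChain K (Sec f W.1) q => s.1 ⟨W, le_rfl⟩ x
  map_add' x y := (s.1 ⟨W, le_rfl⟩).map_add x y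
  map_smul' a x := (s.1 ⟨W, le_rfl⟩).map_smul a x

/-- The value of a section of `ℋom(Ω^q_{X/K}, M)` over an affine open subset. -/
def formValue {M : X.Modules} (W : X.affineOpens) (q : ℕ) (s : homSections (formModule f q) M W.1) :
    ⋀[Sec f W.1]^q Ω[Sec f W.1⁄K] →ₗ[Sec f W.1] Γ(M, W.1) where
  toFun := fun x : ⋀[Sec f W.1]^q Ω[Sec f W.1⁄K] => s.1 ⟨W, le_rfl⟩ x
  map_add' x y := (s.1 ⟨W, le_rfl⟩).map_add x y
  map_smul' a x := (s.1 ⟨W, le_rfl⟩).map_smul a x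

theorem chainValue_bounded [LocallyOfFiniteType f] {n : ℕ} {M : X.Modules} (W : X.affineOpens)
    (t : Fin n → Sec f W.1) (q : ℕ) (s : homSections (chainModule f q) M W.1) :
    ∃ m, ∀ z ∈ idealOfVars (Fin q × Fin n) (Sec f W.1) ^ m,
      chainValue f W q s (polyToChain K t q z) = 0 := by
  obtain ⟨m, hm⟩ := exists_pow_of_continuous_adic (chainIdeal K (Sec f W.1) q)
    (chainValue f W q s).toAddMonoidHom (s.2.2 ⟨W, le_rfl⟩)
  exact ⟨m, fun z hz => hm _ (polyToChain_mem_pow t q m hz)⟩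

variable {f} {n : ℕ} {W : X.affineOpens} {t : Fin n → Sec f W.1}
    (ht : ∀ (V : X.Opens) (h : V ≤ W.1), IsAffineOpen V →
      IsEtaleCoord K (fun i => resSec f h (t i)))
    {M : X.Modules} {q : ℕ}

include ht

theorem formSection_ext {s s' : homSections (formModule f q) M W.1}
    (h : ∀ x, formValue f W q s x = formValue f W q s' x) : s = s' :=
  (isTopBasis_formModule f W t ht q).homSections_ext fun _ => h _

theorem exists_formSection (φ : ⋀[Sec f W.1]^q Ω[Sec f W.1⁄K] →ₗ[Sec f W.1] Γ(M, W.1)) :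
    ∃ s : homSections (formModule f q) M W.1, ∀ x, formValue f W q s x = φ x := by
  let φ' : (formModule f q).obj W →ₗ[Γ(X, W.1)] Γ(M, W.1) :=
    { toFun := fun x : ⋀[Sec f W.1]^q Ω[Sec f W.1⁄K] => φ x
      map_add' := φ.map_add
      map_smul' := φ.map_smul }
  obtain ⟨s, hs⟩ := (isTopBasis_formModule f W t ht q).exists_homSections_linear φ' continuous_bot
  exact ⟨s, fun x => LinearMap.congr_fun hs x⟩

theorem chainSection_ext [LocallyOfFiniteType f] {s s' : homSections (chainModule f q) M W.1}
    (h : ∀ z, chainValue f W q s (polyToChain K t q z) =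
      chainValue f W q s' (polyToChain K t q z)) : s = s' :=
  (isTopBasis_chainModule f W t ht q).homSections_ext fun α => h (monomial α 1)

/-- Vanishing on a power of `(x)` is the coordinate form of continuity; the values on monomials then
define the section. -/
theorem exists_chainSection [LocallyOfFiniteType f]
    (φ : PolyChain (Sec f W.1) n q →ₗ[Sec f W.1] Γ(M, W.1)) (m : ℕ)
    (hφ : ∀ z ∈ idealOfVars (Fin q × Fin n) (Sec f W.1) ^ m, φ z = 0) :
    ∃ s : homSections (chainModule f q) M W.1,
      ∀ z, chainValue f W q s (polyToChain K t q z) = φ z := by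
  obtain ⟨s, hs⟩ := (isTopBasis_chainModule f W t ht q).exists_homSections (M := M)
    (fun α => φ (monomial α 1)) ⟨m, fun α hα => hφ _ ((mem_pow_idealOfVars_iff _ _).mpr
      fun β hβ => by
        obtain rfl := Finset.mem_singleton.mp (support_monomial_subset hβ)
        exact hα)⟩
  refine ⟨s, fun z => ?_⟩
  refine LinearMap.congr_fun (f := (chainValue f W q s).comp (polyToChain K t q).toLinearMap)
    (g := φ) ?_ z
  exact (basisMonomials (Fin q × Fin n) (Sec f W.1)).ext hs

end Bases

/-! ### Composition with maps of polynomial chains as an operation on sections. -/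

section Homotopy
open AlgebraicGeometry CategoryTheory Opposite TopologicalSpace Limits MvPolynomial

variable {K : Type u} [CommRing K] {X : Scheme.{u}} (f : X ⟶ Spec (CommRingCat.of K))

theorem isUnit_sec_of_isUnit {m : ℕ} (hm : IsUnit ((m : ℕ) : K)) (V : X.Opens) :
    IsUnit ((m : ℕ) : Sec f V) := by
  have := hm.map (algebraMap K (Sec f V))
  rwa [map_natCast] at this

/-- `chainValue` as an additive map on sections of `ℋom^cont(Ĉ_q(X), M)`. -/
def chainEval (W : X.affineOpens) (q : ℕ) (M : X.Modules) :
    Γ(homCont ((chainComplex f).obj q) M, W.1) →+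
      (CChain K (Sec f W.1) q →ₗ[Sec f W.1] Γ(M, W.1)) where
  toFun s := chainValue f W q s
  map_zero' := rfl
  map_add' _ _ := rfl

/-- `formValue` as an additive map on sections of `ℋom(Ω^q_{X/K}, M)`. -/
def formEval (W : X.affineOpens) (q : ℕ) (M : X.Modules) :
    Γ(homCont ((formComplex f).obj q) M, W.1) →+
      (⋀[Sec f W.1]^q Ω[Sec f W.1⁄K] →ₗ[Sec f W.1] Γ(M, W.1)) where
  toFun s := formValue f W q s
  map_zero' := rfl
  map_add' _ _ := rfl

variable {W : X.affineOpens} {q : ℕ} {M N : X.Modules}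

theorem chainEval_post (φ : M ⟶ N) (s : Γ(homCont ((chainComplex f).obj q) M, W.1))
    (x : CChain K (Sec f W.1) q) :
    chainEval f W q N ((homContPost _ φ).app W.1 s) x = φ.app W.1 (chainEval f W q M s x) := rfl

theorem formEval_post (φ : M ⟶ N) (s : Γ(homCont ((formComplex f).obj q) M, W.1))
    (x : ⋀[Sec f W.1]^q Ω[Sec f W.1⁄K]) :
    formEval f W q N ((homContPost _ φ).app W.1 s) x = φ.app W.1 (formEval f W q M s x) := rfl

theorem chainEval_pre_boundary (s : Γ(homCont ((chainComplex f).obj q) M, W.1))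
    (x : CChain K (Sec f W.1) (q + 1)) :
    chainEval f W (q + 1) M ((homContPre ((chainComplex f).d q) M).app W.1 s) x =
      chainEval f W q M s (chainBoundary K (Sec f W.1) q x) := rfl

theorem chainEval_pre_pi (s : Γ(homCont ((formComplex f).obj q) M, W.1))
    (x : CChain K (Sec f W.1) q) :
    chainEval f W q M ((homContPre ((chainToForm f).app q) M).app W.1 s) x =
      formEval f W q M s (chainPi K (Sec f W.1) q x) := rfl

variable {f} {n : ℕ} {t : Fin n → Sec f W.1}
    (ht : ∀ (V : X.Opens) (h : V ≤ W.1), IsAffineOpen V →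
      IsEtaleCoord K (fun i => resSec f h (t i)))

include ht

theorem formEval_ext {s s' : Γ(homCont ((formComplex f).obj q) M, W.1)}
    (h : ∀ x, formEval f W q M s x = formEval f W q M s' x) : s = s' :=
  formSection_ext ht h

theorem chainEval_ext [LocallyOfFiniteType f] {s s' : Γ(homCont ((chainComplex f).obj q) M, W.1)}
    (h : ∀ z, chainEval f W q M s (polyToChain K t q z) =
      chainEval f W q M s' (polyToChain K t q z)) : s = s' :=
  chainSection_ext ht h

/-- Linear maps `Ω^q_{A/K} → A[x_{rj}]` induce maps of sections by composition. -/
theorem exists_sectionMap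
    (s : ⋀[Sec f W.1]^q Ω[Sec f W.1⁄K] →ₗ[Sec f W.1] PolyChain (Sec f W.1) n q)
    (M : X.Modules) :
    ∃ σ : Γ(homCont ((chainComplex f).obj q) M, W.1) →+ Γ(homCont ((formComplex f).obj q) M, W.1),
      ∀ F x, formEval f W q M (σ F) x = chainEval f W q M F (polyToChain K t q (s x)) := by
  have hσ : ∀ F : Γ(homCont ((chainComplex f).obj q) M, W.1),
      ∃ G : Γ(homCont ((formComplex f).obj q) M, W.1),
        ∀ x, formEval f W q M G x = chainEval f W q M F (polyToChain K t q (s x)) :=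
    fun F => exists_formSection ht
      ((chainEval f W q M F).comp ((polyToChain K t q).toLinearMap.comp s))
  choose σ hσ using hσ
  refine ⟨AddMonoidHom.mk' σ fun F G => formEval_ext ht fun x => ?_, hσ⟩
  rw [hσ, map_add, map_add, LinearMap.add_apply, LinearMap.add_apply, hσ, hσ]

/-- Linear maps that respect the filtrations by powers of the ideal of the variables induce maps of
sections by composition. -/
theorem exists_sectionHomotopy [LocallyOfFiniteType f]
    (h : PolyChain (Sec f W.1) n q →ₗ[Sec f W.1] PolyChain (Sec f W.1) n (q + 1))
    (hh : ∀ m, q < m → ∀ z ∈ idealOfVars (Fin q × Fin n) (Sec f W.1) ^ m,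
        h z ∈ idealOfVars (Fin (q + 1) × Fin n) (Sec f W.1) ^ m) (M : X.Modules) :
    ∃ η : Γ(homCont ((chainComplex f).obj (q + 1)) M, W.1) →+
        Γ(homCont ((chainComplex f).obj q) M, W.1),
      ∀ F z, chainEval f W q M (η F) (polyToChain K t q z) =
        chainEval f W (q + 1) M F (polyToChain K t (q + 1) (h z)) := by
  have hη : ∀ F : Γ(homCont ((chainComplex f).obj (q + 1)) M, W.1),
      ∃ G : Γ(homCont ((chainComplex f).obj q) M, W.1), ∀ z,
        chainEval f W q M G (polyToChain K t q z) =
          chainEval f W (q + 1) M F (polyToChain K t (q + 1) (h z)) := by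
    intro F
    obtain ⟨m, hm⟩ := chainValue_bounded f W t (q + 1) F
    refine exists_chainSection ht
      ((chainEval f W (q + 1) M F).comp ((polyToChain K t (q + 1)).toLinearMap.comp h))
      (m + q + 1) fun z hz =>
        hm _ (Ideal.pow_le_pow_right (by omega) (hh (m + q + 1) (by omega) z hz))
  choose η hη using hη
  refine ⟨AddMonoidHom.mk' η fun F G => chainEval_ext ht fun x => ?_, hη⟩
  rw [hη, map_add, map_add, LinearMap.add_apply, LinearMap.add_apply, hη, hη]

end Homotopy

/-! ### The homotopy inverse over a chart, natural in the coefficients. -/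

section Homotopy
open AlgebraicGeometry CategoryTheory Opposite TopologicalSpace Limits MvPolynomial

variable {K : Type u} [CommRing K] {X : Scheme.{u}} (f : X ⟶ Spec (CommRingCat.of K))

/-- Over an affine open set with étale coordinates, the map
`ℋom(⨁ Ω^q, M) → ℋom^cont(Ĉ(X), M)` of complexes of sections has a homotopy inverse, which is
natural in `M`. -/
theorem exists_section_homotopy [LocallyOfFiniteType f] {n : ℕ}
    (hn : IsUnit ((n.factorial : ℕ) : K)) (W : X.Opens) (hW : IsChart f n W) :
    ∃ (σ : ∀ (q : ℕ) (M : X.Modules),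
        Γ(homCont ((chainComplex f).obj q) M, W) →+ Γ(homCont ((formComplex f).obj q) M, W))
      (η : ∀ (q : ℕ) (M : X.Modules),
        Γ(homCont ((chainComplex f).obj (q + 1)) M, W) →+
          Γ(homCont ((chainComplex f).obj q) M, W)),
      (∀ q {M N : X.Modules} (φ : M ⟶ N) s, σ q N ((homContPost _ φ).app W s) =
        (homContPost _ φ).app W (σ q M s)) ∧
      (∀ q {M N : X.Modules} (φ : M ⟶ N) s, η q N ((homContPost _ φ).app W s) =
        (homContPost _ φ).app W (η q M s)) ∧
      (∀ q M y, σ q M ((homContPre ((chainToForm f).app q) M).app W y) = y) ∧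
      (∀ q M s, σ (q + 1) M ((homContPre ((chainComplex f).d q) M).app W s) = 0) ∧
      (∀ M s, s - (homContPre ((chainToForm f).app 0) M).app W (σ 0 M s) =
        η 0 M ((homContPre ((chainComplex f).d 0) M).app W s)) ∧
      (∀ q M s, s - (homContPre ((chainToForm f).app (q + 1)) M).app W (σ (q + 1) M s) =
        η (q + 1) M ((homContPre ((chainComplex f).d (q + 1)) M).app W s) +
        (homContPre ((chainComplex f).d q) M).app W (η q M s)) := by
  obtain ⟨hWa, t, ht⟩ := hW
  obtain ⟨W, rfl⟩ : ∃ W' : X.affineOpens, W'.1 = W := ⟨⟨W, hWa⟩, rfl⟩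
  have htW : IsEtaleCoord K t := by
    have := ht W.1 le_rfl hWa
    rwa [show (fun i => resSec f (le_refl W.1) (t i)) = t from funext fun i =>
      DFunLike.congr_fun (resSec_self f le_rfl) (t i)] at this
  obtain ⟨s, h, hps, hds, hh0, hh, hhm⟩ := exists_chart_homotopy htW (isUnit_sec_of_isUnit f hn W.1)
  -- The operators are transposes of the section `s` and the homotopy `h`. Since sections over `W`
  -- are determined by their values on forms or on polynomials, each assertion below is the
  -- transpose of an identity for `s` and `h`; naturality in `M` holds because coefficients are
  -- acted on from the other side.
  choose σ hσ using fun q M => exists_sectionMap ht (s q) M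
  choose η hη using fun q M => exists_sectionHomotopy ht (h q) (hhm q) M
  refine ⟨σ, η, ?_, ?_, ?_, ?_, ?_, ?_⟩
  · intro q M N φ F
    refine formEval_ext ht fun x => ?_
    rw [hσ, formEval_post, chainEval_post, hσ]
  · intro q M N φ F
    refine chainEval_ext ht fun x => ?_
    rw [hη, chainEval_post, chainEval_post, hη]
  · intro q M y
    refine formEval_ext ht fun x => ?_
    rw [hσ, chainEval_pre_pi, hps]
  · intro q M F
    refine formEval_ext ht fun x => ?_
    rw [hσ, chainEval_pre_boundary, chainBoundary_polyToChain, hds, map_zero, map_zero, map_zero]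
    rfl
  · intro M F
    refine chainEval_ext ht fun z => ?_
    rw [hη, chainEval_pre_boundary, chainBoundary_polyToChain, ← hh0, map_sub, LinearMap.sub_apply,
      chainEval_pre_pi, hσ, map_sub, map_sub]
  · intro q M F
    refine chainEval_ext ht fun z => ?_
    rw [map_add, LinearMap.add_apply, hη, chainEval_pre_boundary, chainEval_pre_boundary,
      chainBoundary_polyToChain, chainBoundary_polyToChain, hη, ← map_add, ← map_add, ← hh,
      map_sub, LinearMap.sub_apply, chainEval_pre_pi, hσ, map_sub, map_sub]

end Homotopy

/-! ### Sections of the total complex by components. -/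

section TotalSections
open AlgebraicGeometry CategoryTheory Opposite TopologicalSpace Limits

variable {X : Scheme.{u}}

/-- Evaluation of morphisms at a section. -/
def evalAt {M N : X.Modules} (W : X.Opens) (m : Γ(M, W)) : (M ⟶ N) →+ Γ(N, W) where
  toFun φ := φ.app W m
  map_zero' := rfl
  map_add' _ _ := rfl

theorem app_units_smul {M N : X.Modules} (φ : M ⟶ N) (W : X.Opens) (m : Γ(M, W)) (ε : ℤˣ) :
    (ε • φ).app W m = ε • φ.app W m := by
  rw [Units.smul_def, Units.smul_def]
  exact map_zsmul (evalAt W m) _ φ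

theorem map_units_smul {G H : Type*} [AddCommGroup G] [AddCommGroup H] (φ : G →+ H) (ε : ℤˣ)
    (g : G) : φ (ε • g) = ε • φ g := by
  rw [Units.smul_def, Units.smul_def, map_zsmul]

theorem app_map_units_smul {M N : X.Modules} (φ : M ⟶ N) (W : X.Opens) (ε : ℤˣ) (m : Γ(M, W)) :
    φ.app W (ε • m) = ε • φ.app W m :=
  map_units_smul (φ.app W).hom ε m

variable (C D : AffineComplex X) (M : CochainComplex X.Modules ℤ) (W : X.Opens)

/-- The component of a section of `ℋom^cont(C, M)` at `(q, p)`. -/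
def component {k : ℤ} (q : ℕ) (p : ℤ) (h : q + p = k) :
    Γ(totalHomX C M k, W) →+ Γ(homCont (C.obj q) (M.X p), W) :=
  ((totalHomπ C M q p h).app W).hom

variable {C D M W}

theorem component_ext {k : ℤ} {s s' : Γ(totalHomX C M k, W)}
    (h : ∀ (q : ℕ) (p : ℤ) (e : q + p = k), component C M W q p e s = component C M W q p e s') :
    s = s' :=
  pi_section_ext _ W s s' fun t => h t.1.1 t.1.2 t.2

/-- The terms of the total complex are products, and sections commute with products, so components
can be prescribed freely; no finiteness over `q` is needed for unbounded `M`. -/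
theorem exists_component {k : ℤ}
    (m : ∀ (q : ℕ) (p : ℤ), (q : ℤ) + p = k → Γ(homCont (C.obj q) (M.X p), W)) :
    ∃ s : Γ(totalHomX C M k, W), ∀ q p e, component C M W q p e s = m q p e := by
  obtain ⟨s, hs⟩ := exists_pi_section
    (fun t : {t : ℕ × ℤ // (t.1 : ℤ) + t.2 = k} => homCont (C.obj t.1.1) (M.X t.1.2)) W
    (fun t => m t.1.1 t.1.2 t.2)
  exact ⟨s, fun q p e => hs ⟨(q, p), e⟩⟩

theorem component_d_zero {k : ℤ} (p : ℤ) (h : ((0 : ℕ) : ℤ) + p = k + 1)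
    (h' : ((0 : ℕ) : ℤ) + (p - 1) = k) (s : Γ(totalHomX C M k, W)) :
    component C M W 0 p h ((totalHomD C M k).app W s) =
      (homContPost _ (M.d (p - 1) p)).app W (component C M W 0 (p - 1) h' s) :=
  congrArg (evalAt W s) (totalHomD_π_zero C M k p h)

theorem component_d_succ {k : ℤ} (q : ℕ) (p : ℤ) (h : ((q + 1 : ℕ) : ℤ) + p = k + 1)
    (h' : (q : ℤ) + p = k) (h'' : ((q + 1 : ℕ) : ℤ) + (p - 1) = k) (s : Γ(totalHomX C M k, W)) :
    component C M W (q + 1) p h ((totalHomD C M k).app W s) =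
      (homContPost _ (M.d (p - 1) p)).app W (component C M W (q + 1) (p - 1) h'' s) -
      k.negOnePow • (homContPre (C.d q) (M.X p)).app W (component C M W q p h' s) := by
  have h1 := congrArg (evalAt W s) (totalHomD_π_succ C M k q p h h')
  refine h1.trans ((map_sub (evalAt W s) _ _).trans (congrArg₂ (· - ·) rfl ?_))
  exact app_units_smul _ _ _ _

theorem component_map (φ : C.Hom D) {k : ℤ} (q : ℕ) (p : ℤ) (h : q + p = k)
    (s : Γ(totalHomX D M k, W)) :
    component C M W q p h ((totalHomMapX M φ k).app W s) =
      (homContPre (φ.app q) (M.X p)).app W (component D M W q p h s) :=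
  congrArg (evalAt W s) (totalHomMapX_π M φ q p h)

end TotalSections

theorem add_sub_one_eq {q k p : ℤ} (h : q + p = k + 1) : q + (p - 1) = k := by lia

theorem add_eq_of_succ_add {q : ℕ} {k p : ℤ} (h : ((q + 1 : ℕ) : ℤ) + p = k + 1) :
    (q : ℤ) + p = k := by
  push_cast at h
  lia

theorem succ_add_eq_of_add {q : ℕ} {k p : ℤ} (h : (q : ℤ) + p = k) :
    ((q + 1 : ℕ) : ℤ) + p = k + 1 := by
  push_cast
  lia

theorem succ_add_sub_one_eq {q : ℕ} {k p : ℤ} (h : (q : ℤ) + p = k) :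
    ((q + 1 : ℕ) : ℤ) + (p - 1) = k :=
  add_sub_one_eq (succ_add_eq_of_add h)

theorem add_eq_add_one {q k p : ℤ} (h : q + (p - 1) = k) : q + p = k + 1 := by lia

/-! ### The first assertion: arbitrary complexes of coefficients. -/

section PartOne
open AlgebraicGeometry CategoryTheory Opposite TopologicalSpace Limits

variable {K : Type u} [CommRing K] {X : Scheme.{u}} (f : X ⟶ Spec (CommRingCat.of K))

theorem formComplex_pre_d (q : ℕ) (N : X.Modules) (W : X.Opens)
    (s : Γ(homCont ((formComplex f).obj q) N, W)) :
    (homContPre ((formComplex f).d q) N).app W s = 0 :=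
  congrArg (evalAt W s) (homContPre_zero N)

theorem units_smul_smul_self {G : Type*} [AddCommGroup G] (ε : ℤˣ) (g : G) : ε • ε • g = g := by
  rw [smul_smul, Int.units_mul_self, one_smul]

variable [LocallyOfFiniteType f] {n : ℕ} (hn : IsUnit ((n.factorial : ℕ) : K)) {W : X.Opens}
  (hW : IsChart f n W) (M : CochainComplex X.Modules ℤ)

include hn hW

/-- The cocycle condition expresses `z_q ∘ ∂` through `d_M z_{q+1}`. Inserted into the homotopy
formula for `z_q`, it exhibits the difference between `z` and the image of `σ z` as a coboundary. -/
theorem totalHom_sections_surjective (i : ℤ) (z : Γ(totalHomX (chainComplex f) M (i + 1), W))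
    (hz : (totalHomD (chainComplex f) M (i + 1)).app W z = 0) :
    ∃ (y : Γ(totalHomX (formComplex f) M (i + 1), W)) (w : Γ(totalHomX (chainComplex f) M i, W)),
      (totalHomD (formComplex f) M (i + 1)).app W y = 0 ∧
      z = (totalHomMapX M (chainToForm f) (i + 1)).app W y +
        (totalHomD (chainComplex f) M i).app W w := by
  obtain ⟨σ, η, hσ, hη, hσπ, hσd, h0, h1⟩ := exists_section_homotopy f hn W hW
  have hz0 : ∀ (p : ℤ) (h : ((0 : ℕ) : ℤ) + (p - 1) = i + 1),
      (homContPost _ (M.d (p - 1) p)).app W (component _ M W 0 (p - 1) h z) = 0 := by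
    intro p h
    rw [← component_d_zero (k := i + 1) p (add_eq_add_one h), hz, map_zero]
  have hz1 : ∀ (q : ℕ) (p : ℤ) (h : ((q + 1 : ℕ) : ℤ) + (p - 1) = i + 1) (h' : (q : ℤ) + p = i + 1),
      (homContPost _ (M.d (p - 1) p)).app W (component _ M W (q + 1) (p - 1) h z) =
      (i + 1).negOnePow • (homContPre ((chainComplex f).d q) (M.X p)).app W
        (component _ M W q p h' z) := by
    intro q p h h'
    rw [← sub_eq_zero, ← component_d_succ (k := i + 1) q p (add_eq_add_one h), hz, map_zero]
  obtain ⟨y, hy⟩ := exists_component (C := formComplex f) (M := M) (W := W)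
    (fun q p e => σ q (M.X p) (component _ M W q p e z))
  -- The sign is the one in the cocycle condition `d_M z_{q+1} = (-1)^{i+1} z_q ∘ ∂`. In the other
  -- term of the differential it meets `-(-1)^i` and gives `+1`.
  obtain ⟨w, hw⟩ := exists_component (C := chainComplex f) (M := M) (W := W) (k := i)
    (fun q p e => (i + 1).negOnePow • η q (M.X p)
      (component _ M W (q + 1) p (succ_add_eq_of_add e) z))
  refine ⟨y, w, component_ext fun q p e => ?_, component_ext fun q p e => ?_⟩
  · rw [map_zero]
    rcases q with - | q
    · rw [component_d_zero (k := i + 1) p e (add_sub_one_eq e), hy, ← hσ,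
        hz0 p (add_sub_one_eq e), map_zero]
    · rw [component_d_succ (k := i + 1) q p e (add_eq_of_succ_add e) (add_sub_one_eq e), hy, ← hσ,
        hz1 q p (add_sub_one_eq e) (add_eq_of_succ_add e), formComplex_pre_d,
        map_units_smul (σ _ _), hσd, smul_zero, sub_self]
  · rw [map_add, component_map, hy, ← sub_eq_iff_eq_add']
    rcases q with - | q
    · rw [h0, component_d_zero (k := i) p e (add_sub_one_eq e), hw, app_map_units_smul, ← hη,
        hz1 0 p (succ_add_sub_one_eq e) e, map_units_smul (η _ _), units_smul_smul_self]
    · rw [h1, component_d_succ (k := i) q p e (add_eq_of_succ_add e) (add_sub_one_eq e), hw, hw,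
        app_map_units_smul, ← hη, hz1 (q + 1) p (succ_add_sub_one_eq e) e,
        map_units_smul (η _ _), units_smul_smul_self, app_map_units_smul, Int.negOnePow_succ,
        Units.neg_smul, smul_neg, units_smul_smul_self, sub_neg_eq_add]

/-- The operator `σ` is a left inverse of the map induced by `π`, kills everything of the form `f ∘
∂` and commutes with `d_M`. Applied to the equation, it shows that `y` is the coboundary of `σ w`.
-/
theorem totalHom_sections_injective (i : ℤ) (y : Γ(totalHomX (formComplex f) M (i + 1), W))
    (w : Γ(totalHomX (chainComplex f) M i, W))
    (h : (totalHomMapX M (chainToForm f) (i + 1)).app W y =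
      (totalHomD (chainComplex f) M i).app W w) :
    ∃ v : Γ(totalHomX (formComplex f) M i, W), y = (totalHomD (formComplex f) M i).app W v := by
  obtain ⟨σ, η, hσ, hη, hσπ, hσd, h0, h1⟩ := exists_section_homotopy f hn W hW
  obtain ⟨v, hv⟩ := exists_component (C := formComplex f) (M := M) (W := W)
    (fun q p e => σ q (M.X p) (component _ M W q p e w))
  refine ⟨v, component_ext fun q p e => ?_⟩
  have hy := congrArg (fun s => σ q (M.X p) (component _ M W q p e s)) h
  simp only [component_map, hσπ] at hy
  rw [hy]
  rcases q with - | q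
  · rw [component_d_zero (k := i) p e (add_sub_one_eq e),
      component_d_zero (k := i) p e (add_sub_one_eq e), hσ, hv]
  · rw [component_d_succ (k := i) q p e (add_eq_of_succ_add e) (add_sub_one_eq e),
      component_d_succ (k := i) q p e (add_eq_of_succ_add e) (add_sub_one_eq e), map_sub, hσ,
      map_units_smul (σ _ _), hσd, hv, formComplex_pre_d]

end PartOne

section PartOne
open AlgebraicGeometry CategoryTheory Opposite TopologicalSpace Limits

variable {K : Type u} [CommRing K] {X : Scheme.{u}} (f : X ⟶ Spec (CommRingCat.of K))

theorem quasiIso_totalHomMap {n : ℕ} [SmoothOfRelativeDimension n f]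
    (hn : IsUnit ((n.factorial : ℕ) : K)) (M : CochainComplex X.Modules ℤ) :
    QuasiIso (totalHomMap M (chainToForm f)) := by
  have : Smooth f := SmoothOfRelativeDimension.smooth n f
  refine quasiIso_of_sections _ (isBasis_chart f n) ?_ ?_
  · intro W hW i j k hi hk
    rw [CochainComplex.prev] at hi
    rw [CochainComplex.next] at hk
    obtain rfl : j = i + 1 := by lia
    subst hk
    rw [totalHom_d, totalHom_d, totalHom_d]
    exact totalHom_sections_surjective f hn hW M i
  · intro W hW i j k hi hk
    rw [CochainComplex.prev] at hi
    rw [CochainComplex.next] at hk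
    obtain rfl : j = i + 1 := by lia
    subst hk
    rw [totalHom_d, totalHom_d, totalHom_d]
    exact fun y w _ h => totalHom_sections_injective f hn hW M i y w h

end PartOne

/-! ### Exterior powers and duality for finite free modules. -/

section Pairing

variable {R S N P : Type u} [CommRing R] [CommRing S] [AddCommGroup N] [Module R N]
  [AddCommGroup P] [Module S P] {σ : R →+* S}

/-- If `N` is the dual of a finite free module `P`, then `⋀^q N` is the dual of `⋀^q P`. -/
theorem pairingDual_wedgeMap_bijective (hσ : Function.Bijective σ)
    {E : N →ₛₗ[σ] Module.Dual S P} (hE : Function.Bijective E) {n : ℕ}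
    (b : Module.Basis (Fin n) S P) (q : ℕ) :
    Function.Bijective fun x => exteriorPower.pairingDual S P q (wedgeMap σ E q x) := by
  -- The elements `v j` correspond to the dual basis of `b`; expanding by values on `b` shows that
  -- they span `N`.
  choose v hv using fun j => hE.2 (b.coord j)
  have hspan : Submodule.span R (Set.range v) = ⊤ := by
    refine eq_top_iff.mpr fun m _ => ?_
    choose r hr using fun j => hσ.2 (E m (b j))
    rw [show m = ∑ j, r j • v j from hE.1 (b.ext fun j => ?_)]
    · exact Submodule.sum_mem _ fun j _ => Submodule.smul_mem _ _ (Submodule.subset_span ⟨j, rfl⟩)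
    · simp [map_sum, hv, hr]
  have hspan' := exteriorPower.ιMulti_family_span_of_span (n := q) R hspan
  -- The wedge products of the dual basis pair with those of the basis as the coordinate forms. Both
  -- injectivity and surjectivity are then read off from coefficients.
  have hpair : ∀ s, exteriorPower.pairingDual S P q
      (wedgeMap σ E q (exteriorPower.ιMulti_family R q v s)) = (b.exteriorPower q).coord s := by
    intro s
    rw [exteriorPower.basis_coord, exteriorPower.ιMultiDual, exteriorPower.ιMulti_family,
      wedgeMap_ιMulti, exteriorPower.ιMulti_family]
    simp only [hv, Function.comp_def]
  refine ⟨fun x y hxy => ?_, fun φ => ?_⟩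
  · rw [← sub_eq_zero]
    have h0 : exteriorPower.pairingDual S P q (wedgeMap σ E q (x - y)) = 0 := by
      rw [map_sub, map_sub]
      exact sub_eq_zero.mpr hxy
    obtain ⟨c, hc⟩ := (Submodule.mem_span_range_iff_exists_fun R).mp
      (hspan'.ge (Submodule.mem_top : x - y ∈ ⊤))
    rw [← hc] at h0 ⊢
    refine Finset.sum_eq_zero fun t _ => ?_
    have ht := LinearMap.congr_fun h0 (b.exteriorPower q t)
    simp only [map_sum, map_smulₛₗ, hpair, LinearMap.sum_apply, LinearMap.smul_apply,
      Module.Basis.coord_apply, Module.Basis.repr_self, Finsupp.single_apply, smul_eq_mul, mul_ite,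
      mul_one, mul_zero, Finset.sum_ite_eq, Finset.mem_univ, if_true, LinearMap.zero_apply] at ht
    rw [(injective_iff_map_eq_zero σ).mp hσ.1 _ ht, zero_smul]
  · choose r hr using fun s => hσ.2 (φ (b.exteriorPower q s))
    refine ⟨∑ s, r s • exteriorPower.ιMulti_family R q v s, (b.exteriorPower q).ext fun t => ?_⟩
    simp only [map_sum, map_smulₛₗ, hpair, hr, LinearMap.sum_apply, LinearMap.smul_apply,
      Module.Basis.coord_apply, Module.Basis.repr_self, Finsupp.single_apply, smul_eq_mul, mul_ite,
      mul_one, mul_zero, Finset.sum_ite_eq, Finset.mem_univ, if_true, RingHom.id_apply]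

end Pairing

/-! ### Polyvector fields over a chart as the dual of forms, before sheafification. -/

section Presheaf
open AlgebraicGeometry CategoryTheory Opposite TopologicalSpace Limits

variable {K : Type u} [CommRing K] {X : Scheme.{u}} (f : X ⟶ Spec (CommRingCat.of K))
variable {f} {n : ℕ} {W : X.affineOpens} {t : Fin n → Sec f W.1}
    (ht : ∀ (V : X.Opens) (h : V ≤ W.1), IsAffineOpen V →
      IsEtaleCoord K (fun i => resSec f h (t i)))

include ht

/-- The differentials are free on the `dt_j` compatibly with restriction, so a linear form over `W`
alone extends uniquely to a section of the tangent sheaf. -/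
theorem evalTangent_bijective : Function.Bijective (evalTangent f (U := W.1) ⟨W, le_rfl⟩) := by
  have hb := isTopBasis_kaehlerModule f W t ht
  refine ⟨fun v w h => hb.homSections_ext fun i => DFunLike.congr_fun h _, fun φ => ?_⟩
  let φ' : (kaehlerModule f).obj W →ₗ[Γ(X, W.1)] Γ(structureModule X, W.1) :=
    { toFun := fun x : Ω[Sec f W.1⁄K] => φ x
      map_add' := φ.map_add
      map_smul' := φ.map_smul }
  obtain ⟨s, hs⟩ := hb.exists_homSections_linear φ' continuous_bot
  exact ⟨s, LinearMap.ext fun x => LinearMap.congr_fun hs x⟩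

theorem pairingForm_bijective (q : ℕ) :
    Function.Bijective (pairingForm f (U := W.1) q ⟨W, le_rfl⟩) := by
  have htW : IsEtaleCoord K t := by
    have := ht W.1 le_rfl W.2
    rwa [show (fun i => resSec f (le_refl W.1) (t i)) = t from funext fun i =>
      DFunLike.congr_fun (resSec_self f le_rfl) (t i)] at this
  obtain ⟨b, -⟩ := exists_kaehlerBasis htW
  refine pairingDual_wedgeMap_bijective ?_ (evalTangent_bijective ht) b q
  -- The scalars change along the restriction from `W` to itself, which is the identity on elements.
  exact ⟨fun a a' h => (resO_self le_rfl a).symm.trans (h.trans (resO_self le_rfl a')),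
    fun a => ⟨a, resO_self le_rfl a⟩⟩

theorem pairingSection_bijective (q : ℕ) :
    Function.Bijective (pairingSection f (U := W.1) (q := q)) := by
  refine ⟨fun x y h => (pairingForm_bijective ht q).1 (LinearMap.ext fun z => ?_), fun s => ?_⟩
  · exact congrArg (fun s => formValue f W q s z) h
  · let φ : Module.Dual (Sec f W.1) (⋀[Sec f W.1]^q Ω[Sec f W.1⁄K]) :=
      { toFun := fun x => formValue f W q s x
        map_add' := (formValue f W q s).map_add
        map_smul' := (formValue f W q s).map_smul }
    obtain ⟨x, hx⟩ := (pairingForm_bijective ht q).2 φ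
    exact ⟨x, formSection_ext ht fun z => LinearMap.congr_fun hx z⟩

end Presheaf

/-! ### Passing to the sheaf associated with `U ↦ ⋀^q Γ(T, U)`. -/

section Sheafify
open AlgebraicGeometry CategoryTheory Opposite TopologicalSpace Limits

variable {X : Scheme.{u}} (T : X.Modules) (q : ℕ)

/-- The canonical map `⋀^q Γ(T, U) → Γ(⋀^q T, U)`. -/
def toWedge (U : X.Opens) : ⋀[Γ(X, U)]^q Γ(T, U) →+ Γ(wedgeModule T q, U) :=
  ((CategoryTheory.toSheafify (Opens.grothendieckTopology X) (wedgePresheafAb T q)).app (op U)).hom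

variable {T q}

theorem toWedge_res {U V : X.Opens} (h : V ≤ U) (x : ⋀[Γ(X, U)]^q Γ(T, U)) :
    toWedge T q V (wedgeRes T q h x) = resM _ h (toWedge T q U x) :=
  ConcreteCategory.congr_hom ((CategoryTheory.toSheafify (Opens.grothendieckTopology X)
    (wedgePresheafAb T q)).naturality (homOfLE h).op) x

/-- This is the adjunction between presheaves and sheaves of modules: the morphism from the
associated sheaf restricts to the given presheaf map along the unit. -/
theorem wedgeModuleDesc_toWedge {N : X.Modules}
    (φ : ∀ U : X.Opens, ⋀[Γ(X, U)]^q Γ(T, U) →ₗ[Γ(X, U)] Γ(N, U))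
    (hφ : ∀ (U V : X.Opens) (h : V ≤ U) (x : ⋀[Γ(X, U)]^q Γ(T, U)),
      φ V (wedgeRes T q h x) = resM N h (φ U x)) (U : X.Opens) (x : ⋀[Γ(X, U)]^q Γ(T, U)) :
    (wedgeModuleDesc φ hφ).app U (toWedge T q U x) = φ U x := by
  have h := PresheafOfModules.toPresheaf_map_sheafificationHomEquiv_def (𝟙 X.ringCatSheaf.obj)
    (wedgeModuleDesc φ hφ)
  have h' := h.symm.trans (congrArg (PresheafOfModules.toPresheaf X.ringCatSheaf.obj).map
    (Equiv.apply_symm_apply (PresheafOfModules.sheafificationHomEquiv (𝟙 X.ringCatSheaf.obj)) _))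
  exact ConcreteCategory.congr_hom (NatTrans.congr_app h' (op U)) x

/-- The unit of sheafification is locally surjective. -/
theorem exists_toWedge {U : X.Opens} (s : Γ(wedgeModule T q, U)) (x : X) (hx : x ∈ U) :
    ∃ (V : X.Opens) (hV : V ≤ U), x ∈ V ∧ ∃ y, toWedge T q V y = resM _ hV s := by
  have h := Presheaf.imageSieve_mem (Opens.grothendieckTopology X)
    (CategoryTheory.toSheafify (Opens.grothendieckTopology X) (wedgePresheafAb T q)) (U := op U) s
  obtain ⟨V, i, ⟨y, hy⟩, hxV⟩ := h x hx
  exact ⟨V, i.le, hxV, y, hy⟩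

end Sheafify

/-! ### The second assertion: polyvector fields. -/

section PartTwo
open AlgebraicGeometry CategoryTheory Opposite TopologicalSpace Limits

variable {K : Type u} [CommRing K] {X : Scheme.{u}} (f : X ⟶ Spec (CommRingCat.of K))

theorem wedgeDual_toWedge {q : ℕ} (U : X.Opens)
    (x : ⋀[Γ(X, U)]^q Γ(tangentModule f, U)) :
    (wedgeDual f q).app U (toWedge _ q U x) = pairingSection f x :=
  wedgeModuleDesc_toWedge _ _ U x

/-- Over a chart, `⋀^q 𝒯_{X/K}` is the dual of `Ω^q_{X/K}`. -/
theorem wedgeDual_bijective {n : ℕ} {W : X.Opens} (hW : IsChart f n W) (q : ℕ) :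
    Function.Bijective ((wedgeDual f q).app W) := by
  refine ⟨(injective_iff_map_eq_zero ((wedgeDual f q).app W).hom).mpr fun y hy => ?_, fun s => ?_⟩
  · refine section_ext_of_locally _ _ _ fun x hx => ?_
    -- For injectivity, `y` comes locally from the presheaf. On a smaller chart the presheaf map is
    -- injective, so the local representative vanishes.
    obtain ⟨V, hV, hxV, a, ha⟩ := exists_toWedge y x hx
    obtain ⟨V', hV', hxV', hVV'⟩ :=
      (Opens.isBasis_iff_nbhd.mp X.isBasis_affineOpens) hxV
    refine ⟨V', hVV'.trans hV, hxV', ?_⟩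
    obtain ⟨t, ht⟩ := (hW.mono hV' (hVV'.trans hV)).2
    have ha' : toWedge _ q V' (wedgeRes _ q hVV' a) = resM _ (hVV'.trans hV) y := by
      rw [toWedge_res, ha, resM_resM]
    have h0 : pairingSection f (wedgeRes (tangentModule f) q hVV' a) = 0 := by
      rw [← wedgeDual_toWedge, ha', app_resM]
      exact (congrArg (resM _ _) hy).trans (map_zero _)
    have h1 := (pairingSection_bijective (W := ⟨V', hV'⟩) ht q).1
      (h0.trans (show 0 = pairingSection f 0 by
        rw [← wedgeDual_toWedge, map_zero, map_zero]; rfl))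
    rw [← ha', h1, map_zero, map_zero]
  · obtain ⟨hWa, t, ht⟩ := hW
    -- For surjectivity no localization is needed, since the presheaf map is already onto over the
    -- chart.
    obtain ⟨x, hx⟩ := (pairingSection_bijective (W := ⟨W, hWa⟩) ht q).2 s
    exact ⟨toWedge _ q W x, (wedgeDual_toWedge f W x).trans hx⟩

theorem piCd_app (q : ℕ) (W : X.Opens) (y : Γ(wedgeModule (tangentModule f) q, W)) :
    ((piCd f).f q).app W y = (homContPre ((chainToForm f).app q) (structureModule X)).app W
      ((wedgeDual f q).app W y) := rfl

theorem cochainComplex_d_app (q : ℕ) (W : X.Opens)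
    (w : Γ(homCont ((chainComplex f).obj q) (structureModule X), W)) :
    ((cochainComplex f).d q (q + 1)).app W w =
      (-1 : ℤˣ) ^ (q + 1) • (homContPre ((chainComplex f).d q) (structureModule X)).app W w := by
  rw [cochainComplex_d]
  exact app_units_smul _ _ _ _

theorem polyvectorComplex_d_app (i j : ℕ) (W : X.Opens) (y : Γ((polyvectorComplex f).X i, W)) :
    ((polyvectorComplex f).d i j).app W y = 0 := by
  by_cases h : i + 1 = j
  · subst h
    rw [polyvectorComplex_d]
    rfl
  · rw [(polyvectorComplex f).shape i j h]
    rfl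

theorem smul_eq_zero_units {G : Type*} [AddCommGroup G] {ε : ℤˣ} {g : G} (h : ε • g = 0) :
    g = 0 := by
  rw [← units_smul_smul_self ε g, h, smul_zero]

variable [LocallyOfFiniteType f] {n : ℕ} (hn : IsUnit ((n.factorial : ℕ) : K)) {W : X.Opens}
  (hW : IsChart f n W)

include hn hW

/-- The homotopy formula with coefficients `𝒪_X`: the cocycle condition removes `η (z ∘ ∂)`, leaving
the image of `σ z` and a coboundary. The form-valued part `σ z` is then represented by a polyvector
field. -/
theorem piCd_sections_surjective (i j : ℕ) (hi : (ComplexShape.up ℕ).prev j = i)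
    (z : Γ((cochainComplex f).X j, W)) (hz : ((cochainComplex f).d j (j + 1)).app W z = 0) :
    ∃ (y : Γ((polyvectorComplex f).X j, W)) (w : Γ((cochainComplex f).X i, W)),
      z = ((piCd f).f j).app W y + ((cochainComplex f).d i j).app W w := by
  obtain ⟨σ, η, -, -, -, -, h0, h1⟩ := exists_section_homotopy f hn W hW
  have hz' : (homContPre ((chainComplex f).d j) (structureModule X)).app W z = 0 :=
    smul_eq_zero_units ((cochainComplex_d_app f j W z).symm.trans hz)
  obtain ⟨y, hy⟩ := (wedgeDual_bijective f hW j).2 (σ j _ z)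
  rcases j with - | j
  -- In degree `0` there is no incoming coboundary, and `z` itself comes from `σ z`.
  · refine ⟨y, 0, ?_⟩
    rw [map_zero, add_zero]
    refine Eq.trans ?_ (piCd_app f 0 W y).symm
    rw [hy]
    refine sub_eq_zero.mp ?_
    exact (h0 _ z).trans ((congrArg _ hz').trans (map_zero _))
  · obtain rfl : i = j := hi.symm.trans (CochainComplex.prev_nat_succ _)
    refine ⟨y, (-1 : ℤˣ) ^ (i + 1) • η i _ z, ?_⟩
    refine Eq.trans ?_ (congrArg₂ (· + ·) (piCd_app f (i + 1) W y)
      (cochainComplex_d_app f i W _)).symm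
    rw [hy, app_map_units_smul, units_smul_smul_self]
    refine sub_eq_iff_eq_add'.mp ((h1 i _ z).trans ?_)
    rw [hz', map_zero, zero_add]

/-- Apply `σ`: it recovers the linear form on `Ω^j` defined by `y` and kills coboundaries. The form
determines the polyvector field over a chart. -/
theorem piCd_sections_injective (i j : ℕ) (hi : (ComplexShape.up ℕ).prev j = i)
    (y : Γ((polyvectorComplex f).X j, W)) (w : Γ((cochainComplex f).X i, W))
    (h : ((piCd f).f j).app W y = ((cochainComplex f).d i j).app W w) : y = 0 := by
  obtain ⟨σ, η, -, -, hσπ, hσd, -, -⟩ := exists_section_homotopy f hn W hW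
  have hy : (wedgeDual f j).app W y = σ j _ (((cochainComplex f).d i j).app W w) :=
    (hσπ j _ _).symm.trans (congrArg (σ j _) ((piCd_app f j W y).symm.trans h))
  refine (injective_iff_map_eq_zero ((wedgeDual f j).app W).hom).mp (wedgeDual_bijective f hW j).1 y
    (hy.trans ?_)
  rcases j with - | j
  · rw [(cochainComplex f).shape i 0 (Nat.succ_ne_zero i)]
    exact map_zero _
  · obtain rfl : i = j := hi.symm.trans (CochainComplex.prev_nat_succ _)
    refine (congrArg (σ (i + 1) _) (cochainComplex_d_app f i W w)).trans ?_
    rw [map_units_smul (σ _ _)]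
    exact (congrArg _ (hσd i _ w)).trans (smul_zero _)

end PartTwo

section PartTwo
open AlgebraicGeometry CategoryTheory Opposite TopologicalSpace Limits

variable {K : Type u} [CommRing K] {X : Scheme.{u}} (f : X ⟶ Spec (CommRingCat.of K))

theorem quasiIso_piCd {n : ℕ} [SmoothOfRelativeDimension n f]
    (hn : IsUnit ((n.factorial : ℕ) : K)) : QuasiIso (piCd f) := by
  -- Smoothness supplies local finite type, on which the density of polynomials in the complete
  -- chains rests.
  have : Smooth f := SmoothOfRelativeDimension.smooth n f
  refine quasiIso_of_sections _ (isBasis_chart f n) ?_ ?_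
  · intro W hW i j k hi hk z hz
    rw [CochainComplex.next] at hk
    subst hk
    obtain ⟨y, w, h⟩ := piCd_sections_surjective f hn hW i j hi z hz
    exact ⟨y, w, polyvectorComplex_d_app f _ _ W y, h⟩
  · intro W hW i j k hi hk y w _ h
    -- The source has zero differential, so being a coboundary means being zero.
    exact ⟨0, (piCd_sections_injective f hn hW i j hi y w h).trans
      (polyvectorComplex_d_app f _ _ W _).symm⟩

end PartTwo

end
end CompleteHochschild

theorem theorem0p2 (K : Type u) [CommRing K] [IsNoetherianRing K]
    (X : AlgebraicGeometry.Scheme.{u})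
    (f : X ⟶ AlgebraicGeometry.Spec (CommRingCat.of K)) (n : ℕ)
    [AlgebraicGeometry.IsSeparated f] [AlgebraicGeometry.SmoothOfRelativeDimension n f]
    (hn : IsUnit ((n.factorial : ℕ) : K)) :
    (∀ M : CochainComplex X.Modules ℤ,
      QuasiIso (CompleteHochschild.totalHomMap M (CompleteHochschild.chainToForm f))) ∧
    QuasiIso (CompleteHochschild.piCd f) :=
  ⟨fun M => CompleteHochschild.quasiIso_totalHomMap f hn M, CompleteHochschild.quasiIso_piCd f hn⟩
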